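/- Let $L>0$. Let $\mathcal H=L^2([-L,L],\frac{d\lambda}{\sqrt{2\pi}})$, whose elements are also regarded as functions on $\mathbb R$ vanishing outside $[-L,L]$, and let $\mathbb R$ act on $\mathcal H$ by the unitaries $(f(g)\phi)(\lambda)=e^{i\lambda g}\phi(\lambda)$. Let $\mathcal S(\mathcal H)$ be the set of density operators on $\mathcal H$, and let $\mathcal M_{\rm cov}(\mathbb R)$ be the set of POVMs $M$ on the Borel sets of $\mathbb R$ with values in the operators on $\mathcal H$ that are covariant, i.e. $f(g)M(B)f(g)^\dagger=M(g+B)$. Put $$\mathcal D_R(\rho,M)=\sup_{g\in\mathbb R}\int_{\mathbb R}(\hat g-g)^2\,\mathrm{Tr}\,f(g)\rho f(g)^\dagger M(d\hat g)\in[0,\infty].$$ Let $\mathcal F^{-1}[\phi](\hat g)=\int_{-L}^{L}e^{-i\lambda \hat g}\phi(\lambda)\frac{d\lambda}{\sqrt{2\pi}}$. For the momentum operator $P=-i\frac{d}{d\lambda}$ on $L^2(\mathbb R,\frac{d\lambda}{\sqrt{2\pi}})$, let $\langle\phi|P^2|\phi\rangle=\|P\phi\|^2$ if (the zero extension of) $\phi$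 has a weak derivative in $L^2(\mathbb R)$, and $\langle\phi|P^2|\phi\rangle=\infty$ otherwise. **Theorem.** The following four minima exist and $$\min_{\rho\in\mathcal S(\mathcal H),\,M\in\mathcal M_{\rm cov}(\mathbb R)}\mathcal D_R(\rho,M) =\min_{(p_i),(\rho_i),(M_i)}\sum_i p_i\,\mathcal D_R(\rho_i,M_i) =\min_{\|\phi\|=1}\int_{\mathbb R}\hat g^2\,|\mathcal F^{-1}[\phi](\hat g)|^2\frac{d\hat g}{\sqrt{2\pi}} =\min_{\|\phi\|=1}\langle\phi|P^2|\phi\rangle=\frac{\pi^2}{4L^2},$$ where in the second minimum $(p_i)$ runs over the probability distributions on a countable index set, $\rho_i\in\mathcal S(\mathcal H)$ and $M_i\in\mathcal M_{\rm cov}(\mathbb R)$, and in the last two minima $\phi\in\mathcal H$. Let $$\phi_0(\lambda)=\frac{(2\pi)^{1/4}}{\sqrt L}\sin\frac{\pi(1+\lambda/L)}{2}\qquad(|\lambda|\le L).$$ 1. $\|\phi_0\|=1$, and each of the last two minima is attained exactly by the unit vectors $\phi=c\,\phi_0$ with $c\in\mathbb C$, $|c|=1$. 2. There is a covariant POVM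 $M_0$ with $M_0(B)=\int_B f(g)|\mathcal I\rangle\langle\mathcal I|f(g)^\dagger\frac{dg}{\sqrt{2\pi}}$ (weakly), where $\mathcal I$ is the constant function $1$ on $[-L,L]$; and for $\rho\in\mathcal S(\mathcal H)$, $\mathcal D_R(\rho,M_0)=\frac{\pi^2}{4L^2}$ if and only if $\rho=|\phi_0\rangle\langle\phi_0|$. 3. For $\rho\in\mathcal S(\mathcal H)$, some $M\in\mathcal M_{\rm cov}(\mathbb R)$ satisfies $\mathcal D_R(\rho,M)=\frac{\pi^2}{4L^2}$ if and only if $\rho=|\psi\rangle\langle\psi|$ with $|\psi|=|\phi_0|$ almost everywhere on $[-L,L]$. A choice of $(p_i,\rho_i,M_i)$ attains the second minimum if and only if $\mathcal D_R(\rho_i,M_i)=\frac{\pi^2}{4L^2}$ for every $i$ with $p_i\neq0$. 4. $\mathcal F^{-1}[\phi_0](\hat g)=-\frac{\pi^{3/4}\sqrt L}{2^{1/4}}\,\frac{\cos L\hat g}{L^2\hat g^2-\pi^2/4}$ whenever $L^2\hat g^2\ne\pi^2/4$. -/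

import Mathlib

open MeasureTheory
open scoped ENNReal InnerProductSpace

noncomputable section

namespace GroupEstimation

/-! ### States, measurements and errors on a general Hilbert space -/

section General

variable {H : Type*} [NormedAddCommGroup H] [InnerProductSpace ℂ H] [CompleteSpace H]

/-- A (chosen) orthonormal basis of the Hilbert space `H`. -/
def onb (H : Type*) [NormedAddCommGroup H] [InnerProductSpace ℂ H] [CompleteSpace H] :
    HilbertBasis (exists_hilbertBasis ℂ H).choose ℂ H :=
  (exists_hilbertBasis ℂ H).choose_spec.choose

/-- The trace `Tr A = ∑ᵢ ⟨eᵢ, A eᵢ⟩` (for trace class `A` it does not depend on the basis). -/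
def opTrace (A : H →L[ℂ] H) : ℂ := ∑' i, ⟪onb H i, A (onb H i)⟫_ℂ

/-- Density operators: positive operators of trace one. -/
structure DensityOperator (H : Type*) [NormedAddCommGroup H] [InnerProductSpace ℂ H]
    [CompleteSpace H] where
  op : H →L[ℂ] H
  isPositive : op.IsPositive
  trace_eq_one : opTrace op = 1

/-- The operator `|φ⟩⟨φ|`. -/
def ketbra (φ : H) : H →L[ℂ] H := InnerProductSpace.rankOne ℂ φ φ

/-- Positive operator valued measures on the real line (`M B` is meaningful for Borel sets `B`,
and countable additivity is in the weak operator topology). -/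
structure POVM (H : Type*) [NormedAddCommGroup H] [InnerProductSpace ℂ H] where
  toFun : Set ℝ → (H →L[ℂ] H)
  isPositive : ∀ B, MeasurableSet B → (toFun B).IsPositive
  map_univ : toFun Set.univ = ContinuousLinearMap.id ℂ H
  hasSum_iUnion : ∀ B : ℕ → Set ℝ, (∀ n, MeasurableSet (B n)) →
    Pairwise (Function.onFun Disjoint B) → ∀ x y : H,
      HasSum (fun n => ⟪x, toFun (B n) y⟫_ℂ) ⟪x, toFun (⋃ n, B n) y⟫_ℂ

instance : CoeFun (POVM H) (fun _ => Set ℝ → (H →L[ℂ] H)) := ⟨POVM.toFun⟩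

/-- Covariance of a POVM with respect to unitaries `f g`, `g ∈ ℝ`:
`f(g) M(B) f(g)† = M(g + B)`. -/
def POVM.IsCovariant (f : ℝ → unitary (H →L[ℂ] H)) (M : POVM H) : Prop :=
  ∀ (g : ℝ) (B : Set ℝ), MeasurableSet B →
    (f g : H →L[ℂ] H) * M B * star (f g : H →L[ℂ] H) = M ((fun x => g + x) '' B)

theorem hasSum_normSq_inner {H : Type*} [NormedAddCommGroup H] [InnerProductSpace ℂ H] {ι : Type*} (b : HilbertBasis ι ℂ H) (x : H) :
    HasSum (fun i => ‖⟪b i, x⟫_ℂ‖ ^ 2) (‖x‖ ^ 2) := by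
  have h := Complex.hasSum_re (b.hasSum_inner_mul_inner x x)
  have h1 : (⟪x, x⟫_ℂ).re = ‖x‖ ^ 2 := by
    rw [inner_self_eq_norm_sq_to_K]
    norm_cast
  have h2 : ∀ i, (⟪x, b i⟫_ℂ * ⟪b i, x⟫_ℂ).re = ‖⟪b i, x⟫_ℂ‖ ^ 2 := by
    intro i
    rw [← inner_conj_symm x (b i), mul_comm, Complex.mul_conj, Complex.ofReal_re,
      Complex.normSq_eq_norm_sq]
  simpa only [h1, h2] using h

/-- If `X` is a Hilbert-Schmidt operator, then `Tr X X† A = ∑ⱼ ⟨X eⱼ, A X eⱼ⟩`. -/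
theorem hasSum_trace_mul {ι : Type*} (b : HilbertBasis ι ℂ H) (X A : H →L[ℂ] H)
    (hX : Summable fun j => ‖X (b j)‖ ^ 2) :
    HasSum (fun j => ⟪X (b j), A (X (b j))⟫_ℂ) (∑' i, ⟪b i, (X * star X * A) (b i)⟫_ℂ) := by
  set F : ι × ι → ℂ := fun p => ⟪X (b p.1), A (b p.2)⟫_ℂ * ⟪b p.2, X (b p.1)⟫_ℂ with hF
  have hA : ∀ x y, ⟪x, A y⟫_ℂ = ⟪star A x, y⟫_ℂ := fun x y => by
    rw [ContinuousLinearMap.star_eq_adjoint, ContinuousLinearMap.adjoint_inner_left]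
  have hX1 : Summable fun p : ι × ι => ‖⟪b p.2, X (b p.1)⟫_ℂ‖ ^ 2 := by
    rw [summable_prod_of_nonneg (fun _ => by positivity)]
    exact ⟨fun j => (hasSum_normSq_inner b (X (b j))).summable, by
      simpa only [(hasSum_normSq_inner b _).tsum_eq] using hX⟩
  have hX2 : Summable fun p : ι × ι => ‖⟪b p.2, star A (X (b p.1))⟫_ℂ‖ ^ 2 := by
    rw [summable_prod_of_nonneg (fun _ => by positivity)]
    refine ⟨fun j => (hasSum_normSq_inner b (star A (X (b j)))).summable, ?_⟩
    simp only [(hasSum_normSq_inner b _).tsum_eq]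
    refine Summable.of_nonneg_of_le (fun _ => by positivity) (fun j => ?_)
      (hX.mul_left (‖star A‖ ^ 2))
    rw [← mul_pow]
    gcongr
    exact (star A).le_opNorm _
  have hFs : Summable F := by
    refine Summable.of_norm_bounded (hX1.add hX2) (fun p => ?_)
    rw [hF]
    simp only [norm_mul]
    rw [hA, norm_inner_symm (star A (X (b p.1)))]
    nlinarith [sq_nonneg (‖⟪b p.2, X (b p.1)⟫_ℂ‖ - ‖⟪b p.2, star A (X (b p.1))⟫_ℂ‖),
      sq_nonneg (‖⟪b p.2, X (b p.1)⟫_ℂ‖), sq_nonneg (‖⟪b p.2, star A (X (b p.1))⟫_ℂ‖)]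
  have h1 : ∀ j, HasSum (fun i => F (j, i)) ⟪X (b j), A (X (b j))⟫_ℂ := by
    intro j
    simp only [hF, hA]
    exact b.hasSum_inner_mul_inner _ _
  have h2 : ∀ i, HasSum (fun j => F (j, i)) ⟪b i, (X * star X * A) (b i)⟫_ℂ := by
    intro i
    have h := b.hasSum_inner_mul_inner (star X (b i)) (star X (A (b i)))
    have e1 : ∀ x y, ⟪star X x, y⟫_ℂ = ⟪x, X y⟫_ℂ := fun x y => by
      rw [ContinuousLinearMap.star_eq_adjoint, ContinuousLinearMap.adjoint_inner_left]
    have e2 : ∀ x y, ⟪x, star X y⟫_ℂ = ⟪X x, y⟫_ℂ := fun x y => by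
      rw [ContinuousLinearMap.star_eq_adjoint, ContinuousLinearMap.adjoint_inner_right]
    simp only [e1, e2] at h
    refine (h.congr_fun ?_)
    intro j
    exact mul_comm _ _
  have h3 := hFs.hasSum.prod_fiberwise h1
  have h4 : HasSum (fun i => ⟪b i, (X * star X * A) (b i)⟫_ℂ) (∑' p, F p) :=
    ((Equiv.prodComm ι ι).hasSum_iff.mpr hFs.hasSum).prod_fiberwise h2
  rwa [h4.tsum_eq]

theorem DensityOperator.exists_factor (ρ : DensityOperator H) :
    ∃ S : H →L[ℂ] H, ρ.op = S * star S ∧ HasSum (fun j => ‖S (onb H j)‖ ^ 2) 1 := by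
  have h0 : 0 ≤ ρ.op := (ContinuousLinearMap.nonneg_iff_isPositive _).2 ρ.isPositive
  have hs : star (CFC.sqrt ρ.op) = CFC.sqrt ρ.op :=
    (IsSelfAdjoint.of_nonneg (CFC.sqrt_nonneg ρ.op)).star_eq
  have hm : ρ.op = CFC.sqrt ρ.op * star (CFC.sqrt ρ.op) := by
    rw [hs, CFC.sqrt_mul_sqrt_self ρ.op h0]
  have hi : ∀ x, ⟪x, ρ.op x⟫_ℂ = ((‖CFC.sqrt ρ.op x‖ ^ 2 : ℝ) : ℂ) := by
    intro x
    have : ρ.op x = star (CFC.sqrt ρ.op) (CFC.sqrt ρ.op x) := by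
      rw [hs, ← mul_apply_eq_comp, CFC.sqrt_mul_sqrt_self ρ.op h0]
    rw [this, ContinuousLinearMap.star_eq_adjoint, ContinuousLinearMap.adjoint_inner_right,
      inner_self_eq_norm_sq_to_K]
    norm_cast
  refine ⟨CFC.sqrt ρ.op, hm, ?_⟩
  have ht := ρ.trace_eq_one
  rw [opTrace] at ht
  simp only [hi] at ht
  have hsum : Summable fun j => ((‖CFC.sqrt ρ.op (onb H j)‖ ^ 2 : ℝ) : ℂ) := by
    by_contra hc
    rw [tsum_eq_zero_of_not_summable hc] at ht
    exact zero_ne_one ht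
  have := hsum.hasSum
  rw [ht, ← Complex.ofReal_one] at this
  exact Complex.hasSum_ofReal.mp this

/-- The unitary evolution `ρ ↦ U ρ U†`. -/
def DensityOperator.evolve (U : unitary (H →L[ℂ] H)) (ρ : DensityOperator H) :
    DensityOperator H where
  op := (U : H →L[ℂ] H) * ρ.op * star (U : H →L[ℂ] H)
  isPositive := by
    rw [← ContinuousLinearMap.nonneg_iff_isPositive]
    exact star_right_conjugate_nonneg
      ((ContinuousLinearMap.nonneg_iff_isPositive _).2 ρ.isPositive) _
  trace_eq_one := by
    obtain ⟨S, hS, hsum⟩ := ρ.exists_factor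
    have hU : ∀ x, ‖(U : H →L[ℂ] H) x‖ = ‖x‖ := fun x => by
      exact ContinuousLinearMap.norm_map_of_mem_unitary U.2 x
    have h := hasSum_trace_mul (onb H) ((U : H →L[ℂ] H) * S) 1
      (by simpa [hU] using hsum.summable)
    have h1 : (U : H →L[ℂ] H) * S * star ((U : H →L[ℂ] H) * S) * 1
        = (U : H →L[ℂ] H) * ρ.op * star (U : H →L[ℂ] H) := by
      rw [hS, star_mul, mul_one]
      simp only [mul_assoc]
    rw [h1] at h
    have h2 : ∀ j, ⟪((U : H →L[ℂ] H) * S) (onb H j),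
        (1 : H →L[ℂ] H) (((U : H →L[ℂ] H) * S) (onb H j))⟫_ℂ
          = ((‖S (onb H j)‖ ^ 2 : ℝ) : ℂ) := by
      intro j
      rw [one_apply_eq_self, inner_self_eq_norm_sq_to_K,
        mul_apply_eq_comp, hU]
      norm_cast
    simp only [h2] at h
    have h3 : HasSum (fun j => ((‖S (onb H j)‖ ^ 2 : ℝ) : ℂ)) ((1 : ℝ) : ℂ) := by
      exact_mod_cast hsum
    simpa [opTrace] using h.unique h3

theorem POVM.empty_eq_zero {H : Type*} [NormedAddCommGroup H] [InnerProductSpace ℂ H] (M : POVM H) : M ∅ = 0 := by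
  ext y
  refine ext_inner_left ℂ (fun x => ?_)
  have h := M.hasSum_iUnion (fun _ => ∅) (fun _ => MeasurableSet.empty)
    (fun _ _ _ => by simp [Function.onFun]) x y
  have h2 := h.summable.tendsto_atTop_zero
  have h3 := tendsto_nhds_unique h2 tendsto_const_nhds
  simpa using h3.symm

theorem ofReal_trace_eq (ρ : DensityOperator H) (S : H →L[ℂ] H) (hS : ρ.op = S * star S)
    (hsum : HasSum (fun j => ‖S (onb H j)‖ ^ 2) 1) (A : H →L[ℂ] H) (hA : A.IsPositive) :
    ENNReal.ofReal (opTrace (ρ.op * A)).re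
      = ∑' j, ENNReal.ofReal (⟪S (onb H j), A (S (onb H j))⟫_ℂ).re := by
  have h := Complex.hasSum_re (hasSum_trace_mul (onb H) S A hsum.summable)
  rw [← ENNReal.ofReal_tsum_of_nonneg _ h.summable, h.tsum_eq, hS, opTrace]
  intro j
  exact hA.re_inner_nonneg_right _

/-- The distribution `B ↦ Tr ρ M(B)` of the outcome when `M` is measured in the state `ρ`. -/
def outcomeMeasure (ρ : DensityOperator H) (M : POVM H) : Measure ℝ :=
  Measure.ofMeasurable (fun B _ => ENNReal.ofReal (opTrace (ρ.op * M B)).re)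
    (by simp [M.empty_eq_zero, opTrace])
    (by
      intro B hB hd
      obtain ⟨S, hS, hsum⟩ := ρ.exists_factor
      rw [ofReal_trace_eq ρ S hS hsum _ (M.isPositive _ (MeasurableSet.iUnion hB))]
      simp only [fun n => ofReal_trace_eq ρ S hS hsum _ (M.isPositive _ (hB n))]
      rw [ENNReal.tsum_comm]
      congr 1
      ext j
      have h := Complex.hasSum_re (M.hasSum_iUnion B hB hd (S (onb H j)) (S (onb H j)))
      rw [← h.tsum_eq, ENNReal.ofReal_tsum_of_nonneg _ h.summable]
      intro n
      exact (M.isPositive _ (hB n)).re_inner_nonneg_right _)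

/-- The mean squared error at the true value `g`:
`∫ (ĝ - g)² Tr f(g) ρ f(g)† M(dĝ)`. -/
def errorAt (f : ℝ → unitary (H →L[ℂ] H)) (ρ : DensityOperator H) (M : POVM H) (g : ℝ) : ℝ≥0∞ :=
  ∫⁻ y, ENNReal.ofReal ((y - g) ^ 2) ∂(outcomeMeasure (ρ.evolve (f g)) M)

/-- The worst case mean squared error `D_R(ρ, M)` over all true values `g`,
for the risk function `R(g, ĝ) = (ĝ - g)²`. -/
def worstError (f : ℝ → unitary (H →L[ℂ] H)) (ρ : DensityOperator H) (M : POVM H) : ℝ≥0∞ :=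
  ⨆ g : ℝ, errorAt f ρ M g

/-- The error of the stochastic strategy which inputs `ρ i` with probability `p i` and then
applies the measurement `M i`. -/
def stochasticError (f : ℝ → unitary (H →L[ℂ] H)) (p : PMF ℕ) (ρ : ℕ → DensityOperator H)
    (M : ℕ → POVM H) : ℝ≥0∞ :=
  ∑' i, p i * worstError f (ρ i) (M i)

end General

/-! ### The wave functions supported in an interval -/

/-- The measure `dλ / √(2π)` on the real line. -/
def normMeasure : Measure ℝ := ENNReal.ofReal (1 / Real.sqrt (2 * Real.pi)) • volume

instance : IsFiniteMeasureOnCompacts normMeasure := by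
  unfold normMeasure
  exact IsFiniteMeasureOnCompacts.smul _ ENNReal.ofReal_ne_top

/-- The measure `dλ / √(2π)` on `[-L, L]`. -/
def intervalMeasure (L : ℝ) : Measure ℝ := normMeasure.restrict (Set.Icc (-L) L)

instance (L : ℝ) : IsFiniteMeasure (intervalMeasure L) :=
  ⟨by
    rw [intervalMeasure, Measure.restrict_apply_univ]
    exact isCompact_Icc.measure_lt_top⟩

/-- The Hilbert space `L²([-L, L], dλ / √(2π))`. -/
abbrev WaveSpace (L : ℝ) : Type := Lp ℂ 2 (intervalMeasure L)

/-- A wave function on `[-L, L]`, extended by zero to the real line. -/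
def extend {L : ℝ} (φ : WaveSpace L) : ℝ → ℂ := (Set.Icc (-L) L).indicator φ

/-- The character `λ ↦ e^{iλg}`. -/
def character (g : ℝ) (x : ℝ) : ℂ := Complex.exp (Complex.I * x * g)

theorem continuous_character (g : ℝ) : Continuous (character g) := by
  unfold character; fun_prop

theorem norm_character (g x : ℝ) : ‖character g x‖ = 1 := by
  have : Complex.I * x * g = ((x * g : ℝ) : ℂ) * Complex.I := by push_cast; ring
  rw [character, this, Complex.norm_exp_ofReal_mul_I]

theorem memLp_character_mul {L : ℝ} (g : ℝ) (φ : WaveSpace L) :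
    MemLp (fun x => character g x * φ x) 2 (intervalMeasure L) := by
  refine (Lp.memLp φ).of_le
    ((continuous_character g).aestronglyMeasurable.mul (Lp.aestronglyMeasurable φ)) ?_
  filter_upwards with x
  simp [norm_character]

/-- The linear map `φ(λ) ↦ e^{iλg} φ(λ)`. -/
def phaseLin (L g : ℝ) : WaveSpace L →ₗ[ℂ] WaveSpace L where
  toFun φ := (memLp_character_mul g φ).toLp _
  map_add' φ ψ := by
    rw [← MemLp.toLp_add, MemLp.toLp_eq_toLp_iff]
    filter_upwards [Lp.coeFn_add φ ψ] with x hx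
    rw [hx, Pi.add_apply, mul_add]
    rfl
  map_smul' c φ := by
    rw [RingHom.id_apply, ← MemLp.toLp_const_smul, MemLp.toLp_eq_toLp_iff]
    filter_upwards [Lp.coeFn_smul c φ] with x hx
    simp only [hx, Pi.smul_apply, smul_eq_mul]
    ring

theorem coeFn_phaseLin (L g : ℝ) (φ : WaveSpace L) :
    phaseLin L g φ =ᵐ[intervalMeasure L] fun x => character g x * φ x :=
  MemLp.coeFn_toLp (memLp_character_mul g φ)

theorem inner_phaseLin (L g : ℝ) (φ ψ : WaveSpace L) :
    ⟪phaseLin L g φ, phaseLin L g ψ⟫_ℂ = ⟪φ, ψ⟫_ℂ := by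
  rw [L2.inner_def, L2.inner_def]
  refine integral_congr_ae ?_
  filter_upwards [coeFn_phaseLin L g φ, coeFn_phaseLin L g ψ] with x h1 h2
  rw [h1, h2]
  have h := Complex.mul_conj (character g x)
  rw [Complex.normSq_eq_norm_sq, norm_character] at h
  simp only [RCLike.inner_apply, map_mul]
  calc _ = (character g x * (starRingEnd ℂ) (character g x)) *
        (ψ x * (starRingEnd ℂ) (φ x)) := by ring
    _ = _ := by rw [h]; simp

theorem phaseLin_phaseLin (L g h : ℝ) (φ : WaveSpace L) :
    phaseLin L g (phaseLin L h φ) = phaseLin L (g + h) φ := by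
  refine Lp.ext ?_
  filter_upwards [coeFn_phaseLin L g (phaseLin L h φ), coeFn_phaseLin L h φ,
    coeFn_phaseLin L (g + h) φ] with x h1 h2 h3
  rw [h1, h2, h3, ← mul_assoc, character, character, character, ← Complex.exp_add]
  congr 2
  push_cast
  ring

theorem phaseLin_zero (L : ℝ) (φ : WaveSpace L) : phaseLin L 0 φ = φ := by
  refine Lp.ext ?_
  filter_upwards [coeFn_phaseLin L 0 φ] with x h1
  rw [h1]
  simp [character]

/-- The continuous linear map `φ(λ) ↦ e^{iλg} φ(λ)`. -/
def phaseOp (L g : ℝ) : WaveSpace L →L[ℂ] WaveSpace L :=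
  (phaseLin L g).mkContinuous 1 (fun φ => by
    have h := inner_phaseLin L g φ φ
    simp only [inner_self_eq_norm_sq_to_K] at h
    have h2 : ‖phaseLin L g φ‖ ^ 2 = ‖φ‖ ^ 2 := by exact_mod_cast h
    rw [one_mul]
    exact (pow_le_pow_iff_left₀ (norm_nonneg _) (norm_nonneg _) two_ne_zero).1 h2.le)

/-- The unitary representation of `ℝ` on `L²([-L, L])` by `(f(g)φ)(λ) = e^{iλg} φ(λ)`. -/
def phaseRep (L g : ℝ) : unitary (WaveSpace L →L[ℂ] WaveSpace L) :=
  ⟨phaseOp L g, by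
    have hs : star (phaseOp L g) = phaseOp L (-g) := by
      ext1 φ
      refine ext_inner_right ℂ (fun ψ => ?_)
      rw [ContinuousLinearMap.star_eq_adjoint, ContinuousLinearMap.adjoint_inner_left]
      change ⟪φ, phaseLin L g ψ⟫_ℂ = ⟪phaseLin L (-g) φ, ψ⟫_ℂ
      rw [← inner_phaseLin L g (phaseLin L (-g) φ), phaseLin_phaseLin, add_neg_cancel,
        phaseLin_zero]
    rw [Unitary.mem_iff, hs]
    constructor
    · ext1 φ
      change phaseLin L (-g) (phaseLin L g φ) = φ
      rw [phaseLin_phaseLin, neg_add_cancel, phaseLin_zero]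
    · ext1 φ
      change phaseLin L g (phaseLin L (-g) φ) = φ
      rw [phaseLin_phaseLin, add_neg_cancel, phaseLin_zero]⟩

/-- The inverse Fourier transform `F⁻¹[φ](g) = ∫ e^{-iλg} φ(λ) dλ / √(2π)`. -/
def invFourier {L : ℝ} (φ : WaveSpace L) (g : ℝ) : ℂ :=
  ∫ x, Complex.exp (-(Complex.I * x * g)) * φ x ∂(intervalMeasure L)

/-- `∫ ĝ² |F⁻¹[φ](ĝ)|² dĝ / √(2π)`. -/
def waveError {L : ℝ} (φ : WaveSpace L) : ℝ≥0∞ :=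
  ∫⁻ g, ENNReal.ofReal (g ^ 2 * ‖invFourier φ g‖ ^ 2) ∂normMeasure

/-- `v` is the weak derivative of `u` on the real line. -/
def IsWeakDeriv (u v : ℝ → ℂ) : Prop :=
  ∀ η : ℝ → ℝ, ContDiff ℝ (⊤ : ℕ∞) η → HasCompactSupport η →
    ∫ x, ((deriv η x : ℝ) : ℂ) * u x = -∫ x, ((η x : ℝ) : ℂ) * v x

/-- The quadratic form `⟨φ|P²|φ⟩ = ‖Pφ‖²` of the square of the momentum operator
`P = -i d/dλ` on `L²(ℝ, dλ / √(2π))`, at the zero extension of `φ`. Its value is `∞` if the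
zero extension has no square integrable weak derivative, that is, if it is not in the domain
of `P`; the weak derivative is unique up to null sets, so the infimum is over one value. -/
def momentumForm {L : ℝ} (φ : WaveSpace L) : ℝ≥0∞ :=
  ⨅ (v : ℝ → ℂ) (_ : MemLp v 2 normMeasure) (_ : IsWeakDeriv (extend φ) v),
    ∫⁻ x, ENNReal.ofReal (‖-Complex.I * v x‖ ^ 2) ∂normMeasure

/-- The constant wave function `|I⟩ = 1` on `[-L, L]`. -/
def unitWave (L : ℝ) : WaveSpace L := (memLp_const (1 : ℂ)).toLp (fun _ => (1 : ℂ))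

/-- `M` is the canonical measurement `M(B) = ∫_B f(g) |I⟩⟨I| f(g)† dg / √(2π)`
(as a weak integral). -/
def IsCanonical {L : ℝ} (M : POVM (WaveSpace L)) : Prop :=
  ∀ B : Set ℝ, MeasurableSet B → ∀ φ ψ : WaveSpace L,
    IntegrableOn (fun g => ⟪φ, ketbra ((phaseRep L g).1 (unitWave L)) ψ⟫_ℂ) B normMeasure ∧
    ⟪φ, M B ψ⟫_ℂ = ∫ g in B, ⟪φ, ketbra ((phaseRep L g).1 (unitWave L)) ψ⟫_ℂ ∂normMeasure

/-- The function `(2π)^{1/4} L^{-1/2} sin (π (1 + λ/L) / 2)`. -/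
def sineFun (L x : ℝ) : ℝ :=
  (2 * Real.pi) ^ (1 / 4 : ℝ) / Real.sqrt L * Real.sin (Real.pi * (1 + x / L) / 2)

theorem memLp_sineFun (L : ℝ) :
    MemLp (fun x => (sineFun L x : ℂ)) 2 (intervalMeasure L) := by
  refine MemLp.of_bound (C := (2 * Real.pi) ^ (1 / 4 : ℝ) / Real.sqrt L) ?_ ?_
  · refine Continuous.aestronglyMeasurable ?_
    unfold sineFun
    fun_prop
  · filter_upwards with x
    have h : 0 ≤ (2 * Real.pi) ^ (1 / 4 : ℝ) / Real.sqrt L := by positivity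
    rw [Complex.norm_real, sineFun, norm_mul, Real.norm_of_nonneg h]
    exact mul_le_of_le_one_right h (Real.abs_sin_le_one _)

/-- The wave function `(2π)^{1/4} L^{-1/2} sin (π (1 + λ/L) / 2)` on `[-L, L]`. -/
def sineWave (L : ℝ) : WaveSpace L := (memLp_sineFun L).toLp _

end GroupEstimation

end

noncomputable section

namespace GroupEstimation

/-! ### The Fourier transform on the line -/

/-! Everything rests on one sharp inequality: a square integrable `u` supported in `[-L, L]` with
`‖u(·+t) - u‖² ≤ C t²` for all `t > 0` satisfies `(π/2L)² ‖u‖² ≤ C`, with equality only for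
multiples of `cos(πx/2L)`. It is the Dirichlet eigenvalue problem, phrased with difference quotients
so that no regularity of `u` is needed. The bound (`dirichlet_bound`) comes from a discrete Picone
inequality against a slightly wider cosine. In the equality case (`dirichlet_eq`) the Picone defect
is `o(t)` in norm; testing it against exponentials yields a recurrence for the Fourier coefficients
of `u`, which leaves only those of the cosine.

For the variance of `F⁻¹[φ]` the hypothesis holds with `u = φ`, by Plancherel and `|e^{itg} - 1| ≤
|tg|`. If the zero extension of `φ` has a square integrable weak derivative, the transform of that
derivative is `ig F⁻¹[φ](g)`, so the variance is at most the momentum form, and the sine wave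
attains both.

For a covariant measurement `M`, put `N = ∫ e^{ity} M(dy)`. This is a contraction that commutes with
the phases `f(g)` up to the scalar `e^{itg}`. Hence it is a translation by `t` followed by
multiplication by a function of modulus at most one (`extend_charOp`, `norm_extend_charOp_le`). With
`2 - 2 cos(ty) ≤ t²y²`, the second moment of `M` in `ψ` controls the difference quotients of `|ψ|`
(`POVM.IsCovariant.ofReal_norm_diff_le`), so the sharp inequality applies to `u = |ψ|`. The phase of
`ψ` is lost, as it must be: the measurement can compensate for it.

A density operator factors as `ρ = S S†`, and its error is the sum of the second moments of the
vectors `S eⱼ` (`worstError_eq`), so the bound passes to mixed states and to mixtures of strategies.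
At equality each `S eⱼ` is extremal for `M`. The extremal vectors form a linear space, being the
null space of a nonnegative quadratic form, and all have modulus proportional to that of the sine
wave. For orthogonal extremal `x` and `z`, comparing the moduli of `x + z` and `x + iz` forces `x z
= 0` almost everywhere, so the space has dimension at most one (`exists_smul_of_secondMoment_le`)
and `ρ` is pure. Conversely, the canonical measurement is optimal for the sine wave, and conjugating
it by a multiplication operator of modulus one serves every `ψ` with the same modulus. -/

open scoped FourierTransform in
theorem integral_fourier_mul_schwartz (f : ℝ → ℂ) (hf : Integrable f) (g : SchwartzMap ℝ ℂ) :
    ∫ x, g x • 𝓕 f x = ∫ x, (𝓕 g) x • f x := by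
  have h := VectorFourier.integral_fourierIntegral_smul_eq_flip (L := innerₗ ℝ)
    (μ := volume) (ν := volume) Real.continuous_fourierChar continuous_inner hf
    (g.integrable (μ := volume))
  rw [flip_innerₗ] at h
  have e1 : ∀ x, 𝓕 f x = VectorFourier.fourierIntegral Real.fourierChar volume (innerₗ ℝ) f x :=
    fun x => rfl
  have e2 : ∀ x, (𝓕 g) x
      = VectorFourier.fourierIntegral Real.fourierChar volume (innerₗ ℝ) (g : ℝ → ℂ) x :=
    fun x => rfl
  simp only [e1, e2, smul_eq_mul] at h ⊢
  simpa only [mul_comm] using h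

theorem ae_eq_of_integral_schwartz {f h : ℝ → ℂ} (hf : LocallyIntegrable f)
    (hh : LocallyIntegrable h)
    (H : ∀ g : SchwartzMap ℝ ℂ, ∫ x, g x • f x = ∫ x, g x • h x) : f =ᵐ[volume] h := by
  refine ae_eq_of_integral_contDiff_smul_eq hf hh (fun g hg hc => ?_)
  have hc' : HasCompactSupport (fun x => (g x : ℂ)) := hc.comp_left (g := Complex.ofReal) rfl
  have := H (hc'.toSchwartzMap (Complex.ofRealCLM.contDiff.comp hg))
  simp only [Complex.real_smul]
  exact this

open scoped FourierTransform in
theorem ae_eq_of_fourier_eq {f h : ℝ → ℂ} (hf : Integrable f) (hh : Integrable h)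
    (H : 𝓕 f = 𝓕 h) : f =ᵐ[volume] h := by
  refine ae_eq_of_integral_schwartz hf.locallyIntegrable hh.locallyIntegrable (fun g => ?_)
  have h1 := integral_fourier_mul_schwartz f hf (𝓕⁻ g)
  have h2 := integral_fourier_mul_schwartz h hh (𝓕⁻ g)
  rw [FourierTransform.fourier_fourierInv_eq] at h1 h2
  rw [← h1, ← h2, H]

-- The Fourier transform on `L²` is an abstract extension. Both sides have the same pairing with
-- every Schwartz function, so the abstract transform can be replaced by the integral on `L¹ ∩ L²`.
open scoped FourierTransform in
theorem coeFn_fourier_toLp {f : ℝ → ℂ} (hf1 : Integrable f) (hf2 : MemLp f 2) :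
    (𝓕 (hf2.toLp f) : Lp ℂ 2 (volume : Measure ℝ)) =ᵐ[volume] 𝓕 f := by
  have hc : Continuous (𝓕 f) := VectorFourier.fourierIntegral_continuous
    Real.continuous_fourierChar (by fun_prop) hf1
  refine ae_eq_of_integral_schwartz ((Lp.memLp _).locallyIntegrable (by norm_num))
    hc.locallyIntegrable (fun g => ?_)
  rw [integral_fourier_mul_schwartz f hf1 g, ← Lp.toTemperedDistribution_apply,
    ← Lp.fourier_toTemperedDistribution_eq, TemperedDistribution.fourier_apply,
    Lp.toTemperedDistribution_apply]
  refine integral_congr_ae ?_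
  filter_upwards [hf2.coeFn_toLp] with x hx
  rw [hx]

/-- The Fourier transform with the conventions of `invFourier`, for functions on the line. -/
def lineFourier (f : ℝ → ℂ) (g : ℝ) : ℂ :=
  ∫ x, Complex.exp (-(Complex.I * x * g)) * f x ∂normMeasure

theorem integral_normMeasure (f : ℝ → ℂ) :
    ∫ x, f x ∂normMeasure = ((1 / Real.sqrt (2 * Real.pi) : ℝ) : ℂ) * ∫ x, f x := by
  rw [normMeasure, integral_smul_measure, ENNReal.toReal_ofReal (by positivity)]
  simp

theorem ae_normMeasure : ae normMeasure = ae volume := by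
  unfold normMeasure
  exact Measure.ae_ennreal_smul_measure_eq (by simp; positivity) _

theorem memLp_normMeasure {f : ℝ → ℂ} {p : ℝ≥0∞} : MemLp f p normMeasure ↔ MemLp f p volume := by
  have hp : 0 < 1 / Real.sqrt (2 * Real.pi) := by positivity
  constructor
  · intro h
    refine h.of_measure_le_smul (c := ENNReal.ofReal (Real.sqrt (2 * Real.pi)))
      ENNReal.ofReal_ne_top ?_
    rw [normMeasure, smul_smul, ← ENNReal.ofReal_mul (by positivity), mul_one_div_cancel
      (by positivity)]
    simp
  · intro h
    exact h.smul_measure ENNReal.ofReal_ne_top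

open scoped FourierTransform in
theorem lineFourier_eq (f : ℝ → ℂ) (g : ℝ) :
    lineFourier f g = ((1 / Real.sqrt (2 * Real.pi) : ℝ) : ℂ) * 𝓕 f ((2 * Real.pi)⁻¹ * g) := by
  rw [lineFourier, integral_normMeasure, Real.fourier_eq']
  congr 1
  refine integral_congr_ae (Filter.Eventually.of_forall fun x => ?_)
  simp only [smul_eq_mul]
  congr 2
  simp only [RCLike.inner_apply, conj_trivial]
  push_cast
  have : (Real.pi : ℂ) ≠ 0 := by exact_mod_cast Real.pi_ne_zero
  field_simp

theorem continuous_lineFourier {f : ℝ → ℂ} (hf : Integrable f) : Continuous (lineFourier f) := by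
  have : lineFourier f = _ := funext (lineFourier_eq f)
  rw [this]
  refine continuous_const.mul (Continuous.comp (VectorFourier.fourierIntegral_continuous
    Real.continuous_fourierChar (by fun_prop) hf) (by fun_prop))

theorem ae_eq_of_lineFourier_eq {f h : ℝ → ℂ} (hf : Integrable f) (hh : Integrable h)
    (H : ∀ g, lineFourier f g = lineFourier h g) : f =ᵐ[volume] h := by
  refine ae_eq_of_fourier_eq hf hh (funext fun x => ?_)
  have h1 := H (2 * Real.pi * x)
  rw [lineFourier_eq, lineFourier_eq, inv_mul_cancel_left₀ (by positivity)] at h1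
  refine mul_left_cancel₀ ?_ h1
  exact_mod_cast (by positivity : (1 / Real.sqrt (2 * Real.pi) : ℝ) ≠ 0)

open scoped FourierTransform in
theorem memLp_lineFourier {f : ℝ → ℂ} (hf1 : Integrable f) (hf2 : MemLp f 2) :
    MemLp (lineFourier f) 2 normMeasure := by
  rw [memLp_normMeasure]
  have h : MemLp (𝓕 f) 2 volume :=
    (memLp_congr_ae (coeFn_fourier_toLp hf1 hf2)).1 (Lp.memLp _)
  have : lineFourier f = _ := funext (lineFourier_eq f)
  rw [this]
  refine MemLp.const_mul ?_ _
  have hq : (2 * Real.pi)⁻¹ ≠ 0 := by positivity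
  have hm : MemLp (𝓕 f) 2 (Measure.map (fun x => (2 * Real.pi)⁻¹ * x) volume) := by
    rw [Real.map_volume_mul_left hq]
    exact h.smul_measure ENNReal.ofReal_ne_top
  exact hm.comp_of_map (by fun_prop)

open scoped FourierTransform in
/-- Plancherel's theorem. -/
theorem integral_lineFourier_mul {f h : ℝ → ℂ} (hf1 : Integrable f) (hf2 : MemLp f 2)
    (hh1 : Integrable h) (hh2 : MemLp h 2) :
    ∫ g, lineFourier h g * (starRingEnd ℂ) (lineFourier f g) ∂normMeasure
      = ∫ x, h x * (starRingEnd ℂ) (f x) ∂normMeasure := by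
  have e := Lp.inner_fourier_eq (hf2.toLp f) (hh2.toLp h)
  rw [L2.inner_def, L2.inner_def] at e
  have e1 : ∫ x, 𝓕 h x * (starRingEnd ℂ) (𝓕 f x) = ∫ x, h x * (starRingEnd ℂ) (f x) := by
    refine Eq.trans ?_ (e.trans ?_)
    · refine integral_congr_ae ?_
      filter_upwards [coeFn_fourier_toLp hf1 hf2, coeFn_fourier_toLp hh1 hh2] with x h1 h2
      rw [h1, h2, RCLike.inner_apply]
    · refine integral_congr_ae ?_
      filter_upwards [hf2.coeFn_toLp, hh2.coeFn_toLp] with x h1 h2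
      rw [h1, h2, RCLike.inner_apply]
  rw [integral_normMeasure, integral_normMeasure, ← e1]
  congr 1
  simp only [lineFourier_eq, map_mul, Complex.conj_ofReal]
  have h2 := Measure.integral_comp_mul_left
    (fun y => 𝓕 h y * (starRingEnd ℂ) (𝓕 f y)) (2 * Real.pi)⁻¹
  rw [inv_inv, abs_of_pos (by positivity)] at h2
  -- The normalizing factors of the two transforms multiply to `1/(2π)`, which cancels the Jacobian
  -- `2π` of the rescaling.
  calc _ = ∫ x, ((1 / (2 * Real.pi) : ℝ) : ℂ) * (𝓕 h ((2 * Real.pi)⁻¹ * x)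
        * (starRingEnd ℂ) (𝓕 f ((2 * Real.pi)⁻¹ * x))) := by
        refine integral_congr_ae (Filter.Eventually.of_forall fun x => ?_)
        have : ((1 / (2 * Real.pi) : ℝ) : ℂ)
          = ((1 / Real.sqrt (2 * Real.pi) : ℝ) : ℂ) * ((1 / Real.sqrt (2 * Real.pi) : ℝ) : ℂ) := by
          rw [← Complex.ofReal_mul, div_mul_div_comm, Real.mul_self_sqrt (by positivity), one_mul]
        simp only [this]
        ring
    _ = _ := by
        rw [integral_const_mul, h2, Complex.real_smul, ← mul_assoc, ← Complex.ofReal_mul,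
          one_div_mul_cancel (by positivity)]
        simp

theorem integral_normSq_eq (f : ℝ → ℂ) (μ : Measure ℝ) :
    ∫ x, f x * (starRingEnd ℂ) (f x) ∂μ = ((∫ x, ‖f x‖ ^ 2 ∂μ : ℝ) : ℂ) := by
  rw [← integral_complex_ofReal]
  simp only [Complex.mul_conj, Complex.normSq_eq_norm_sq]

theorem integral_norm_lineFourier_sq {f : ℝ → ℂ} (hf1 : Integrable f) (hf2 : MemLp f 2) :
    ∫ g, ‖lineFourier f g‖ ^ 2 ∂normMeasure = ∫ x, ‖f x‖ ^ 2 ∂normMeasure := by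
  have h := integral_lineFourier_mul hf1 hf2 hf1 hf2
  rw [integral_normSq_eq, integral_normSq_eq] at h
  exact_mod_cast h

/-! ### The Dirichlet problem by difference quotients -/

/-- Discrete Picone identity: the two sides would be equal if the last square were divided by `p q`.
As `p q ≤ 1`, removing that weight only decreases it. The square is kept because it carries the case
of equality. -/
theorem picone_pointwise (a b : ℂ) {p q : ℝ} (hp : 0 < p) (hp1 : p ≤ 1) (hq : 0 < q)
    (hq1 : q ≤ 1) :
    ‖b‖ ^ 2 * (1 - p / q) + ‖a‖ ^ 2 * (1 - q / p) + ‖b * p - a * q‖ ^ 2 ≤ ‖b - a‖ ^ 2 := by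
  have h1 : ‖b - a‖ ^ 2 - (‖b‖ ^ 2 * (1 - p / q) + ‖a‖ ^ 2 * (1 - q / p))
      = ‖b * p - a * q‖ ^ 2 / (p * q) := by
    simp only [← Complex.normSq_eq_norm_sq, Complex.normSq_apply, Complex.sub_re, Complex.sub_im,
      Complex.mul_re, Complex.mul_im, Complex.ofReal_re, Complex.ofReal_im]
    field_simp
    ring
  have h2 : ‖b * p - a * q‖ ^ 2 ≤ ‖b * p - a * q‖ ^ 2 / (p * q) := by
    rw [le_div_iff₀ (by positivity)]
    exact mul_le_of_le_one_right (by positivity) (mul_le_one₀ hp1 hq.le hq1)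
  linarith

theorem integrable_normSq {u : ℝ → ℂ} {μ : Measure ℝ} (hu : MemLp u 2 μ) :
    Integrable (fun x => ‖u x‖ ^ 2) μ := hu.integrable_norm_pow (by norm_num)

theorem memLp_comp_add {u : ℝ → ℂ} (hu : MemLp u 2) (t : ℝ) : MemLp (fun x => u (x + t)) 2 :=
  hu.comp_measurePreserving (measurePreserving_add_right volume t)

theorem MemLp.mul_cos {u : ℝ → ℂ} {μ : Measure ℝ} (hu : MemLp u 2 μ) (β t : ℝ) :
    MemLp (fun x => u x * (Real.cos (β * (x + t)) : ℂ)) 2 μ := by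
  refine hu.of_le (hu.aestronglyMeasurable.mul (Continuous.aestronglyMeasurable (by fun_prop))) ?_
  filter_upwards with x
  rw [norm_mul, Complex.norm_real]
  exact mul_le_of_le_one_right (norm_nonneg _) (Real.abs_cos_le_one _)

/-- Integrate the pointwise inequality with `a = u(x)`, `b = u(x+t)` and weights `w = cos(β ·)` at
`x` and `x+t`. After a translation the coefficient of `|u(x)|²` is `2 - (w(x-t) + w(x+t))/w(x)`, a
constant because the cosine is an eigenfunction of the second difference. -/
theorem picone_integral {L t β : ℝ} (hL : 0 < L) (ht : 0 < t) (hβ : 0 < β)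
    (hβ2 : β * (L + t) < Real.pi / 2) {u : ℝ → ℂ} (hu : MemLp u 2)
    (hs : ∀ x, x ∉ Set.Icc (-L) L → u x = 0) :
    2 * (1 - Real.cos (β * t)) * (∫ x, ‖u x‖ ^ 2)
      + ∫ x, ‖u (x + t) * (Real.cos (β * x) : ℂ) - u x * (Real.cos (β * (x + t)) : ℂ)‖ ^ 2
      ≤ ∫ x, ‖u (x + t) - u x‖ ^ 2 := by
  set w : ℝ → ℝ := fun x => Real.cos (β * x) with hw
  have hpos : ∀ x, -(L + t) ≤ x → x ≤ L + t → 0 < w x := by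
    intro x h1 h2
    refine Real.cos_pos_of_mem_Ioo ⟨?_, ?_⟩ <;> nlinarith
  have hle : ∀ x, w x ≤ 1 := fun x => Real.cos_le_one _
  have hlow : ∀ x ∈ Set.Icc (-L) L, Real.cos (β * L) ≤ w x := by
    intro x hx
    simp only [hw]
    rw [← Real.cos_abs (β * x)]
    have h1 : |β * x| ≤ β * L := by
      rw [abs_mul, abs_of_pos hβ]
      exact mul_le_mul_of_nonneg_left (abs_le.2 hx) hβ.le
    refine Real.cos_le_cos_of_nonneg_of_le_pi (abs_nonneg _) ?_ h1
    nlinarith [Real.pi_pos]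
  have hcL : 0 < Real.cos (β * L) := hpos L (by linarith) (by linarith)
  have hint : ∀ s : ℝ, Integrable (fun x => ‖u x‖ ^ 2 * (1 - w (x + s) / w x)) := by
    intro s
    -- The quotient is unbounded near zeros of the cosine; cutting it off outside the support of `u`
    -- changes no integrand and gives a bounded factor, since `w ≥ cos(βL) > 0` on `[-L, L]`.
    set G : ℝ → ℝ := (Set.Icc (-L) L).indicator (fun x => 1 - w (x + s) / w x) with hG
    have hGm : Measurable G := by
      refine Measurable.indicator ?_ measurableSet_Icc
      simp only [hw]
      fun_prop
    have e : (fun x => ‖u x‖ ^ 2 * (1 - w (x + s) / w x)) = fun x => ‖u x‖ ^ 2 * G x := by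
      funext x
      by_cases hx : x ∈ Set.Icc (-L) L
      · simp [hG, hx]
      · simp [hs x hx]
    rw [e]
    refine (integrable_normSq hu).mul_bdd (c := 1 + 1 / Real.cos (β * L)) hGm.aestronglyMeasurable
      (Filter.Eventually.of_forall fun x => ?_)
    by_cases hx : x ∈ Set.Icc (-L) L
    · simp only [hG, hx, Set.indicator_of_mem]
      refine (norm_sub_le _ _).trans ?_
      rw [norm_one, norm_div]
      gcongr
      · exact Real.abs_cos_le_one _
      · exact (hlow x hx).trans (le_abs_self _)
    · simp only [hG, hx, Set.indicator_of_notMem, not_false_eq_true, norm_zero]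
      positivity
  have hint2 : Integrable (fun x => ‖u (x + t)‖ ^ 2 * (1 - w x / w (x + t))) := by
    have := (hint (-t)).comp_add_right t
    simpa using this
  have hint3 : Integrable (fun x => ‖u (x + t) * (w x : ℂ) - u x * (w (x + t) : ℂ)‖ ^ 2) := by
    refine integrable_normSq (MemLp.sub ?_ (MemLp.mul_cos hu β t))
    simpa only [add_zero] using MemLp.mul_cos (memLp_comp_add hu t) β 0
  have hmain : ∫ x, (‖u (x + t)‖ ^ 2 * (1 - w x / w (x + t)) + ‖u x‖ ^ 2 * (1 - w (x + t) / w x)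
      + ‖u (x + t) * (w x : ℂ) - u x * (w (x + t) : ℂ)‖ ^ 2) ≤ ∫ x, ‖u (x + t) - u x‖ ^ 2 := by
    refine integral_mono ((hint2.add (hint t)).add hint3)
      (integrable_normSq ((memLp_comp_add hu t).sub hu)) (fun x => ?_)
    by_cases hx : x ∈ Set.Icc (-L) L
    · exact picone_pointwise _ _ (hpos x (by linarith [hx.1]) (by linarith [hx.2])) (hle _)
        (hpos _ (by linarith [hx.1]) (by linarith [hx.2])) (hle _)
    · by_cases hy : x + t ∈ Set.Icc (-L) L
      · exact picone_pointwise _ _ (hpos x (by linarith [hy.1]) (by linarith [hy.2])) (hle _)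
          (hpos _ (by linarith [hy.1]) (by linarith [hy.2])) (hle _)
      · simp [hs x hx, hs _ hy]
  have hint4 : Integrable (fun x => ‖u (x + t)‖ ^ 2 * (1 - w x / w (x + t))
      + ‖u x‖ ^ 2 * (1 - w (x + t) / w x)) := hint2.add (hint t)
  rw [integral_add hint4 hint3, integral_add hint2 (hint t)] at hmain
  have e2 : ∫ x, ‖u (x + t)‖ ^ 2 * (1 - w x / w (x + t))
      = ∫ x, ‖u x‖ ^ 2 * (1 - w (x + -t) / w x) := by
    rw [← integral_add_right_eq_self (fun x => ‖u x‖ ^ 2 * (1 - w (x + -t) / w x)) t]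
    simp
  rw [e2, ← integral_add (hint (-t)) (hint t)] at hmain
  have e3 : ∀ x, ‖u x‖ ^ 2 * (1 - w (x + -t) / w x) + ‖u x‖ ^ 2 * (1 - w (x + t) / w x)
      = 2 * (1 - Real.cos (β * t)) * ‖u x‖ ^ 2 := by
    intro x
    by_cases hx : x ∈ Set.Icc (-L) L
    · have hwx : w x ≠ 0 := (hcL.trans_le (hlow x hx)).ne'
      have : w (x + -t) + w (x + t) = 2 * Real.cos (β * t) * w x := by
        simp only [hw, mul_add, mul_neg, Real.cos_add, Real.cos_neg, Real.sin_neg]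
        ring
      have h2 : w (x + -t) / w x + w (x + t) / w x = 2 * Real.cos (β * t) := by
        rw [← add_div, this, mul_div_cancel_right₀ _ hwx]
      linear_combination (-‖u x‖ ^ 2) * h2
    · simp [hs x hx]
  simp only [e3] at hmain
  rwa [integral_const_mul] at hmain

/-- The frequency of the cosine that vanishes at `±(L + 2t)`. -/
def freq (L t : ℝ) : ℝ := Real.pi / (2 * (L + 2 * t))

theorem freq_pos {L t : ℝ} (hL : 0 < L) (ht : 0 ≤ t) : 0 < freq L t := by
  unfold freq; positivity

/-- The points `x` and `x + t` range over `[-(L+t), L+t]` when one of them is in `[-L, L]`. Zeros at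
`±(L+2t)` keep the cosine strictly positive there, while the frequency still tends to `π/2L`. -/
theorem freq_mul_lt {L t : ℝ} (hL : 0 < L) (ht : 0 < t) : freq L t * (L + t) < Real.pi / 2 := by
  unfold freq
  rw [div_mul_eq_mul_div, div_lt_div_iff₀ (by positivity) (by positivity)]
  nlinarith [Real.pi_pos, mul_pos Real.pi_pos ht]

theorem differentiableAt_freq {L : ℝ} (hL : 0 < L) : DifferentiableAt ℝ (freq L) 0 := by
  unfold freq
  refine DifferentiableAt.div (by fun_prop) (by fun_prop) (by simp; positivity)

theorem hasDerivAt_freq_mul {L : ℝ} (hL : 0 < L) :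
    HasDerivAt (fun t => freq L t * t) (freq L 0) 0 := by
  have h := (differentiableAt_freq hL).hasDerivAt.mul (hasDerivAt_id (0 : ℝ))
  simpa using! h

-- Since `2(1 - cos θ) = (2 sin(θ/2))²`, the quotient is the square of a difference quotient at
-- zero.
open Filter Topology in
theorem tendsto_one_sub_cos_freq {L : ℝ} (hL : 0 < L) :
    Tendsto (fun t => 2 * (1 - Real.cos (freq L t * t)) / t ^ 2) (𝓝[>] 0) (𝓝 (freq L 0 ^ 2)) := by
  have h1 : HasDerivAt (fun t => 2 * Real.sin (freq L t * t / 2)) (freq L 0) 0 := by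
    have := (((hasDerivAt_freq_mul hL).div_const 2).sin).const_mul 2
    simpa [mul_div_cancel₀] using! this
  have h2 := (h1.tendsto_slope.mono_left (nhdsGT_le_nhdsNE 0)).pow 2
  refine h2.congr (fun t => ?_)
  have : Real.cos (freq L t * t) = 1 - 2 * Real.sin (freq L t * t / 2) ^ 2 := by
    have h := Real.cos_sq' (freq L t * t / 2)
    have h' := Real.cos_two_mul (freq L t * t / 2)
    rw [mul_div_cancel₀ _ two_ne_zero] at h'
    rw [h', h]; ring
  rw [this]
  simp only [slope, vsub_eq_sub, sub_zero, smul_eq_mul, mul_zero, zero_div, Real.sin_zero]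
  rw [mul_pow, inv_pow]
  ring

theorem dirichlet_bound {L : ℝ} (hL : 0 < L) {u : ℝ → ℂ} (hu : MemLp u 2)
    (hs : ∀ x, x ∉ Set.Icc (-L) L → u x = 0) {C : ℝ}
    (h : ∀ t, 0 < t → ∫ x, ‖u (x + t) - u x‖ ^ 2 ≤ C * t ^ 2) :
    freq L 0 ^ 2 * ∫ x, ‖u x‖ ^ 2 ≤ C := by
  refine le_of_tendsto ((tendsto_one_sub_cos_freq hL).mul_const _) ?_
  filter_upwards [self_mem_nhdsWithin] with t ht
  have ht : 0 < t := ht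
  have h1 := picone_integral hL ht (freq_pos hL ht.le) (freq_mul_lt hL ht) hu hs
  have h2 := h t ht
  have h3 : 0 ≤ ∫ x, ‖u (x + t) * (Real.cos (freq L t * x) : ℂ)
      - u x * (Real.cos (freq L t * (x + t)) : ℂ)‖ ^ 2 := integral_nonneg fun x => by positivity
  rw [div_mul_eq_mul_div, div_le_iff₀ (by positivity)]
  linarith

/-! ### Equality in the Dirichlet bound, by Fourier coefficients -/

/-- The integral of `u` against the exponential of frequency `s`. -/
def expInt (u : ℝ → ℂ) (s : ℝ) : ℂ := ∫ x : ℝ, Complex.exp (Complex.I * s * x) * u x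

theorem expInt_eq_lineFourier (u : ℝ → ℂ) (s : ℝ) :
    expInt u s = (Real.sqrt (2 * Real.pi) : ℂ) * lineFourier u (-s) := by
  rw [lineFourier, integral_normMeasure, ← mul_assoc, ← Complex.ofReal_mul,
    mul_one_div_cancel (by positivity), Complex.ofReal_one, one_mul, expInt]
  refine integral_congr_ae (Filter.Eventually.of_forall fun x => ?_)
  simp only
  congr 2
  push_cast
  ring

theorem continuous_expInt {u : ℝ → ℂ} (hu : Integrable u) : Continuous (expInt u) := by
  have : expInt u = _ := funext (expInt_eq_lineFourier u)
  rw [this]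
  exact continuous_const.mul ((continuous_lineFourier hu).comp continuous_neg)

theorem integrable_exp_mul {u : ℝ → ℂ} {μ : Measure ℝ} (hu : Integrable u μ) (s : ℝ) :
    Integrable (fun x : ℝ => Complex.exp (Complex.I * s * x) * u x) μ := by
  refine hu.bdd_mul (c := 1) (Continuous.aestronglyMeasurable (by fun_prop))
    (Filter.Eventually.of_forall fun x => ?_)
  have : Complex.I * s * x = ((s * x : ℝ) : ℂ) * Complex.I := by push_cast; ring
  rw [this, Complex.norm_exp_ofReal_mul_I]

theorem expInt_comp_add (u : ℝ → ℂ) (s t : ℝ) :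
    expInt (fun x => u (x + t)) s = Complex.exp (-(Complex.I * s * t)) * expInt u s := by
  rw [expInt, expInt, ← integral_const_mul, ← integral_add_right_eq_self (fun x : ℝ =>
    Complex.exp (-(Complex.I * s * t)) * (Complex.exp (Complex.I * s * x) * u x)) t]
  refine integral_congr_ae (Filter.Eventually.of_forall fun x => ?_)
  simp only
  rw [← mul_assoc, ← Complex.exp_add]
  congr 2
  push_cast
  ring

/-- Writing the cosines as exponentials shifts the frequency `nβ` to `(n ± 1)β`, so the Picone
defect is tested using only two Fourier integrals of `u`. The right side is arranged as differences
of exponentials in `βt`, ready for division by `t`. -/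
theorem integral_exp_mul_defect {u : ℝ → ℂ} (hu : Integrable u) (n β t : ℝ) :
    ∫ x : ℝ, Complex.exp (Complex.I * (n * β : ℝ) * x)
        * (u (x + t) * (Real.cos (β * x) : ℂ) - u x * (Real.cos (β * (x + t)) : ℂ))
      = 1 / 2 * (expInt u ((n + 1) * β)
          * (Complex.exp (Complex.I * (-(n + 1) : ℝ) * (β * t : ℝ))
            - Complex.exp (Complex.I * (1 : ℝ) * (β * t : ℝ)))
        + expInt u ((n - 1) * β) * (Complex.exp (Complex.I * (-(n - 1) : ℝ) * (β * t : ℝ))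
            - Complex.exp (Complex.I * (-1 : ℝ) * (β * t : ℝ)))) := by
  have hut : Integrable (fun x => u (x + t)) := hu.comp_add_right t
  have e : ∀ x : ℝ, Complex.exp (Complex.I * (n * β : ℝ) * x)
        * (u (x + t) * (Real.cos (β * x) : ℂ) - u x * (Real.cos (β * (x + t)) : ℂ))
      = 1 / 2 * ((Complex.exp (Complex.I * ((n + 1) * β : ℝ) * x) * u (x + t)
          + Complex.exp (Complex.I * ((n - 1) * β : ℝ) * x) * u (x + t))
        - (Complex.exp (Complex.I * (1 : ℝ) * (β * t : ℝ))
            * (Complex.exp (Complex.I * ((n + 1) * β : ℝ) * x) * u x)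
          + Complex.exp (Complex.I * (-1 : ℝ) * (β * t : ℝ))
            * (Complex.exp (Complex.I * ((n - 1) * β : ℝ) * x) * u x))) := by
    intro x
    have e1 : Complex.exp (Complex.I * ((n + 1) * β : ℝ) * x)
        = Complex.exp (Complex.I * (n * β : ℝ) * x) * Complex.exp ((β * x : ℝ) * Complex.I) := by
      rw [← Complex.exp_add]; congr 1; push_cast; ring
    have e2 : Complex.exp (Complex.I * ((n - 1) * β : ℝ) * x)
        = Complex.exp (Complex.I * (n * β : ℝ) * x) * Complex.exp (-(β * x : ℝ) * Complex.I) := by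
      rw [← Complex.exp_add]; congr 1; push_cast; ring
    have e3 : (Real.cos (β * x) : ℂ) = (Complex.exp ((β * x : ℝ) * Complex.I)
        + Complex.exp (-(β * x : ℝ) * Complex.I)) / 2 := by
      rw [Complex.ofReal_cos, Complex.cos]
    have e4 : (Real.cos (β * (x + t)) : ℂ) = (Complex.exp ((β * x : ℝ) * Complex.I)
        * Complex.exp (Complex.I * (1 : ℝ) * (β * t : ℝ)) + Complex.exp (-(β * x : ℝ) * Complex.I)
        * Complex.exp (Complex.I * (-1 : ℝ) * (β * t : ℝ))) / 2 := by
      rw [Complex.ofReal_cos, Complex.cos, ← Complex.exp_add, ← Complex.exp_add]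
      congr 3 <;> · push_cast; ring
    rw [e1, e2, e3, e4]
    ring
  simp only [e]
  have i1 := integrable_exp_mul hut ((n + 1) * β)
  have i2 := integrable_exp_mul hut ((n - 1) * β)
  have i3 := (integrable_exp_mul hu ((n + 1) * β)).const_mul
    (Complex.exp (Complex.I * (1 : ℝ) * (β * t : ℝ)))
  have i4 := (integrable_exp_mul hu ((n - 1) * β)).const_mul
    (Complex.exp (Complex.I * (-1 : ℝ) * (β * t : ℝ)))
  have i12 := integral_add i1 i2
  have i34 := integral_add i3 i4
  have key := integral_sub (i1.add i2) (i3.add i4)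
  simp only [Pi.add_apply] at key
  rw [i12, i34, integral_const_mul, integral_const_mul] at key
  rw [integral_const_mul, key]
  have c1 := expInt_comp_add u ((n + 1) * β) t
  have c2 := expInt_comp_add u ((n - 1) * β) t
  rw [expInt] at c1 c2
  rw [c1, c2]
  simp only [expInt]
  have e5 : -(Complex.I * ((n + 1) * β : ℝ) * t) = Complex.I * (-(n + 1) : ℝ) * (β * t : ℝ) := by
    push_cast; ring
  have e6 : -(Complex.I * ((n - 1) * β : ℝ) * t) = Complex.I * (-(n - 1) : ℝ) * (β * t : ℝ) := by
    push_cast; ring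
  rw [e5, e6]
  ring

/-- Cauchy–Schwarz against the constant one, from the nonnegativity of `∫ (V f - a)²` with `V` the
total mass and `a` the integral of `f`. -/
theorem sq_integral_le {f : ℝ → ℝ} {μ : Measure ℝ} [IsFiniteMeasure μ] (hf : Integrable f μ)
    (hf2 : Integrable (fun x => f x ^ 2) μ) :
    (∫ x, f x ∂μ) ^ 2 ≤ μ.real Set.univ * ∫ x, f x ^ 2 ∂μ := by
  set a := ∫ x, f x ∂μ
  set V := μ.real Set.univ
  have hV : 0 ≤ V := measureReal_nonneg
  have h : 0 ≤ ∫ x, (V * f x - a) ^ 2 ∂μ := integral_nonneg fun x => sq_nonneg _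
  have e : ∀ x, (V * f x - a) ^ 2 = V ^ 2 * f x ^ 2 - 2 * V * a * f x + a ^ 2 := fun x => by ring
  simp only [e] at h
  have i1 : Integrable (fun x => V ^ 2 * f x ^ 2 - 2 * V * a * f x) μ :=
    (hf2.const_mul _).sub (hf.const_mul _)
  rw [integral_add i1 (integrable_const _),
    integral_sub (hf2.const_mul _) (hf.const_mul _), integral_const_mul, integral_const_mul,
    integral_const, smul_eq_mul] at h
  have h2 : 0 ≤ V * (V * (∫ x, f x ^ 2 ∂μ) - a ^ 2) := by
    have : V * (V * (∫ x, f x ^ 2 ∂μ) - a ^ 2)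
      = V ^ 2 * (∫ x, f x ^ 2 ∂μ) - 2 * V * a * a + V * a ^ 2 := by ring
    rw [this]; exact h
  rcases hV.eq_or_lt with h0 | h0
  · have : μ = 0 := by
      rw [← Measure.measure_univ_eq_zero]
      exact (measureReal_eq_zero_iff).1 h0.symm
    simp [a, this]
  · have := nonneg_of_mul_nonneg_right h2 h0
    linarith

theorem norm_integral_exp_mul_sq_le {h : ℝ → ℂ} {c d : ℝ} (hcd : c ≤ d) (hh : MemLp h 2)
    (hs : ∀ x, x ∉ Set.Icc c d → h x = 0) (s : ℝ) :
    ‖∫ x : ℝ, Complex.exp (Complex.I * s * x) * h x‖ ^ 2 ≤ (d - c) * ∫ x, ‖h x‖ ^ 2 := by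
  have h1 : ‖∫ x : ℝ, Complex.exp (Complex.I * s * x) * h x‖ ≤ ∫ x, ‖h x‖ := by
    refine (norm_integral_le_integral_norm _).trans (le_of_eq ?_)
    refine integral_congr_ae (Filter.Eventually.of_forall fun x => ?_)
    have : Complex.I * s * x = ((s * x : ℝ) : ℂ) * Complex.I := by push_cast; ring
    simp only [norm_mul]
    rw [this, Complex.norm_exp_ofReal_mul_I, one_mul]
  have e1 : ∫ x, ‖h x‖ = ∫ x in Set.Icc c d, ‖h x‖ :=
    (setIntegral_eq_integral_of_forall_compl_eq_zero fun x hx => by simp [hs x hx]).symm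
  have e2 : ∫ x, ‖h x‖ ^ 2 = ∫ x in Set.Icc c d, ‖h x‖ ^ 2 :=
    (setIntegral_eq_integral_of_forall_compl_eq_zero fun x hx => by simp [hs x hx]).symm
  have hr : MemLp h 2 (volume.restrict (Set.Icc c d)) := hh.restrict _
  have h2 := sq_integral_le (hr.integrable (by norm_num)).norm (integrable_normSq hr)
  rw [← e1, ← e2] at h2
  have h3 : (volume.restrict (Set.Icc c d)).real Set.univ = d - c := by
    rw [measureReal_restrict_apply MeasurableSet.univ, Set.univ_inter, Real.volume_real_Icc,
      max_eq_left (by linarith)]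
  rw [h3] at h2
  exact (pow_le_pow_left₀ (norm_nonneg _) h1 2).trans h2

theorem hasDerivAt_exp_freq {L : ℝ} (hL : 0 < L) (a : ℝ) :
    HasDerivAt (fun t => Complex.exp (Complex.I * a * (freq L t * t : ℝ)))
      (Complex.I * a * freq L 0) 0 := by
  have h := ((hasDerivAt_freq_mul hL).ofReal_comp.const_mul (Complex.I * a)).cexp
  simpa using! h

theorem integrable_of_support {L : ℝ} {u : ℝ → ℂ} (hu : MemLp u 2)
    (hs : ∀ x, x ∉ Set.Icc (-L) L → u x = 0) : Integrable u := by
  have h1 : IntegrableOn u (Set.Icc (-L) L) := (hu.restrict _).integrable (by norm_num)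
  have h2 : (Set.Icc (-L) L).indicator u = u := by
    refine Set.indicator_eq_self.2 fun x hx => ?_
    by_contra h
    exact hx (hs x h)
  rw [← h2]
  exact h1.integrable_indicator measurableSet_Icc

-- At equality the squared norm of the Picone defect is at most `t²` times a quantity tending to
-- zero, and the defect is supported in an interval of length `2L + t`. So its integral against
-- `e^{inβx}`, divided by `t`, tends to zero. The explicit limit is the weak form of `u' w - u w' =
-- 0` tested on that exponential.
open Filter Topology in
theorem expInt_recurrence {L : ℝ} (hL : 0 < L) {u : ℝ → ℂ} (hu : MemLp u 2)
    (hs : ∀ x, x ∉ Set.Icc (-L) L → u x = 0)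
    (h : ∀ t, 0 < t → ∫ x, ‖u (x + t) - u x‖ ^ 2 ≤ freq L 0 ^ 2 * (∫ x, ‖u x‖ ^ 2) * t ^ 2)
    (n : ℝ) :
    (n + 2) * expInt u ((n + 1) * freq L 0) + (n - 2) * expInt u ((n - 1) * freq L 0) = 0 := by
  have hu1 := integrable_of_support hu hs
  set U := ∫ x, ‖u x‖ ^ 2
  set F : ℝ → ℂ := fun t => ∫ x : ℝ, Complex.exp (Complex.I * (n * freq L t : ℝ) * x)
    * (u (x + t) * (Real.cos (freq L t * x) : ℂ) - u x * (Real.cos (freq L t * (x + t)) : ℂ))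
    with hF
  have hbound : ∀ t, 0 < t → ‖t⁻¹ • F t‖ ^ 2
      ≤ (2 * L + t) * ((freq L 0 ^ 2 - 2 * (1 - Real.cos (freq L t * t)) / t ^ 2) * U) := by
    intro t ht
    have h1 := picone_integral hL ht (freq_pos hL ht.le) (freq_mul_lt hL ht) hu hs
    have h2 : MemLp (fun x => u (x + t) * (Real.cos (freq L t * x) : ℂ)
        - u x * (Real.cos (freq L t * (x + t)) : ℂ)) 2 := by
      refine MemLp.sub ?_ (MemLp.mul_cos hu _ t)
      simpa only [add_zero] using MemLp.mul_cos (memLp_comp_add hu t) (freq L t) 0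
    have h3 := norm_integral_exp_mul_sq_le (c := -L - t) (d := L) (by linarith) h2
      (fun x hx => by
        have hx1 : x ∉ Set.Icc (-L) L := fun hh => hx ⟨by linarith [hh.1], hh.2⟩
        have hx2 : x + t ∉ Set.Icc (-L) L := fun hh => hx ⟨by linarith [hh.1], by linarith [hh.2]⟩
        simp [hs _ hx1, hs _ hx2]) (n * freq L t)
    have h4 := h t ht
    rw [norm_smul, mul_pow, norm_inv, inv_pow, Real.norm_eq_abs, sq_abs, inv_mul_le_iff₀
      (by positivity)]
    refine h3.trans ?_
    have e : t ^ 2 * ((2 * L + t) * ((freq L 0 ^ 2 - 2 * (1 - Real.cos (freq L t * t)) / t ^ 2)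
        * U)) = (L - (-L - t)) * (freq L 0 ^ 2 * U * t ^ 2
          - 2 * (1 - Real.cos (freq L t * t)) * U) := by
      field_simp
      ring
    rw [e]
    refine mul_le_mul_of_nonneg_left ?_ (by linarith)
    linarith
  have hcont : ∀ m : ℝ, Tendsto (fun t => expInt u (m * freq L t)) (𝓝[>] 0)
      (𝓝 (expInt u (m * freq L 0))) := by
    intro m
    refine (continuous_expInt hu1).continuousAt.tendsto.comp ?_
    exact ((differentiableAt_freq hL).continuousAt.tendsto.const_mul m).mono_left
      nhdsWithin_le_nhds
  have hsl : ∀ a c : ℝ, Tendsto (fun t => t⁻¹ •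
      (Complex.exp (Complex.I * a * (freq L t * t : ℝ))
        - Complex.exp (Complex.I * c * (freq L t * t : ℝ)))) (𝓝[>] 0)
      (𝓝 (Complex.I * a * freq L 0 - Complex.I * c * freq L 0)) := by
    intro a c
    have h1 := ((hasDerivAt_exp_freq hL a).sub (hasDerivAt_exp_freq hL c)).tendsto_slope.mono_left
      (nhdsGT_le_nhdsNE 0)
    refine h1.congr fun t => ?_
    simp [slope]
  have hlim : Tendsto (fun t => t⁻¹ • F t) (𝓝[>] 0) (𝓝 (1 / 2 * (expInt u ((n + 1) * freq L 0)
      * (Complex.I * (-(n + 1) : ℝ) * freq L 0 - Complex.I * (1 : ℝ) * freq L 0)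
      + expInt u ((n - 1) * freq L 0)
      * (Complex.I * (-(n - 1) : ℝ) * freq L 0 - Complex.I * (-1 : ℝ) * freq L 0)))) := by
    refine ((((hcont (n + 1)).mul (hsl (-(n + 1)) 1)).add
      ((hcont (n - 1)).mul (hsl (-(n - 1)) (-1)))).const_mul (1 / 2)).congr fun t => ?_
    simp only [hF]
    rw [integral_exp_mul_defect hu1]
    simp only [Complex.real_smul]
    ring
  have h0 : Tendsto (fun t => (2 * L + t)
      * ((freq L 0 ^ 2 - 2 * (1 - Real.cos (freq L t * t)) / t ^ 2) * U)) (𝓝[>] 0) (𝓝 0) := by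
    have h1 : Tendsto (fun t : ℝ => 2 * L + t) (𝓝[>] 0) (𝓝 (2 * L + 0)) :=
      Tendsto.mono_left (Continuous.tendsto (by fun_prop) _) nhdsWithin_le_nhds
    have h2 := h1.mul (((tendsto_one_sub_cos_freq hL).const_sub (freq L 0 ^ 2)).mul_const U)
    simpa using h2
  have h1 : ‖(1 / 2 * (expInt u ((n + 1) * freq L 0)
      * (Complex.I * (-(n + 1) : ℝ) * freq L 0 - Complex.I * (1 : ℝ) * freq L 0)
      + expInt u ((n - 1) * freq L 0)
      * (Complex.I * (-(n - 1) : ℝ) * freq L 0 - Complex.I * (-1 : ℝ) * freq L 0)))‖ ^ 2 ≤ 0 := by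
    refine le_of_tendsto_of_tendsto (hlim.norm.pow 2) h0 ?_
    filter_upwards [self_mem_nhdsWithin] with t ht using hbound t ht
  have h2 := norm_eq_zero.1 (pow_eq_zero_iff two_ne_zero |>.1 (le_antisymm h1 (by positivity)))
  have hb : (freq L 0 : ℂ) ≠ 0 := by exact_mod_cast (freq_pos hL le_rfl).ne'
  have h3 : (-(Complex.I * freq L 0) / 2) * ((n + 2) * expInt u ((n + 1) * freq L 0)
      + (n - 2) * expInt u ((n - 1) * freq L 0)) = 0 := by
    rw [← h2]
    push_cast
    ring
  refine (mul_eq_zero.1 h3).resolve_left ?_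
  simp [hb]

theorem freq_zero_mul {L : ℝ} (hL : 0 < L) : freq L 0 * L = Real.pi / 2 := by
  unfold freq; field_simp; ring

/-- The factors `n - 2` and `n + 2` vanish at `n = 2` and `n = -2`, which starts the induction at
the frequencies `±3b`; for larger even `|n|` the recurrence carries the vanishing outwards. -/
theorem expInt_odd_eq_zero {u : ℝ → ℂ} {b : ℝ}
    (h : ∀ n : ℝ, (n + 2) * expInt u ((n + 1) * b) + (n - 2) * expInt u ((n - 1) * b) = 0)
    (k : ℕ) : expInt u ((2 * k + 3) * b) = 0 ∧ expInt u (-(2 * k + 3) * b) = 0 := by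
  induction k with
  | zero =>
    have h1 := h 2
    have h2 := h (-2)
    norm_num at h1 h2 ⊢
    exact ⟨h1, h2⟩
  | succ k ih =>
    have h1 := h (2 * k + 4)
    have h2 := h (-(2 * k + 4))
    have e1 : (2 * (k : ℝ) + 4 - 1) * b = (2 * k + 3) * b := by ring
    have e2 : (-(2 * (k : ℝ) + 4) + 1) * b = -(2 * k + 3) * b := by ring
    have e3 : (2 * (k : ℝ) + 4 + 1) * b = (2 * (k + 1 : ℕ) + 3) * b := by push_cast; ring
    have e4 : (-(2 * (k : ℝ) + 4) - 1) * b = -(2 * (k + 1 : ℕ) + 3) * b := by push_cast; ring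
    rw [e1, e3, ih.1, mul_zero, add_zero] at h1
    rw [e2, e4, ih.2, mul_zero, zero_add] at h2
    have n1 : ((2 * k + 4 : ℝ) : ℂ) + 2 ≠ 0 := by
      exact_mod_cast (by positivity : (2 * (k : ℝ) + 4) + 2 ≠ 0)
    have n2 : ((-(2 * k + 4) : ℝ) : ℂ) - 2 ≠ 0 := by
      have : (-(2 * k + 4) : ℝ) - 2 ≠ 0 := by
        have : (0 : ℝ) ≤ k := k.cast_nonneg
        linarith
      exact_mod_cast this
    exact ⟨(mul_eq_zero.1 h1).resolve_left n1, (mul_eq_zero.1 h2).resolve_left n2⟩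

theorem integral_exp_even {L : ℝ} (hL : 0 < L) (k : ℤ) :
    ∫ x : ℝ in -L..L, Complex.exp (Complex.I * ((2 * k) * freq L 0 : ℝ) * x)
      = if k = 0 then (2 * L : ℂ) else 0 := by
  split_ifs with hk
  · subst hk
    simp
    ring
  · have hc : Complex.I * ((2 * k) * freq L 0 : ℝ) ≠ 0 := by
      refine mul_ne_zero Complex.I_ne_zero (by
        exact_mod_cast mul_ne_zero (mul_ne_zero two_ne_zero (Int.cast_ne_zero.2 hk))
          (freq_pos hL le_rfl).ne')
    rw [integral_exp_mul_complex hc]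
    have h1 : Complex.I * ((2 * k) * freq L 0 : ℝ) * L
        = Complex.I * ((2 * k) * freq L 0 : ℝ) * (-L : ℝ) + k * (2 * Real.pi * Complex.I) := by
      have h2 : (freq L 0 : ℂ) * L = Real.pi / 2 := by exact_mod_cast freq_zero_mul hL
      push_cast
      linear_combination (4 * Complex.I * k) * h2
    rw [h1, Complex.exp_add, Complex.exp_int_mul_two_pi_mul_I, mul_one, sub_self, zero_div]

theorem integral_exp_mul_cos {L : ℝ} (hL : 0 < L) (k : ℤ) :
    ∫ x : ℝ in -L..L, Complex.exp (Complex.I * ((1 - 2 * k) * freq L 0 : ℝ) * x)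
      * (Real.cos (freq L 0 * x) : ℂ) = if k = 0 ∨ k = 1 then (L : ℂ) else 0 := by
  have e : ∀ x : ℝ, Complex.exp (Complex.I * ((1 - 2 * k) * freq L 0 : ℝ) * x)
      * (Real.cos (freq L 0 * x) : ℂ)
      = 1 / 2 * (Complex.exp (Complex.I * ((2 * (1 - k : ℤ)) * freq L 0 : ℝ) * x)
        + Complex.exp (Complex.I * ((2 * (-k : ℤ)) * freq L 0 : ℝ) * x)) := by
    intro x
    have e1 : Complex.exp (Complex.I * ((2 * (1 - k : ℤ)) * freq L 0 : ℝ) * x)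
        = Complex.exp (Complex.I * ((1 - 2 * k) * freq L 0 : ℝ) * x)
          * Complex.exp ((freq L 0 * x : ℝ) * Complex.I) := by
      rw [← Complex.exp_add]; congr 1; push_cast; ring
    have e2 : Complex.exp (Complex.I * ((2 * (-k : ℤ)) * freq L 0 : ℝ) * x)
        = Complex.exp (Complex.I * ((1 - 2 * k) * freq L 0 : ℝ) * x)
          * Complex.exp (-(freq L 0 * x : ℝ) * Complex.I) := by
      rw [← Complex.exp_add]; congr 1; push_cast; ring
    rw [e1, e2, Complex.ofReal_cos, Complex.cos]
    ring
  simp only [e]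
  rw [intervalIntegral.integral_const_mul, intervalIntegral.integral_add
    (Continuous.intervalIntegrable (by fun_prop) _ _)
    (Continuous.intervalIntegrable (by fun_prop) _ _), integral_exp_even hL, integral_exp_even hL]
  by_cases h0 : k = 0
  · simp [h0]
  · by_cases h1 : k = 1
    · simp [h1]
    · have : 1 - k ≠ 0 := by omega
      simp [h0, h1, this]

/-- The exponentials with odd multiples of `π/2L` as frequencies form a complete orthogonal system
on `[-L, L]`. The recurrence kills all coefficients of `u` but those at `±π/2L` and makes these two
equal, as for a multiple of the cosine; Parseval concludes. -/
theorem dirichlet_eq {L : ℝ} (hL : 0 < L) {u : ℝ → ℂ} (hu : MemLp u 2)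
    (hs : ∀ x, x ∉ Set.Icc (-L) L → u x = 0)
    (h : ∀ t, 0 < t → ∫ x, ‖u (x + t) - u x‖ ^ 2 ≤ freq L 0 ^ 2 * (∫ x, ‖u x‖ ^ 2) * t ^ 2) :
    ∃ κ : ℂ, ∀ᵐ x, x ∈ Set.Icc (-L) L → u x = κ * (Real.cos (freq L 0 * x) : ℂ) := by
  have hu1 := integrable_of_support hu hs
  have hrec := expInt_recurrence hL hu hs h
  have hodd := expInt_odd_eq_zero hrec
  have hsym : expInt u (-freq L 0) = expInt u (freq L 0) := by
    have := hrec 0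
    norm_num at this
    linear_combination (-1 / 2) * this
  refine ⟨expInt u (freq L 0) / L, ?_⟩
  set κ := expInt u (freq L 0) / L with hκ
  set v : ℝ → ℂ := fun x => u x - κ * (Real.cos (freq L 0 * x) : ℂ) with hv
  have hLL : -L < L := by linarith
  -- The factor `e^{iβx}` turns the even multiples of `β` in the Fourier basis of period `2L` into
  -- odd multiples: the `k`-th coefficient of `f` samples `v` at the frequency `(1 - 2k)β`.
  set f : ℝ → ℂ := fun x => Complex.exp (Complex.I * freq L 0 * x) * v x with hf
  have hv2 : MemLp v 2 (volume.restrict (Set.Ioc (-L) L)) := by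
    refine (hu.restrict _).sub (MemLp.const_mul ?_ _)
    refine MemLp.of_bound (C := 1) (Continuous.aestronglyMeasurable (by fun_prop)) ?_
    filter_upwards with x
    rw [Complex.norm_real]
    exact Real.abs_cos_le_one _
  have hnorm : ∀ x, ‖f x‖ = ‖v x‖ := by
    intro x
    have : Complex.I * freq L 0 * x = ((freq L 0 * x : ℝ) : ℂ) * Complex.I := by
      push_cast; ring
    rw [hf]
    simp only [norm_mul]
    rw [this, Complex.norm_exp_ofReal_mul_I, one_mul]
  have hf2 : MemLp f 2 (volume.restrict (Set.Ioc (-L) L)) :=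
    hv2.of_le ((Continuous.aestronglyMeasurable (by fun_prop)).mul hv2.aestronglyMeasurable)
      (Filter.Eventually.of_forall fun x => (hnorm x).le)
  have hcoef : ∀ k : ℤ, fourierCoeffOn hLL f k = 0 := by
    intro k
    rw [fourierCoeffOn_eq_integral]
    have e : ∀ x : ℝ, (fourier (-k) (x : AddCircle (L - -L)) : ℂ) • f x
        = Complex.exp (Complex.I * ((1 - 2 * k) * freq L 0 : ℝ) * x) * u x
          - κ * (Complex.exp (Complex.I * ((1 - 2 * k) * freq L 0 : ℝ) * x)
            * (Real.cos (freq L 0 * x) : ℂ)) := by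
      intro x
      have e1 : (fourier (-k) (x : AddCircle (L - -L)) : ℂ)
          * Complex.exp (Complex.I * freq L 0 * x)
          = Complex.exp (Complex.I * ((1 - 2 * k) * freq L 0 : ℝ) * x) := by
        have h2 : ((L - -L : ℝ) : ℂ) = 2 * L := by push_cast; ring
        rw [fourier_coe_apply, ← Complex.exp_add, h2]
        congr 1
        have : (L : ℂ) ≠ 0 := by exact_mod_cast hL.ne'
        simp only [freq, mul_zero, add_zero]
        push_cast
        field_simp
        ring
      simp only [hf, hv, smul_eq_mul]
      rw [← mul_assoc, e1]
      ring
    simp only [e]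
    rw [intervalIntegral.integral_sub (integrable_exp_mul hu1 _).intervalIntegrable
      (Continuous.intervalIntegrable (by fun_prop) _ _), intervalIntegral.integral_const_mul,
      integral_exp_mul_cos hL]
    have e2 : ∫ x : ℝ in -L..L, Complex.exp (Complex.I * ((1 - 2 * k) * freq L 0 : ℝ) * x) * u x
        = expInt u ((1 - 2 * k) * freq L 0) := by
      rw [intervalIntegral.integral_of_le hLL.le, ← integral_Icc_eq_integral_Ioc, expInt]
      exact setIntegral_eq_integral_of_forall_compl_eq_zero fun x hx => by simp [hs x hx]
    rw [e2]
    have hLc : (L : ℂ) ≠ 0 := by exact_mod_cast hL.ne'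
    have : expInt u ((1 - 2 * k) * freq L 0) = κ * if k = 0 ∨ k = 1 then (L : ℂ) else 0 := by
      by_cases h0 : k = 0
      · simp [h0, hκ, hLc]
      by_cases h1 : k = 1
      · have : (1 - 2 * ((1 : ℤ) : ℝ)) * freq L 0 = - freq L 0 := by push_cast; ring
        rw [h1, this, hsym]
        simp [hκ, hLc]
      simp only [h0, h1, or_self, if_false, mul_zero]
      -- The remaining frequencies are `1 - 2k = 2m + 3` with `m = -k - 1`, and `1 - 2k = -(2m + 3)`
      -- with `m = k - 2`.
      rcases lt_or_ge k 0 with hk | hk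
      · obtain ⟨m, hm⟩ := Int.eq_ofNat_of_zero_le (by omega : 0 ≤ -k - 1)
        have hk' : (k : ℝ) = -(m + 1) := by
          have : k = -(m + 1) := by omega
          rw [this]; push_cast; ring
        have := (hodd m).1
        rw [hk']
        convert this using 2
        ring
      · obtain ⟨m, hm⟩ := Int.eq_ofNat_of_zero_le (by omega : 0 ≤ k - 2)
        have hk' : (k : ℝ) = m + 2 := by
          have : k = m + 2 := by omega
          rw [this]; push_cast; ring
        have := (hodd m).2
        rw [hk']
        convert this using 2
        ring
    rw [this, sub_self, smul_zero]
  have hP := hasSum_sq_fourierCoeffOn hLL hf2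
  simp only [hcoef, norm_zero, ne_eq, OfNat.ofNat_ne_zero, not_false_eq_true, zero_pow, hnorm]
    at hP
  have hz := hP.unique hasSum_zero
  rw [smul_eq_mul, mul_eq_zero, or_iff_right (inv_ne_zero (by linarith)),
    intervalIntegral.integral_of_le hLL.le,
    integral_eq_zero_iff_of_nonneg (fun x => by positivity) (integrable_normSq hv2)] at hz
  rw [restrict_Ioc_eq_restrict_Icc] at hz
  have hz' := (ae_restrict_iff' measurableSet_Icc).1 hz
  filter_upwards [hz'] with x hx hmem
  have := hx hmem
  simp only [Pi.zero_apply, ne_eq, OfNat.ofNat_ne_zero, not_false_eq_true, pow_eq_zero_iff,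
    norm_eq_zero] at this
  exact sub_eq_zero.1 this

/-! ### Outcome distributions of a measurement -/

section General

variable {H : Type*} [NormedAddCommGroup H] [InnerProductSpace ℂ H]

theorem POVM.re_inner_nonneg (M : POVM H) {B : Set ℝ} (hB : MeasurableSet B) (x : H) :
    0 ≤ (⟪x, M B x⟫_ℂ).re := (M.isPositive _ hB).re_inner_nonneg_right x

/-- The measure `B ↦ ⟨x, M(B) x⟩`. -/
def POVM.diag (M : POVM H) (x : H) : Measure ℝ :=
  Measure.ofMeasurable (fun B _ => ENNReal.ofReal (⟪x, M B x⟫_ℂ).re)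
    (by simp [M.empty_eq_zero])
    (by
      intro B hB hd
      have h := Complex.hasSum_re (M.hasSum_iUnion B hB hd x x)
      rw [← h.tsum_eq, ENNReal.ofReal_tsum_of_nonneg _ h.summable]
      intro n
      exact M.re_inner_nonneg (hB n) x)

theorem POVM.diag_apply (M : POVM H) (x : H) {B : Set ℝ} (hB : MeasurableSet B) :
    M.diag x B = ENNReal.ofReal (⟪x, M B x⟫_ℂ).re :=
  Measure.ofMeasurable_apply B hB

theorem POVM.diag_univ (M : POVM H) (x : H) : M.diag x Set.univ = ENNReal.ofReal (‖x‖ ^ 2) := by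
  rw [M.diag_apply x MeasurableSet.univ, M.map_univ, ContinuousLinearMap.id_apply,
    inner_self_eq_norm_sq_to_K]
  norm_cast

instance (M : POVM H) (x : H) : IsFiniteMeasure (M.diag x) :=
  ⟨by rw [M.diag_univ]; exact ENNReal.ofReal_lt_top⟩

theorem POVM.inner_eq_ofReal (M : POVM H) (x : H) {B : Set ℝ} (hB : MeasurableSet B) :
    ⟪x, M B x⟫_ℂ = (((M.diag x).real B : ℝ) : ℂ) := by
  rw [Measure.real, M.diag_apply x hB,
    ENNReal.toReal_ofReal (M.re_inner_nonneg hB x)]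
  exact ((RCLike.nonneg_iff_exists_ofReal.1 ((M.isPositive _ hB).inner_nonneg_right x)).elim
    fun r hr => by
      have h2 : ((r : ℝ) : ℂ) = ⟪x, M B x⟫_ℂ := hr.2
      rw [← h2]; simp)

/-- The parallelogram law at the level of measures. It makes the second moment an extended-valued
quadratic form even where it is infinite. -/
theorem POVM.diag_add_diag_sub (M : POVM H) (x y : H) :
    M.diag (x + y) + M.diag (x - y) = (2 : ℝ≥0∞) • (M.diag x + M.diag y) := by
  ext B hB
  have hp := M.re_inner_nonneg hB
  simp only [Measure.coe_add, Pi.add_apply, Measure.smul_apply, smul_eq_mul,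
    M.diag_apply _ hB]
  have h2 : (2 : ℝ≥0∞) = ENNReal.ofReal 2 := by simp
  rw [← ENNReal.ofReal_add (hp _) (hp _), ← ENNReal.ofReal_add (hp _) (hp _), h2,
    ← ENNReal.ofReal_mul (by norm_num)]
  congr 1
  simp only [map_add, map_sub, inner_add_left, inner_sub_left, inner_add_right, inner_sub_right,
    Complex.add_re, Complex.sub_re]
  ring

theorem POVM.diag_smul (M : POVM H) (c : ℂ) (x : H) :
    M.diag (c • x) = ENNReal.ofReal (‖c‖ ^ 2) • M.diag x := by
  ext B hB
  rw [Measure.smul_apply, smul_eq_mul, M.diag_apply _ hB, M.diag_apply _ hB,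
    ← ENNReal.ofReal_mul (by positivity), map_smul, inner_smul_left, inner_smul_right,
    ← mul_assoc, mul_comm ((starRingEnd ℂ) c), Complex.mul_conj, Complex.normSq_eq_norm_sq,
    Complex.re_ofReal_mul]

/-- The second moment of the distribution `B ↦ ⟨x, M(B) x⟩`. -/
def POVM.secondMoment (M : POVM H) (x : H) : ℝ≥0∞ := ∫⁻ y, ENNReal.ofReal (y ^ 2) ∂(M.diag x)

theorem POVM.secondMoment_add_sub (M : POVM H) (x y : H) :
    M.secondMoment (x + y) + M.secondMoment (x - y)
      = 2 * (M.secondMoment x + M.secondMoment y) := by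
  simp only [POVM.secondMoment]
  rw [← lintegral_add_measure, M.diag_add_diag_sub, lintegral_smul_measure, lintegral_add_measure]
  rfl

theorem POVM.secondMoment_smul (M : POVM H) (c : ℂ) (x : H) :
    M.secondMoment (c • x) = ENNReal.ofReal (‖c‖ ^ 2) * M.secondMoment x := by
  simp only [POVM.secondMoment]
  rw [M.diag_smul, lintegral_smul_measure]
  rfl

/-- The integral of a simple function with respect to a measurement. -/
def POVM.simpleOp (M : POVM H) (φ : SimpleFunc ℝ ℂ) : H →L[ℂ] H :=
  ∑ v ∈ φ.range, v • M (φ ⁻¹' {v})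

theorem POVM.inner_simpleOp (M : POVM H) (φ : SimpleFunc ℝ ℂ) (x y : H) :
    ⟪x, M.simpleOp φ y⟫_ℂ = ∑ v ∈ φ.range, v * ⟪x, M (φ ⁻¹' {v}) y⟫_ℂ := by
  simp [POVM.simpleOp]

theorem POVM.inner_simpleOp_self (M : POVM H) (φ : SimpleFunc ℝ ℂ) (x : H) :
    ⟪x, M.simpleOp φ x⟫_ℂ = ∫ y, φ y ∂(M.diag x) := by
  rw [M.inner_simpleOp, SimpleFunc.integral_eq_sum _ (φ.integrable_of_isFiniteMeasure)]
  refine Finset.sum_congr rfl fun v _ => ?_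
  rw [M.inner_eq_ofReal x (φ.measurableSet_preimage _), Complex.real_smul, mul_comm]

variable [CompleteSpace H]

/-- Cauchy–Schwarz for the form of `T`, which is the inner product of images under the square root
of `T`. -/
theorem norm_inner_le_of_isPositive {T : H →L[ℂ] H} (hT : T.IsPositive) (x y : H) :
    ‖⟪x, T y⟫_ℂ‖ ≤ Real.sqrt (⟪x, T x⟫_ℂ).re * Real.sqrt (⟪y, T y⟫_ℂ).re := by
  have h0 : 0 ≤ T := (ContinuousLinearMap.nonneg_iff_isPositive _).2 hT
  have hi : ∀ x y, ⟪x, T y⟫_ℂ = ⟪CFC.sqrt T x, CFC.sqrt T y⟫_ℂ := by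
    intro x y
    have hs : star (CFC.sqrt T) = CFC.sqrt T :=
      (IsSelfAdjoint.of_nonneg (CFC.sqrt_nonneg T)).star_eq
    rw [← ContinuousLinearMap.adjoint_inner_right, ← ContinuousLinearMap.star_eq_adjoint, hs,
      ← mul_apply_eq_comp, CFC.sqrt_mul_sqrt_self T h0]
  have hn : ∀ x, Real.sqrt (⟪x, T x⟫_ℂ).re = ‖CFC.sqrt T x‖ := by
    intro x
    rw [hi, inner_self_eq_norm_sq_to_K]
    norm_cast
    exact Real.sqrt_sq (norm_nonneg _)
  rw [hn, hn, hi]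
  exact norm_inner_le_norm _ _

/-- Cauchy–Schwarz twice, on each fibre and then over the fibres, whose masses under `M.diag z` add
up to `‖z‖²`. This gives the sharp constant one; a triangle inequality over the values would not. -/
theorem POVM.norm_inner_simpleOp_le (M : POVM H) (φ : SimpleFunc ℝ ℂ) (hφ : ∀ y, ‖φ y‖ ≤ 1)
    (x y : H) : ‖⟪x, M.simpleOp φ y⟫_ℂ‖ ≤ ‖x‖ * ‖y‖ := by
  have hsum : ∀ z : H, ∑ v ∈ φ.range, (M.diag z).real (φ ⁻¹' {v}) = ‖z‖ ^ 2 := by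
    intro z
    have h := φ.sum_range_measure_preimage_singleton (M.diag z)
    rw [M.diag_univ] at h
    simp only [Measure.real]
    rw [← ENNReal.toReal_sum (fun _ _ => measure_ne_top _ _), h,
      ENNReal.toReal_ofReal (by positivity)]
  rw [M.inner_simpleOp]
  calc ‖∑ v ∈ φ.range, v * ⟪x, M (φ ⁻¹' {v}) y⟫_ℂ‖
      ≤ ∑ v ∈ φ.range, ‖v * ⟪x, M (φ ⁻¹' {v}) y⟫_ℂ‖ := norm_sum_le _ _
    _ ≤ ∑ v ∈ φ.range, Real.sqrt ((M.diag x).real (φ ⁻¹' {v}))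
          * Real.sqrt ((M.diag y).real (φ ⁻¹' {v})) := by
        refine Finset.sum_le_sum fun v hv => ?_
        obtain ⟨w, rfl⟩ := SimpleFunc.mem_range.1 hv
        have hm := φ.measurableSet_preimage {φ w}
        have h := norm_inner_le_of_isPositive (M.isPositive _ hm) x y
        rw [M.inner_eq_ofReal x hm, M.inner_eq_ofReal y hm, Complex.ofReal_re,
          Complex.ofReal_re] at h
        rw [norm_mul]
        exact (mul_le_of_le_one_left (norm_nonneg _) (hφ w)).trans h
    _ ≤ Real.sqrt (∑ v ∈ φ.range, (M.diag x).real (φ ⁻¹' {v}))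
          * Real.sqrt (∑ v ∈ φ.range, (M.diag y).real (φ ⁻¹' {v})) :=
        Real.sum_sqrt_mul_sqrt_le _ (fun _ => measureReal_nonneg) (fun _ => measureReal_nonneg)
    _ = ‖x‖ * ‖y‖ := by
        rw [hsum, hsum, Real.sqrt_sq (norm_nonneg _), Real.sqrt_sq (norm_nonneg _)]

open Filter Topology in
/-- The operator `∫ s dM` for a measurable function `s` bounded by one. -/
theorem POVM.exists_integral (M : POVM H) {s : ℝ → ℂ} (hs : Measurable s)
    (h1 : ∀ y, ‖s y‖ ≤ 1) :
    ∃ N : H →L[ℂ] H, (∀ x, ⟪x, N x⟫_ℂ = ∫ y, s y ∂(M.diag x)) ∧ ∀ x, ‖N x‖ ≤ ‖x‖ := by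
  have hsm := hs.stronglyMeasurable
  set A : ℕ → H →L[ℂ] H := fun n => M.simpleOp (hsm.approxBounded 1 n) with hA
  have hb : ∀ n x y, ‖⟪A n x, y⟫_ℂ‖ ≤ ‖x‖ * ‖y‖ := by
    intro n x y
    rw [norm_inner_symm, mul_comm]
    exact M.norm_inner_simpleOp_le _ (hsm.norm_approxBounded_le zero_le_one n) _ _
  -- On the diagonal the approximants converge by dominated convergence. Polarization below extends
  -- this to all pairs, and the limit is a bounded sesquilinear form, represented by an operator.
  have hd : ∀ z, Tendsto (fun n => ⟪A n z, z⟫_ℂ) atTop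
      (𝓝 ((starRingEnd ℂ) (∫ y, s y ∂(M.diag z)))) := by
    intro z
    have h2 : Tendsto (fun n => ∫ y, hsm.approxBounded 1 n y ∂(M.diag z)) atTop
        (𝓝 (∫ y, s y ∂(M.diag z))) := by
      refine tendsto_integral_of_dominated_convergence (fun _ => 1)
        (fun n => (SimpleFunc.stronglyMeasurable _).aestronglyMeasurable) (integrable_const _)
        (fun n => Eventually.of_forall fun y => hsm.norm_approxBounded_le zero_le_one n y)
        (Eventually.of_forall fun y => hsm.tendsto_approxBounded_of_norm_le (h1 y))
    refine ((Complex.continuous_conj.tendsto _).comp h2).congr fun n => ?_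
    rw [Function.comp_apply, ← M.inner_simpleOp_self, inner_conj_symm]
  have hlim : ∀ x y, ∃ l, Tendsto (fun n => ⟪A n x, y⟫_ℂ) atTop (𝓝 l) := by
    intro x y
    have h3 := ((((hd (x + y)).sub (hd (x - y))).sub ((hd (x + Complex.I • y)).const_mul
        Complex.I)).add ((hd (x - Complex.I • y)).const_mul Complex.I)).div_const 4
    exact ⟨_, h3.congr fun n => (inner_map_polarization' (A n : H →ₗ[ℂ] H) x y).symm⟩
  choose b hbl using hlim
  have hbb : ∀ x y, ‖b x y‖ ≤ 1 * ‖x‖ * ‖y‖ := fun x y => by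
    rw [one_mul]
    exact le_of_tendsto (hbl x y).norm (Eventually.of_forall fun n => hb n x y)
  let b' : H →ₗ⋆[ℂ] H →ₗ[ℂ] ℂ := LinearMap.mk₂'ₛₗ (starRingEnd ℂ) (RingHom.id ℂ) b
    (fun x x' y => tendsto_nhds_unique (hbl _ _) (((hbl x y).add (hbl x' y)).congr fun n => by
      simp))
    (fun c x y => tendsto_nhds_unique (hbl _ _) (((hbl x y).const_mul _).congr fun n => by
      simp [mul_comm]))
    (fun x y y' => tendsto_nhds_unique (hbl _ _) (((hbl x y).add (hbl x y')).congr fun n => by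
      simp))
    (fun c x y => tendsto_nhds_unique (hbl _ _) (((hbl x y).const_mul _).congr fun n => by
      simp))
  let B := b'.mkContinuous₂ 1 hbb
  have hB : ∀ x y, ⟪InnerProductSpace.continuousLinearMapOfBilin B x, y⟫_ℂ = b x y := fun x y =>
    InnerProductSpace.continuousLinearMapOfBilin_apply B x y
  refine ⟨InnerProductSpace.continuousLinearMapOfBilin B, fun x => ?_, fun x => ?_⟩
  · rw [← inner_conj_symm, hB, tendsto_nhds_unique (hbl x x) (hd x), Complex.conj_conj]
  · set N := InnerProductSpace.continuousLinearMapOfBilin B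
    -- Evaluating the bounded form at `(x, N x)` gives `‖N x‖² ≤ ‖x‖ ‖N x‖`.
    have h2 := hbb x (N x)
    rw [← hB, one_mul, inner_self_eq_norm_sq_to_K, norm_pow] at h2
    simp only [RCLike.norm_ofReal, abs_norm] at h2
    rcases (norm_nonneg (N x)).eq_or_lt with h0 | h0
    · rw [← h0]; exact norm_nonneg _
    · rw [sq] at h2
      exact le_of_mul_le_mul_right h2 h0

end General

/-! ### Covariant measurements and mixed states -/

section General

variable {H : Type*} [NormedAddCommGroup H] [InnerProductSpace ℂ H] [CompleteSpace H]

theorem outcomeMeasure_apply (ρ : DensityOperator H) (M : POVM H) {B : Set ℝ}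
    (hB : MeasurableSet B) :
    outcomeMeasure ρ M B = ENNReal.ofReal (opTrace (ρ.op * M B)).re :=
  Measure.ofMeasurable_apply B hB

/-- Cyclicity of the trace, `Tr S S† M(B) = ∑ⱼ ⟨S eⱼ, M(B) S eⱼ⟩`, reduces mixed states to
unnormalized vectors. -/
theorem outcomeMeasure_eq_sum (ρ : DensityOperator H) (M : POVM H) (S : H →L[ℂ] H)
    (hS : ρ.op = S * star S) (hsum : HasSum (fun j => ‖S (onb H j)‖ ^ 2) 1) :
    outcomeMeasure ρ M = Measure.sum fun j => M.diag (S (onb H j)) := by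
  ext B hB
  rw [outcomeMeasure_apply ρ M hB, ofReal_trace_eq ρ S hS hsum _ (M.isPositive _ hB),
    Measure.sum_apply _ hB]
  simp only [M.diag_apply _ hB]

theorem POVM.IsCovariant.conj_eq {f : ℝ → unitary (H →L[ℂ] H)} {M : POVM H}
    (hM : M.IsCovariant f) (g : ℝ) {B : Set ℝ} (hB : MeasurableSet B) (x : H) :
    ⟪(f g : H →L[ℂ] H) x, M B ((f g : H →L[ℂ] H) x)⟫_ℂ = ⟪x, M ((fun y => g + y) ⁻¹' B) x⟫_ℂ := by
  have hB' : MeasurableSet ((fun y => g + y) ⁻¹' B) := (measurable_const_add g) hB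
  have h := hM g _ hB'
  rw [Set.image_preimage_eq B (add_left_surjective g)] at h
  have hu : star (f g : H →L[ℂ] H) * (f g : H →L[ℂ] H) = 1 := (Unitary.mem_iff.1 (f g).2).1
  have hu2 : ∀ y, star (f g : H →L[ℂ] H) ((f g : H →L[ℂ] H) y) = y := fun y => by
    rw [← mul_apply_eq_comp, hu, one_apply_eq_self]
  rw [← h, ← ContinuousLinearMap.adjoint_inner_right, ← ContinuousLinearMap.star_eq_adjoint]
  simp only [mul_apply_eq_comp, hu2]

theorem POVM.IsCovariant.diag_eq {f : ℝ → unitary (H →L[ℂ] H)} {M : POVM H}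
    (hM : M.IsCovariant f) (g : ℝ) (x : H) :
    M.diag ((f g : H →L[ℂ] H) x) = (M.diag x).map (fun y => g + y) := by
  ext B hB
  rw [Measure.map_apply (measurable_const_add g) hB, M.diag_apply _ hB,
    M.diag_apply _ ((measurable_const_add g) hB), hM.conj_eq g hB]

/-- The evolved state has the factor `f(g) S`, and covariance translates its outcome distributions
by `g`. So the error does not depend on `g` and the supremum is over a constant. -/
theorem worstError_eq {f : ℝ → unitary (H →L[ℂ] H)} {M : POVM H} (hM : M.IsCovariant f)
    (ρ : DensityOperator H) (S : H →L[ℂ] H) (hS : ρ.op = S * star S)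
    (hsum : HasSum (fun j => ‖S (onb H j)‖ ^ 2) 1) :
    worstError f ρ M = ∑' j, M.secondMoment (S (onb H j)) := by
  have h : ∀ g, errorAt f ρ M g = ∑' j, M.secondMoment (S (onb H j)) := by
    intro g
    have hU : ∀ x, ‖(f g : H →L[ℂ] H) x‖ = ‖x‖ := fun x =>
      ContinuousLinearMap.norm_map_of_mem_unitary (f g).2 x
    rw [errorAt, outcomeMeasure_eq_sum (ρ.evolve (f g)) M ((f g : H →L[ℂ] H) * S)
      (by
        change (f g : H →L[ℂ] H) * ρ.op * star (f g : H →L[ℂ] H) = _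
        rw [hS, star_mul]
        simp only [mul_assoc])
      (by simpa only [mul_apply_eq_comp, hU] using hsum), lintegral_sum_measure]
    refine tsum_congr fun j => ?_
    rw [mul_apply_eq_comp, hM.diag_eq, lintegral_map (by fun_prop) (measurable_const_add g)]
    simp only [add_sub_cancel_left]
    rfl
  rw [worstError]
  simp only [h, ciSup_const]

omit [CompleteSpace H] in
theorem ketbra_apply (φ x : H) : ketbra φ x = ⟪φ, x⟫_ℂ • φ := by
  simp [ketbra]

/-- The projection onto a unit vector serves as its own factor `S`. -/
theorem ketbra_mul_star (φ : H) (hφ : ‖φ‖ = 1) : ketbra φ = ketbra φ * star (ketbra φ) := by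
  ext1 x
  refine ext_inner_left ℂ fun y => ?_
  rw [mul_apply_eq_comp, ContinuousLinearMap.star_eq_adjoint]
  have h : ⟪φ, (ContinuousLinearMap.adjoint (ketbra φ)) x⟫_ℂ = ⟪φ, x⟫_ℂ := by
    rw [ContinuousLinearMap.adjoint_inner_right, ketbra_apply, inner_self_eq_norm_sq_to_K, hφ]
    simp
  rw [ketbra_apply, ketbra_apply, h]

theorem hasSum_norm_ketbra_onb (φ : H) :
    HasSum (fun j => ‖⟪φ, onb H j⟫_ℂ‖ ^ 2) (‖φ‖ ^ 2) := by
  simpa only [norm_inner_symm] using hasSum_normSq_inner (onb H) φ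

theorem opTrace_ketbra (φ : H) : opTrace (ketbra φ) = ((‖φ‖ ^ 2 : ℝ) : ℂ) := by
  have h := hasSum_norm_ketbra_onb φ
  have h2 : ∀ j, ⟪onb H j, ketbra φ (onb H j)⟫_ℂ = ((‖⟪φ, onb H j⟫_ℂ‖ ^ 2 : ℝ) : ℂ) := by
    intro j
    rw [ketbra_apply, inner_smul_right, ← inner_conj_symm (onb H j) φ, Complex.mul_conj,
      Complex.normSq_eq_norm_sq]
  rw [opTrace]
  simp only [h2]
  exact (Complex.hasSum_ofReal.2 h).tsum_eq

theorem norm_eq_one_of_op_eq_ketbra {ρ : DensityOperator H} {φ : H} (h : ρ.op = ketbra φ) :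
    ‖φ‖ = 1 := by
  have h1 := ρ.trace_eq_one
  rw [h, opTrace_ketbra] at h1
  have h2 : ‖φ‖ ^ 2 = 1 := by exact_mod_cast h1
  exact (pow_eq_one_iff_of_nonneg (norm_nonneg _) two_ne_zero).1 h2

/-- The pure state of a unit vector. -/
def pureState (φ : H) (hφ : ‖φ‖ = 1) : DensityOperator H where
  op := ketbra φ
  isPositive := by
    rw [← ContinuousLinearMap.nonneg_iff_isPositive, ketbra_mul_star φ hφ]
    exact mul_star_self_nonneg _
  trace_eq_one := by rw [opTrace_ketbra, hφ]; simp

theorem worstError_of_op_eq_ketbra {f : ℝ → unitary (H →L[ℂ] H)} {M : POVM H}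
    (hM : M.IsCovariant f) {ρ : DensityOperator H} {φ : H} (h : ρ.op = ketbra φ) :
    worstError f ρ M = M.secondMoment φ := by
  have hφ := norm_eq_one_of_op_eq_ketbra h
  have hk := hasSum_norm_ketbra_onb φ
  rw [hφ, one_pow] at hk
  rw [worstError_eq hM ρ (ketbra φ) (h.trans (ketbra_mul_star φ hφ))
    (by simpa only [ketbra_apply, norm_smul, hφ, mul_one] using hk)]
  simp only [ketbra_apply, M.secondMoment_smul]
  rw [ENNReal.tsum_mul_right, ← ENNReal.ofReal_tsum_of_nonneg (fun _ => by positivity) hk.summable,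
    hk.tsum_eq, ENNReal.ofReal_one, one_mul]

theorem op_eq_ketbra_of_forall {ρ : DensityOperator H} {S : H →L[ℂ] H} (hS : ρ.op = S * star S)
    (hsum : HasSum (fun j => ‖S (onb H j)‖ ^ 2) 1) {φ : H} (hφ : ‖φ‖ = 1)
    (h : ∀ j, ∃ c : ℂ, S (onb H j) = c • φ) : ρ.op = ketbra φ := by
  choose c hc using h
  simp only [hc, norm_smul, hφ, mul_one] at hsum
  ext1 y
  refine ext_inner_left ℂ fun x => ?_
  have h1 := (onb H).hasSum_inner_mul_inner (star S x) (star S y)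
  have e1 : ∀ j, ⟪star S x, onb H j⟫_ℂ * ⟪onb H j, star S y⟫_ℂ
      = ((‖c j‖ ^ 2 : ℝ) : ℂ) * (⟪x, φ⟫_ℂ * ⟪φ, y⟫_ℂ) := by
    intro j
    rw [ContinuousLinearMap.star_eq_adjoint, ContinuousLinearMap.adjoint_inner_left,
      ContinuousLinearMap.adjoint_inner_right, hc, inner_smul_left, inner_smul_right,
      ← Complex.normSq_eq_norm_sq, ← Complex.mul_conj]
    ring
  simp only [e1] at h1
  have h2 := (Complex.hasSum_ofReal.2 hsum).mul_right (⟪x, φ⟫_ℂ * ⟪φ, y⟫_ℂ)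
  rw [hS, mul_apply_eq_comp, ketbra_apply, inner_smul_right, ← ContinuousLinearMap.adjoint_inner_left,
    ← ContinuousLinearMap.star_eq_adjoint, h1.unique h2]
  simp [mul_comm]

open Filter Topology in
/-- For a covariant measurement, the operator `∫ e^{ity} M(dy)` intertwines up to a phase. -/
theorem POVM.IsCovariant.exists_charOp {f : ℝ → unitary (H →L[ℂ] H)} {M : POVM H}
    (hM : M.IsCovariant f) (t : ℝ) :
    ∃ N : H →L[ℂ] H, (∀ x, ⟪x, N x⟫_ℂ = ∫ y, character t y ∂(M.diag x)) ∧
      (∀ x, ‖N x‖ ≤ ‖x‖) ∧ ∀ (g : ℝ) (x : H),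
        N ((f g : H →L[ℂ] H) x) = character t g • (f g : H →L[ℂ] H) (N x) := by
  obtain ⟨N, hN, hN1⟩ := M.exists_integral (continuous_character t).measurable
    (fun y => (norm_character t y).le)
  refine ⟨N, hN, hN1, fun g x => ?_⟩
  have hu : star (f g : H →L[ℂ] H) * (f g : H →L[ℂ] H) = 1 := (Unitary.mem_iff.1 (f g).2).1
  have hu' : (f g : H →L[ℂ] H) * star (f g : H →L[ℂ] H) = 1 := (Unitary.mem_iff.1 (f g).2).2
  -- A bounded operator is determined by its quadratic form, and there the identity is the
  -- translation of `M.diag` by `g`.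
  have h : star (f g : H →L[ℂ] H) * N * (f g : H →L[ℂ] H) = character t g • N := by
    have h1 : ((star (f g : H →L[ℂ] H) * N * (f g : H →L[ℂ] H) : H →L[ℂ] H) : H →ₗ[ℂ] H)
        = ((character t g • N : H →L[ℂ] H) : H →ₗ[ℂ] H) := by
      rw [← ext_inner_map]
      intro z
      rw [← inner_conj_symm, ← inner_conj_symm _ z]
      congr 1
      simp only [ContinuousLinearMap.coe_coe, mul_apply_eq_comp, smul_apply]
      rw [ContinuousLinearMap.star_eq_adjoint, ContinuousLinearMap.adjoint_inner_right, hN,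
        inner_smul_right, hN, hM.diag_eq, integral_map (measurable_const_add g).aemeasurable
          (continuous_character t).aestronglyMeasurable, ← integral_const_mul]
      refine integral_congr_ae (Eventually.of_forall fun y => ?_)
      simp only [character]
      rw [← Complex.exp_add]
      congr 1
      push_cast
      ring
    exact ContinuousLinearMap.coe_injective h1
  have h2 : N * (f g : H →L[ℂ] H) = (f g : H →L[ℂ] H) * (character t g • N) := by
    rw [← h, ← mul_assoc, ← mul_assoc, hu', one_mul]
  have h3 := congrArg (fun T : H →L[ℂ] H => T x) h2
  simpa only [mul_apply_eq_comp, smul_apply, map_smul] using h3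

-- The left side is `∫ (2 - 2 cos(ty))` against the distribution of `x`, and `2 - 2 cos s ≤ s²`.
omit [CompleteSpace H] in
theorem POVM.ofReal_le_secondMoment (M : POVM H) (x : H) (t : ℝ) :
    ENNReal.ofReal (2 * ‖x‖ ^ 2 - 2 * (∫ y, character t y ∂(M.diag x)).re)
      ≤ ENNReal.ofReal (t ^ 2) * M.secondMoment x := by
  have hi : Integrable (character t) (M.diag x) :=
    Integrable.of_bound (continuous_character t).aestronglyMeasurable 1
      (Filter.Eventually.of_forall fun y => (norm_character t y).le)
  have hre : ∀ y, (character t y).re = Real.cos (y * t) := by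
    intro y
    have : Complex.I * y * t = ((y * t : ℝ) : ℂ) * Complex.I := by push_cast; ring
    rw [character, this, Complex.exp_ofReal_mul_I_re]
  have h1 : (∫ y, character t y ∂(M.diag x)).re = ∫ y, Real.cos (y * t) ∂(M.diag x) := by
    rw [← RCLike.re_eq_complex_re, ← integral_re hi]
    exact integral_congr_ae (Filter.Eventually.of_forall hre)
  have hi2 : Integrable (fun y => Real.cos (y * t)) (M.diag x) :=
    hi.re.congr (Filter.Eventually.of_forall hre)
  have h2 : 2 * ‖x‖ ^ 2 = ∫ _y, (2 : ℝ) ∂(M.diag x) := by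
    rw [integral_const, Measure.real, M.diag_univ, ENNReal.toReal_ofReal (by positivity)]
    simp [mul_comm]
  have hi3 : Integrable (fun y => 2 - 2 * Real.cos (y * t)) (M.diag x) :=
    (integrable_const _).sub (hi2.const_mul 2)
  rw [h1, h2, ← integral_const_mul, ← integral_sub (integrable_const _) (hi2.const_mul 2),
    ofReal_integral_eq_lintegral_ofReal hi3
      (Filter.Eventually.of_forall fun y => by
        simp only [Pi.zero_apply]
        linarith [Real.cos_le_one (y * t)]),
    POVM.secondMoment, ← lintegral_const_mul _ (by fun_prop)]
  refine lintegral_mono fun y => ?_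
  rw [← ENNReal.ofReal_mul (by positivity)]
  refine ENNReal.ofReal_le_ofReal ?_
  have := Real.one_sub_sq_div_two_le_cos (x := y * t)
  nlinarith

end General

/-! ### Wave functions and their zero extensions -/

section Wave

variable {L : ℝ}

theorem extend_of_notMem (φ : WaveSpace L) {x : ℝ} (hx : x ∉ Set.Icc (-L) L) : extend φ x = 0 :=
  Set.indicator_of_notMem hx _

theorem extend_of_mem (φ : WaveSpace L) {x : ℝ} (hx : x ∈ Set.Icc (-L) L) : extend φ x = φ x :=
  Set.indicator_of_mem hx _

theorem memLp_extend (φ : WaveSpace L) : MemLp (extend φ) 2 :=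
  memLp_normMeasure.1 ((memLp_indicator_iff_restrict measurableSet_Icc).2 (Lp.memLp φ))

theorem integrable_extend (φ : WaveSpace L) : Integrable (extend φ) :=
  integrable_of_support (memLp_extend φ) fun _ hx => extend_of_notMem φ hx

theorem extend_ae_of_ae {φ : WaveSpace L} {f : ℝ → ℂ} (h : φ =ᵐ[intervalMeasure L] f) :
    extend φ =ᵐ[volume] (Set.Icc (-L) L).indicator f := by
  rw [← ae_normMeasure]
  exact (ae_eq_restrict_iff_indicator_ae_eq measurableSet_Icc).1 h

theorem integral_intervalMeasure {E : Type*} [NormedAddCommGroup E] [NormedSpace ℝ E]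
    (f : ℝ → E) :
    ∫ x, f x ∂(intervalMeasure L) = ∫ x, (Set.Icc (-L) L).indicator f x ∂normMeasure :=
  (integral_indicator measurableSet_Icc).symm

theorem ae_intervalMeasure_iff {p : ℝ → Prop} :
    (∀ᵐ x ∂(intervalMeasure L), p x) ↔ ∀ᵐ x, x ∈ Set.Icc (-L) L → p x := by
  rw [intervalMeasure, ae_restrict_iff' measurableSet_Icc, ae_normMeasure]

theorem ext_of_extend_ae {φ ψ : WaveSpace L} (h : extend φ =ᵐ[volume] extend ψ) : φ = ψ := by
  refine Lp.ext ?_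
  have : ∀ᵐ x ∂(intervalMeasure L), φ x = ψ x := by
    rw [ae_intervalMeasure_iff]
    filter_upwards [h] with x hx hmem
    rwa [extend_of_mem φ hmem, extend_of_mem ψ hmem] at hx
  exact this

theorem extend_smul (c : ℂ) (φ : WaveSpace L) :
    extend (c • φ) =ᵐ[volume] fun x => c * extend φ x := by
  refine (extend_ae_of_ae (Lp.coeFn_smul c φ)).trans (Filter.Eventually.of_forall fun x => ?_)
  by_cases hx : x ∈ Set.Icc (-L) L
  · simp [hx, extend_of_mem φ hx]
  · simp [hx, extend_of_notMem φ hx]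

theorem extend_add (φ ψ : WaveSpace L) :
    extend (φ + ψ) =ᵐ[volume] fun x => extend φ x + extend ψ x := by
  refine (extend_ae_of_ae (Lp.coeFn_add φ ψ)).trans (Filter.Eventually.of_forall fun x => ?_)
  by_cases hx : x ∈ Set.Icc (-L) L
  · simp [hx, extend_of_mem φ hx, extend_of_mem ψ hx]
  · simp [hx, extend_of_notMem φ hx, extend_of_notMem ψ hx]

theorem extend_phaseRep (g : ℝ) (φ : WaveSpace L) :
    extend ((phaseRep L g : WaveSpace L →L[ℂ] WaveSpace L) φ)
      =ᵐ[volume] fun x => character g x * extend φ x := by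
  refine (extend_ae_of_ae (coeFn_phaseLin L g φ)).trans (Filter.Eventually.of_forall fun x => ?_)
  by_cases hx : x ∈ Set.Icc (-L) L
  · simp [hx, extend_of_mem φ hx]
  · simp [hx, extend_of_notMem φ hx]

theorem extend_unitWave :
    extend (unitWave L) =ᵐ[volume] (Set.Icc (-L) L).indicator fun _ => (1 : ℂ) :=
  extend_ae_of_ae (memLp_const (1 : ℂ)).coeFn_toLp

theorem inner_eq_integral_extend (φ ψ : WaveSpace L) :
    ⟪φ, ψ⟫_ℂ = ∫ x, extend ψ x * (starRingEnd ℂ) (extend φ x) ∂normMeasure := by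
  rw [L2.inner_def, integral_intervalMeasure]
  refine integral_congr_ae (Filter.Eventually.of_forall fun x => ?_)
  by_cases hx : x ∈ Set.Icc (-L) L
  · simp [hx, extend_of_mem φ hx, extend_of_mem ψ hx]
  · simp [hx, extend_of_notMem φ hx]

theorem norm_sq_eq_integral_extend (φ : WaveSpace L) :
    ‖φ‖ ^ 2 = ∫ x, ‖extend φ x‖ ^ 2 ∂normMeasure := by
  have h := inner_eq_integral_extend φ φ
  rw [integral_normSq_eq, inner_self_eq_norm_sq_to_K] at h
  refine Complex.ofReal_injective ?_
  rw [← h]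
  push_cast
  rfl

theorem invFourier_eq_lineFourier (φ : WaveSpace L) (g : ℝ) :
    invFourier φ g = lineFourier (extend φ) g := by
  rw [invFourier, lineFourier, integral_intervalMeasure]
  refine integral_congr_ae (Filter.Eventually.of_forall fun x => ?_)
  by_cases hx : x ∈ Set.Icc (-L) L
  · simp [hx, extend_of_mem φ hx]
  · simp [hx, extend_of_notMem φ hx]

theorem integral_normMeasure_real (f : ℝ → ℝ) :
    ∫ x, f x ∂normMeasure = 1 / Real.sqrt (2 * Real.pi) * ∫ x, f x := by
  rw [normMeasure, integral_smul_measure, ENNReal.toReal_ofReal (by positivity), smul_eq_mul]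

theorem ae_eq_of_expInt_eq {f h : ℝ → ℂ} (hf : Integrable f) (hh : Integrable h)
    (H : ∀ g, expInt f g = expInt h g) : f =ᵐ[volume] h := by
  refine ae_eq_of_lineFourier_eq hf hh fun g => ?_
  have h1 := H (-g)
  rw [expInt_eq_lineFourier, expInt_eq_lineFourier, neg_neg] at h1
  refine mul_left_cancel₀ ?_ h1
  exact_mod_cast (by positivity : Real.sqrt (2 * Real.pi) ≠ 0)

theorem inner_phaseRep (φ ψ : WaveSpace L) (g : ℝ) :
    ⟪φ, (phaseRep L g : WaveSpace L →L[ℂ] WaveSpace L) ψ⟫_ℂ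
      = ((1 / Real.sqrt (2 * Real.pi) : ℝ) : ℂ)
        * expInt (fun x => extend ψ x * (starRingEnd ℂ) (extend φ x)) g := by
  rw [inner_eq_integral_extend, integral_normMeasure, expInt]
  congr 1
  refine integral_congr_ae ?_
  filter_upwards [extend_phaseRep g ψ] with x hx
  rw [hx, character, mul_assoc]
  congr 2
  ring

/-- An operator with the intertwining property of `∫ e^{ity} M(dy)` is a translation by `t`
followed by a multiplication. -/
theorem extend_charOp {N : WaveSpace L →L[ℂ] WaveSpace L} {t : ℝ}
    (hN : ∀ (g : ℝ) (x : WaveSpace L), N ((phaseRep L g : WaveSpace L →L[ℂ] WaveSpace L) x)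
      = character t g • (phaseRep L g : WaveSpace L →L[ℂ] WaveSpace L) (N x)) (y : WaveSpace L) :
    extend (N y) =ᵐ[volume] fun x => extend y (x + t)
      * (starRingEnd ℂ) (extend (ContinuousLinearMap.adjoint N (unitWave L)) (x + t)) := by
  set n := ContinuousLinearMap.adjoint N (unitWave L)
  set q : ℝ → ℂ := fun x => extend y x * (starRingEnd ℂ) (extend n x) with hq
  have hqi : Integrable q := (memLp_extend y).integrable_mul (memLp_extend n).star
  refine ae_eq_of_expInt_eq (integrable_extend _) (hqi.comp_add_right t) fun g => ?_
  -- The matrix element is computed in two ways, with `n = N† 1`. The intertwining relation gives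
  -- the Fourier integral of `N y` times `e^{itg}`; moving `N` to the left gives that of `q`. The
  -- phase is a translation by `t`, and Fourier integrals determine a function.
  have h1 : ⟪unitWave L, N ((phaseRep L g : WaveSpace L →L[ℂ] WaveSpace L) y)⟫_ℂ
      = ⟪n, (phaseRep L g : WaveSpace L →L[ℂ] WaveSpace L) y⟫_ℂ :=
    (ContinuousLinearMap.adjoint_inner_left _ _ _).symm
  rw [hN, inner_smul_right, inner_phaseRep, inner_phaseRep, mul_left_comm] at h1
  have hc : ((1 / Real.sqrt (2 * Real.pi) : ℝ) : ℂ) ≠ 0 := by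
    exact_mod_cast (by positivity : (1 / Real.sqrt (2 * Real.pi) : ℝ) ≠ 0)
  have h2 := mul_left_cancel₀ hc h1
  have h3 : expInt (fun x => extend (N y) x * (starRingEnd ℂ) (extend (unitWave L) x)) g
      = expInt (extend (N y)) g := by
    refine integral_congr_ae ?_
    filter_upwards [extend_unitWave (L := L)] with x hx
    rw [hx]
    by_cases hmem : x ∈ Set.Icc (-L) L
    · simp [hmem]
    · simp [extend_of_notMem (N y) hmem]
  rw [h3] at h2
  change _ = expInt (fun x => q (x + t)) g
  rw [expInt_comp_add, ← h2, character, ← mul_assoc, ← Complex.exp_add]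
  have : -(Complex.I * g * t) + Complex.I * g * t = 0 := by ring
  rw [this, Complex.exp_zero, one_mul]

/-- By the translation formula `‖N y‖² = ∫ |y|² |n|²`. Contractivity at indicators of measurable
sets then bounds the average of `|n|²` over each set by one. -/
theorem norm_extend_charOp_le {N : WaveSpace L →L[ℂ] WaveSpace L} {t : ℝ}
    (hN : ∀ (g : ℝ) (x : WaveSpace L), N ((phaseRep L g : WaveSpace L →L[ℂ] WaveSpace L) x)
      = character t g • (phaseRep L g : WaveSpace L →L[ℂ] WaveSpace L) (N x))
    (hN1 : ∀ x, ‖N x‖ ≤ ‖x‖) :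
    ∀ᵐ x, ‖extend (ContinuousLinearMap.adjoint N (unitWave L)) x‖ ≤ 1 := by
  set n := ContinuousLinearMap.adjoint N (unitWave L)
  have hint : ∀ y : WaveSpace L, ∫ x, ‖extend y x‖ ^ 2 * ‖extend n x‖ ^ 2 ∂normMeasure
      ≤ ∫ x, ‖extend y x‖ ^ 2 ∂normMeasure := by
    intro y
    rw [← norm_sq_eq_integral_extend]
    refine le_trans (le_of_eq ?_) (pow_le_pow_left₀ (norm_nonneg _) (hN1 y) 2)
    rw [norm_sq_eq_integral_extend, integral_normMeasure_real, integral_normMeasure_real]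
    congr 1
    rw [← integral_add_right_eq_self (fun x => ‖extend y x‖ ^ 2 * ‖extend n x‖ ^ 2) t]
    refine integral_congr_ae ?_
    filter_upwards [extend_charOp hN y] with x hx
    rw [hx, norm_mul, RCLike.norm_conj, mul_pow]
  have hle : ∀ᵐ x ∂(intervalMeasure L), ‖n x‖ ^ 2 ≤ 1 := by
    refine ae_le_of_forall_setIntegral_le (integrable_normSq (Lp.memLp n)) (integrable_const _) ?_
    intro A hA _
    have hmem : MemLp (A.indicator fun _ => (1 : ℂ)) 2 (intervalMeasure L) :=
      (memLp_const _).indicator hA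
    have h1 := hint (hmem.toLp _)
    have h2 := extend_ae_of_ae hmem.coeFn_toLp
    rw [← ae_normMeasure] at h2
    have e1 : ∫ x, ‖extend (hmem.toLp _) x‖ ^ 2 * ‖extend n x‖ ^ 2 ∂normMeasure
        = ∫ x in A, ‖n x‖ ^ 2 ∂(intervalMeasure L) := by
      rw [← integral_indicator hA, integral_intervalMeasure]
      refine integral_congr_ae ?_
      filter_upwards [h2] with x hx
      rw [hx]
      by_cases hI : x ∈ Set.Icc (-L) L
      · by_cases hxA : x ∈ A
        · simp [hI, hxA, extend_of_mem n hI]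
        · simp [hI, hxA]
      · simp [hI]
    have e2 : ∫ x, ‖extend (hmem.toLp _) x‖ ^ 2 ∂normMeasure
        = ∫ x in A, (1 : ℝ) ∂(intervalMeasure L) := by
      rw [← integral_indicator hA, integral_intervalMeasure]
      refine integral_congr_ae ?_
      filter_upwards [h2] with x hx
      rw [hx]
      by_cases hI : x ∈ Set.Icc (-L) L
      · by_cases hxA : x ∈ A
        · simp [hI, hxA]
        · simp [hI, hxA]
      · simp [hI]
    rwa [e1, e2] at h1
  rw [ae_intervalMeasure_iff] at hle
  filter_upwards [hle] with x hx
  by_cases hI : x ∈ Set.Icc (-L) L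
  · rw [extend_of_mem n hI]
    exact (sq_le_one_iff₀ (norm_nonneg _)).1 (hx hI)
  · rw [extend_of_notMem n hI]
    simp

theorem integrable_norm_mul_shift (ψ : WaveSpace L) (t : ℝ) :
    Integrable (fun x => ‖extend ψ (x + t)‖ * ‖extend ψ x‖) :=
  (memLp_comp_add (memLp_extend ψ) t).norm.integrable_mul (memLp_extend ψ).norm

/-- The multiplier of `N` depends on the measurement and only its modulus is controlled, hence the
absolute values on the right. -/
theorem re_inner_charOp_le {N : WaveSpace L →L[ℂ] WaveSpace L} {t : ℝ}
    (hN : ∀ (g : ℝ) (x : WaveSpace L), N ((phaseRep L g : WaveSpace L →L[ℂ] WaveSpace L) x)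
      = character t g • (phaseRep L g : WaveSpace L →L[ℂ] WaveSpace L) (N x))
    (hN1 : ∀ x, ‖N x‖ ≤ ‖x‖) (ψ : WaveSpace L) :
    (⟪ψ, N ψ⟫_ℂ).re ≤ ∫ x, ‖extend ψ (x + t)‖ * ‖extend ψ x‖ ∂normMeasure := by
  refine (Complex.re_le_norm _).trans ?_
  rw [inner_eq_integral_extend]
  refine norm_integral_le_of_norm_le ?_ ?_
  · exact (integrable_norm_mul_shift ψ t).smul_measure ENNReal.ofReal_ne_top
  · rw [ae_normMeasure]
    have hshift := (measurePreserving_add_right volume t).quasiMeasurePreserving.ae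
      (norm_extend_charOp_le hN hN1)
    filter_upwards [extend_charOp hN ψ, hshift] with x hx h1
    rw [hx, norm_mul, norm_mul, RCLike.norm_conj, RCLike.norm_conj]
    exact mul_le_mul_of_nonneg_right (mul_le_of_le_one_right (norm_nonneg _) h1) (norm_nonneg _)

theorem integral_norm_diff_sq (ψ : WaveSpace L) (t : ℝ) :
    ∫ x, ‖((‖extend ψ (x + t)‖ : ℝ) : ℂ) - (‖extend ψ x‖ : ℝ)‖ ^ 2 ∂normMeasure
      = 2 * ‖ψ‖ ^ 2 - 2 * ∫ x, ‖extend ψ (x + t)‖ * ‖extend ψ x‖ ∂normMeasure := by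
  rw [norm_sq_eq_integral_extend, integral_normMeasure_real, integral_normMeasure_real,
    integral_normMeasure_real]
  have h1 := integrable_normSq (memLp_extend ψ)
  have h2 := integrable_normSq (memLp_comp_add (memLp_extend ψ) t)
  have e : ∀ x, ‖((‖extend ψ (x + t)‖ : ℝ) : ℂ) - (‖extend ψ x‖ : ℝ)‖ ^ 2
      = ‖extend ψ (x + t)‖ ^ 2 + ‖extend ψ x‖ ^ 2
        - 2 * (‖extend ψ (x + t)‖ * ‖extend ψ x‖) := by
    intro x
    rw [← Complex.ofReal_sub, Complex.norm_real, Real.norm_eq_abs, sq_abs]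
    ring
  have h12 : Integrable (fun x => ‖extend ψ (x + t)‖ ^ 2 + ‖extend ψ x‖ ^ 2) := h2.add h1
  simp only [e]
  rw [integral_sub h12 ((integrable_norm_mul_shift ψ t).const_mul 2), integral_add h2 h1,
    integral_const_mul, integral_add_right_eq_self (fun x => ‖extend ψ x‖ ^ 2) t]
  ring

/-- The link between measurement and Dirichlet problem: both `2‖ψ‖² - 2 Re⟨ψ, Nψ⟩ ≤ t² ∫ y²` and the
bound of `⟨ψ, Nψ⟩` by the autocorrelation of `|ψ|` hold for every covariant `M`. -/
theorem POVM.IsCovariant.ofReal_norm_diff_le {M : POVM (WaveSpace L)}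
    (hM : M.IsCovariant (phaseRep L)) (ψ : WaveSpace L) (t : ℝ) :
    ENNReal.ofReal
      (∫ x, ‖((‖extend ψ (x + t)‖ : ℝ) : ℂ) - (‖extend ψ x‖ : ℝ)‖ ^ 2 ∂normMeasure)
      ≤ ENNReal.ofReal (t ^ 2) * M.secondMoment ψ := by
  obtain ⟨N, hN, hN1, hNf⟩ := hM.exists_charOp t
  refine le_trans (ENNReal.ofReal_le_ofReal ?_) (M.ofReal_le_secondMoment ψ t)
  rw [integral_norm_diff_sq, ← hN]
  linarith [re_inner_charOp_le hNf hN1 ψ]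

/-- The Dirichlet bound for the difference quotients, in extended nonnegative numbers. -/
theorem dirichlet_bound_ennreal (hL : 0 < L) {u : ℝ → ℂ} (hu : MemLp u 2)
    (hs : ∀ x, x ∉ Set.Icc (-L) L → u x = 0) {E : ℝ≥0∞}
    (h : ∀ t, 0 < t → ENNReal.ofReal (∫ x, ‖u (x + t) - u x‖ ^ 2 ∂normMeasure)
      ≤ ENNReal.ofReal (t ^ 2) * E) :
    ENNReal.ofReal (freq L 0 ^ 2 * ∫ x, ‖u x‖ ^ 2 ∂normMeasure) ≤ E ∧
    (E ≤ ENNReal.ofReal (freq L 0 ^ 2 * ∫ x, ‖u x‖ ^ 2 ∂normMeasure) →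
      ∃ κ : ℂ, ∀ᵐ x, x ∈ Set.Icc (-L) L → u x = κ * (Real.cos (freq L 0 * x) : ℂ)) := by
  set c : ℝ := Real.sqrt (2 * Real.pi) with hc
  have hc0 : 0 < c := by positivity
  -- Passing from `dx/√(2π)` to Lebesgue measure multiplies the constant by `c`. The bound uses `C =
  -- E`, when finite; the equality case uses the lower bound itself as `C`.
  have key : ∀ C : ℝ, 0 ≤ C → E ≤ ENNReal.ofReal C →
      ∀ t, 0 < t → ∫ x, ‖u (x + t) - u x‖ ^ 2 ≤ (c * C) * t ^ 2 := by
    intro C hC hE t ht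
    have h1 := (h t ht).trans (mul_le_mul_right hE _)
    rw [← ENNReal.ofReal_mul (by positivity), ENNReal.ofReal_le_ofReal_iff (by positivity),
      integral_normMeasure_real, one_div_mul_eq_div, div_le_iff₀ hc0] at h1
    linarith
  refine ⟨?_, fun hE => ?_⟩
  · by_cases hE : E = ∞
    · rw [hE]; exact le_top
    · have h1 := dirichlet_bound hL hu hs (key E.toReal ENNReal.toReal_nonneg
        (ENNReal.ofReal_toReal hE).ge)
      refine (ENNReal.ofReal_le_iff_le_toReal hE).2 ?_
      rw [integral_normMeasure_real, mul_left_comm, one_div_mul_eq_div, div_le_iff₀ hc0]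
      linarith
  · refine dirichlet_eq hL hu hs fun t ht => ?_
    refine (key _ ?_ hE t ht).trans (le_of_eq ?_)
    · exact mul_nonneg (sq_nonneg _) (integral_nonneg fun x => by positivity)
    · rw [integral_normMeasure_real, ← hc]
      field_simp

end Wave

/-! ### The canonical measurement -/

section Canonical

variable {L : ℝ}

theorem memLp_invFourier (φ : WaveSpace L) : MemLp (invFourier φ) 2 normMeasure := by
  have : invFourier φ = lineFourier (extend φ) := funext (invFourier_eq_lineFourier φ)
  rw [this]
  exact memLp_lineFourier (integrable_extend φ) (memLp_extend φ)

theorem continuous_invFourier (φ : WaveSpace L) : Continuous (invFourier φ) := by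
  have : invFourier φ = lineFourier (extend φ) := funext (invFourier_eq_lineFourier φ)
  rw [this]
  exact continuous_lineFourier (integrable_extend φ)

theorem integral_invFourier_mul (φ ψ : WaveSpace L) :
    ∫ g, invFourier ψ g * (starRingEnd ℂ) (invFourier φ g) ∂normMeasure = ⟪φ, ψ⟫_ℂ := by
  simp only [invFourier_eq_lineFourier]
  rw [inner_eq_integral_extend, integral_lineFourier_mul (integrable_extend φ) (memLp_extend φ)
    (integrable_extend ψ) (memLp_extend ψ)]

theorem integral_norm_invFourier_sq (φ : WaveSpace L) :
    ∫ g, ‖invFourier φ g‖ ^ 2 ∂normMeasure = ‖φ‖ ^ 2 := by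
  simp only [invFourier_eq_lineFourier]
  rw [norm_sq_eq_integral_extend,
    integral_norm_lineFourier_sq (integrable_extend φ) (memLp_extend φ)]

theorem inner_phaseRep_unitWave (ψ : WaveSpace L) (g : ℝ) :
    ⟪(phaseRep L g : WaveSpace L →L[ℂ] WaveSpace L) (unitWave L), ψ⟫_ℂ = invFourier ψ g := by
  rw [inner_eq_integral_extend, invFourier_eq_lineFourier, lineFourier]
  refine integral_congr_ae ?_
  rw [Filter.EventuallyEq, ae_normMeasure]
  filter_upwards [extend_phaseRep g (unitWave L), extend_unitWave (L := L)] with x h1 h2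
  rw [h1, h2]
  by_cases hx : x ∈ Set.Icc (-L) L
  · simp only [hx, Set.indicator_of_mem, mul_one]
    rw [mul_comm, character, ← Complex.exp_conj]
    congr 2
    simp
  · simp [hx, extend_of_notMem ψ hx]

theorem invFourier_add (φ ψ : WaveSpace L) (g : ℝ) :
    invFourier (φ + ψ) g = invFourier φ g + invFourier ψ g := by
  simp only [← inner_phaseRep_unitWave, inner_add_right]

theorem invFourier_smul (c : ℂ) (φ : WaveSpace L) (g : ℝ) :
    invFourier (c • φ) g = c * invFourier φ g := by
  simp only [← inner_phaseRep_unitWave, inner_smul_right]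

/-- The inverse Fourier transform, restricted to a set. -/
def fourierOn (L : ℝ) (B : Set ℝ) : WaveSpace L →L[ℂ] Lp ℂ 2 (normMeasure.restrict B) :=
  LinearMap.mkContinuous
    { toFun := fun φ => ((memLp_invFourier φ).restrict B).toLp _
      map_add' := fun φ ψ => by
        rw [← MemLp.toLp_add, MemLp.toLp_eq_toLp_iff]
        exact Filter.Eventually.of_forall fun g => invFourier_add φ ψ g
      map_smul' := fun c φ => by
        rw [RingHom.id_apply, ← MemLp.toLp_const_smul, MemLp.toLp_eq_toLp_iff]
        exact Filter.Eventually.of_forall fun g => invFourier_smul c φ g } 1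
    (fun φ => by
      rw [one_mul]
      refine (pow_le_pow_iff_left₀ (norm_nonneg _) (norm_nonneg _) two_ne_zero).1 ?_
      have h := L2.inner_def (𝕜 := ℂ) (((memLp_invFourier φ).restrict B).toLp _)
        (((memLp_invFourier φ).restrict B).toLp _)
      rw [inner_self_eq_norm_sq_to_K] at h
      have h2 : ∫ g, ⟪((memLp_invFourier φ).restrict B).toLp _ g,
          ((memLp_invFourier φ).restrict B).toLp _ g⟫_ℂ ∂(normMeasure.restrict B)
          = ((∫ g in B, ‖invFourier φ g‖ ^ 2 ∂normMeasure : ℝ) : ℂ) := by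
        rw [← integral_normSq_eq]
        refine integral_congr_ae ?_
        filter_upwards [((memLp_invFourier φ).restrict B).coeFn_toLp] with g hg
        rw [hg, RCLike.inner_apply]
      rw [h2] at h
      have h3 : ‖((memLp_invFourier φ).restrict B).toLp _‖ ^ 2
          = ∫ g in B, ‖invFourier φ g‖ ^ 2 ∂normMeasure := by
        refine Complex.ofReal_injective ?_
        rw [← h]
        push_cast
        rfl
      change ‖((memLp_invFourier φ).restrict B).toLp _‖ ^ 2 ≤ _
      rw [h3, ← integral_norm_invFourier_sq φ]
      exact setIntegral_le_integral (integrable_normSq (memLp_invFourier φ))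
        (Filter.Eventually.of_forall fun g => by positivity))

theorem inner_fourierOn (B : Set ℝ) (φ ψ : WaveSpace L) :
    ⟪fourierOn L B φ, fourierOn L B ψ⟫_ℂ
      = ∫ g in B, invFourier ψ g * (starRingEnd ℂ) (invFourier φ g) ∂normMeasure := by
  rw [L2.inner_def]
  refine integral_congr_ae ?_
  filter_upwards [((memLp_invFourier φ).restrict B).coeFn_toLp,
    ((memLp_invFourier ψ).restrict B).coeFn_toLp] with g h1 h2
  change ⟪((memLp_invFourier φ).restrict B).toLp _ g,
    ((memLp_invFourier ψ).restrict B).toLp _ g⟫_ℂ = _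
  rw [h1, h2, RCLike.inner_apply]

theorem integrable_invFourier_mul (φ ψ : WaveSpace L) :
    Integrable (fun g => invFourier ψ g * (starRingEnd ℂ) (invFourier φ g)) normMeasure :=
  (memLp_invFourier ψ).integrable_mul (memLp_invFourier φ).star

theorem inner_adjoint_fourierOn (B : Set ℝ) (φ ψ : WaveSpace L) :
    ⟪φ, (ContinuousLinearMap.adjoint (fourierOn L B) ∘L fourierOn L B) ψ⟫_ℂ
      = ∫ g in B, invFourier ψ g * (starRingEnd ℂ) (invFourier φ g) ∂normMeasure := by
  rw [ContinuousLinearMap.comp_apply, ContinuousLinearMap.adjoint_inner_right, inner_fourierOn]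

/-- The canonical measurement. -/
def canonicalPOVM (L : ℝ) : POVM (WaveSpace L) where
  -- As `T† T`, with `T` the transform restricted to `B`, the effect is visibly positive; Plancherel
  -- makes the total the identity.
  toFun B := ContinuousLinearMap.adjoint (fourierOn L B) ∘L fourierOn L B
  isPositive B _ := ContinuousLinearMap.isPositive_adjoint_comp_self _
  map_univ := by
    ext1 ψ
    refine ext_inner_left ℂ fun φ => ?_
    rw [inner_adjoint_fourierOn, Measure.restrict_univ, integral_invFourier_mul]
    rfl
  hasSum_iUnion B hB hd φ ψ := by
    simp only [inner_adjoint_fourierOn]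
    exact hasSum_integral_iUnion hB hd (integrable_invFourier_mul φ ψ).integrableOn

theorem inner_canonicalPOVM (B : Set ℝ) (φ ψ : WaveSpace L) :
    ⟪φ, canonicalPOVM L B ψ⟫_ℂ
      = ∫ g in B, invFourier ψ g * (starRingEnd ℂ) (invFourier φ g) ∂normMeasure :=
  inner_adjoint_fourierOn B φ ψ

theorem isCanonical_canonicalPOVM : IsCanonical (canonicalPOVM L) := by
  intro B _ φ ψ
  have h : ∀ g, ⟪φ, ketbra ((phaseRep L g).1 (unitWave L)) ψ⟫_ℂ
      = invFourier ψ g * (starRingEnd ℂ) (invFourier φ g) := by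
    intro g
    rw [ketbra_apply, inner_smul_right, ← inner_conj_symm φ, inner_phaseRep_unitWave,
      inner_phaseRep_unitWave]
  simp only [h]
  exact ⟨(integrable_invFourier_mul φ ψ).integrableOn, inner_canonicalPOVM B φ ψ⟩

theorem measurePreserving_add_normMeasure (g : ℝ) :
    MeasurePreserving (fun x => g + x) normMeasure normMeasure :=
  ⟨measurable_const_add g, by
    rw [normMeasure, Measure.map_smul, (measurePreserving_add_left volume g).map_eq]⟩

theorem invFourier_star_phaseRep (g h : ℝ) (φ : WaveSpace L) :
    invFourier (star (phaseRep L g : WaveSpace L →L[ℂ] WaveSpace L) φ) h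
      = invFourier φ (g + h) := by
  rw [← inner_phaseRep_unitWave, ← inner_phaseRep_unitWave, ContinuousLinearMap.star_eq_adjoint,
    ContinuousLinearMap.adjoint_inner_right]
  congr 1
  exact phaseLin_phaseLin L g h _

theorem isCovariant_canonicalPOVM : (canonicalPOVM L).IsCovariant (phaseRep L) := by
  intro g B _
  ext1 ψ
  refine ext_inner_left ℂ fun φ => ?_
  rw [inner_canonicalPOVM, (measurePreserving_add_normMeasure g).setIntegral_image_emb
    (measurableEmbedding_addLeft g), mul_apply_eq_comp, mul_apply_eq_comp,
    ← ContinuousLinearMap.adjoint_inner_left, ← ContinuousLinearMap.star_eq_adjoint,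
    inner_canonicalPOVM]
  simp only [invFourier_star_phaseRep]

theorem secondMoment_canonicalPOVM (ψ : WaveSpace L) :
    (canonicalPOVM L).secondMoment ψ = waveError ψ := by
  have hm : Measurable fun g => ENNReal.ofReal (‖invFourier ψ g‖ ^ 2) :=
    ((continuous_invFourier ψ).norm.pow 2).measurable.ennreal_ofReal
  have h : (canonicalPOVM L).diag ψ
      = normMeasure.withDensity fun g => ENNReal.ofReal (‖invFourier ψ g‖ ^ 2) := by
    ext B hB
    rw [POVM.diag_apply _ _ hB, inner_canonicalPOVM, integral_normSq_eq, Complex.ofReal_re,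
      withDensity_apply _ hB, ofReal_integral_eq_lintegral_ofReal
        (integrable_normSq (memLp_invFourier ψ)).integrableOn
        (Filter.Eventually.of_forall fun g => by positivity)]
  rw [POVM.secondMoment, h, lintegral_withDensity_eq_lintegral_mul _ hm (by fun_prop), waveError]
  refine lintegral_congr fun g => ?_
  rw [Pi.mul_apply, mul_comm, ← ENNReal.ofReal_mul (by positivity)]

/-! ### Difference quotients and the variance of the inverse Fourier transform -/

theorem lineFourier_diff {u : ℝ → ℂ} (hu : Integrable u) (t g : ℝ) :
    lineFourier (fun x => u (x + t) - u x) g = (character t g - 1) * lineFourier u g := by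
  have h : ∀ f : ℝ → ℂ, lineFourier f g
      = ((1 / Real.sqrt (2 * Real.pi) : ℝ) : ℂ) * expInt f (-g) := by
    intro f
    rw [expInt_eq_lineFourier, neg_neg, ← mul_assoc, ← Complex.ofReal_mul,
      one_div_mul_cancel (by positivity)]
    simp
  have h2 : expInt (fun x => u (x + t) - u x) (-g)
      = expInt (fun x => u (x + t)) (-g) - expInt u (-g) := by
    simp only [expInt, mul_sub]
    exact integral_sub (integrable_exp_mul (hu.comp_add_right t) _) (integrable_exp_mul hu _)
  rw [h, h2, expInt_comp_add, h u, character]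
  have : -(Complex.I * (-g : ℝ) * t) = Complex.I * g * t := by push_cast; ring
  rw [this]
  ring

/-- Plancherel and `|e^{itg} - 1| ≤ |tg|`. In contrast with the bound for general covariant
measurements, `φ` itself appears and not `|φ|`, so the minimizer is unique up to a constant phase.
-/
theorem ofReal_diff_le_waveError (φ : WaveSpace L) (t : ℝ) :
    ENNReal.ofReal (∫ x, ‖extend φ (x + t) - extend φ x‖ ^ 2 ∂normMeasure)
      ≤ ENNReal.ofReal (t ^ 2) * waveError φ := by
  have h1 := (integrable_extend φ).comp_add_right t
  have h2 := memLp_comp_add (memLp_extend φ) t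
  have h3 := memLp_lineFourier (h1.sub (integrable_extend φ)) (h2.sub (memLp_extend φ))
  have h4 := integral_norm_lineFourier_sq (h1.sub (integrable_extend φ)) (h2.sub (memLp_extend φ))
  have h5 := ofReal_integral_eq_lintegral_ofReal (integrable_normSq h3)
    (Filter.Eventually.of_forall fun g => by positivity)
  rw [h4] at h5
  simp only [Pi.sub_apply] at h5
  rw [h5, waveError, ← lintegral_const_mul']
  swap
  · exact ENNReal.ofReal_ne_top
  refine lintegral_mono fun g => ?_
  rw [← ENNReal.ofReal_mul (by positivity)]
  refine ENNReal.ofReal_le_ofReal ?_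
  have h6 := lineFourier_diff (integrable_extend φ) t g
  rw [invFourier_eq_lineFourier]
  change ‖lineFourier (fun x => extend φ (x + t) - extend φ x) g‖ ^ 2 ≤ _
  rw [h6, norm_mul, mul_pow, ← mul_assoc]
  refine mul_le_mul_of_nonneg_right ?_ (by positivity)
  rw [← mul_pow, ← sq_abs (t * g)]
  refine pow_le_pow_left₀ (norm_nonneg _) ?_ 2
  have e : Complex.I * g * t = Complex.I * ((t * g : ℝ) : ℂ) := by push_cast; ring
  rw [character, e]
  exact Real.norm_exp_I_mul_ofReal_sub_one_le

theorem waveError_eq_of_norm_eq {φ χ : WaveSpace L}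
    (h : ∀ g : ℝ, |g| * ‖invFourier φ g‖ = ‖invFourier χ g‖) :
    waveError φ = ENNReal.ofReal (‖χ‖ ^ 2) := by
  rw [← integral_norm_invFourier_sq, ofReal_integral_eq_lintegral_ofReal
    (integrable_normSq (memLp_invFourier χ)) (Filter.Eventually.of_forall fun g => by positivity)]
  refine lintegral_congr fun g => ?_
  rw [← h, mul_pow, sq_abs]

end Canonical

/-! ### The sine wave -/

section Sine

variable {L : ℝ}

theorem integral_intervalMeasure_eq (hL : 0 < L) (f : ℝ → ℂ) :
    ∫ x, f x ∂(intervalMeasure L)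
      = ((1 / Real.sqrt (2 * Real.pi) : ℝ) : ℂ) * ∫ x in -L..L, f x := by
  rw [integral_intervalMeasure, integral_normMeasure, integral_indicator measurableSet_Icc,
    intervalIntegral.integral_of_le (by linarith), integral_Icc_eq_integral_Ioc]

theorem norm_sq_toLp (hL : 0 < L) {f : ℝ → ℝ}
    (hf : MemLp (fun x => (f x : ℂ)) 2 (intervalMeasure L)) :
    ‖hf.toLp _‖ ^ 2 = 1 / Real.sqrt (2 * Real.pi) * ∫ x in -L..L, f x ^ 2 := by
  refine Complex.ofReal_injective ?_
  have h := L2.inner_def (𝕜 := ℂ) (hf.toLp _) (hf.toLp _)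
  rw [inner_self_eq_norm_sq_to_K] at h
  have h2 : ∫ x, ⟪hf.toLp _ x, hf.toLp _ x⟫_ℂ ∂(intervalMeasure L)
      = ∫ x, ((f x ^ 2 : ℝ) : ℂ) ∂(intervalMeasure L) := by
    refine integral_congr_ae ?_
    filter_upwards [hf.coeFn_toLp] with x hx
    rw [hx, RCLike.inner_apply, Complex.conj_ofReal]
    push_cast
    ring
  rw [h2, integral_intervalMeasure_eq hL, intervalIntegral.integral_ofReal] at h
  rw [Complex.ofReal_mul, ← h]
  push_cast
  rfl

theorem invFourier_toLp (hL : 0 < L) {f : ℝ → ℂ} (hf : MemLp f 2 (intervalMeasure L)) (g : ℝ) :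
    invFourier (hf.toLp f) g = ((1 / Real.sqrt (2 * Real.pi) : ℝ) : ℂ)
      * ∫ x in -L..L, Complex.exp (-(Complex.I * x * g)) * f x := by
  rw [invFourier, ← integral_intervalMeasure_eq hL]
  refine integral_congr_ae ?_
  filter_upwards [hf.coeFn_toLp] with x hx
  rw [hx]

/-- The amplitude of the sine wave. -/
def sineAmp (L : ℝ) : ℝ := (2 * Real.pi) ^ (1 / 4 : ℝ) / Real.sqrt L

theorem sineAmp_pos (hL : 0 < L) : 0 < sineAmp L := by
  unfold sineAmp; positivity

theorem sineAmp_sq (hL : 0 < L) : sineAmp L ^ 2 = Real.sqrt (2 * Real.pi) / L := by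
  rw [sineAmp, div_pow, Real.sq_sqrt hL.le, ← Real.rpow_natCast, ← Real.rpow_mul (by positivity),
    Real.sqrt_eq_rpow]
  norm_num

theorem sineFun_eq (hL : 0 < L) (x : ℝ) : sineFun L x = sineAmp L * Real.cos (freq L 0 * x) := by
  rw [sineFun, sineAmp, ← Real.sin_add_pi_div_two, freq]
  congr 2
  simp only [mul_zero, add_zero]
  field_simp
  ring

theorem freq_zero_sq : freq L 0 ^ 2 = Real.pi ^ 2 / (4 * L ^ 2) := by
  rw [freq]; simp only [mul_zero, add_zero]; rw [div_pow]; ring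

theorem integral_cos_freq_sq (hL : 0 < L) : ∫ x in -L..L, Real.cos (freq L 0 * x) ^ 2 = L := by
  have hb := freq_pos hL le_rfl
  rw [intervalIntegral.integral_comp_mul_left (fun y => Real.cos y ^ 2) hb.ne', integral_cos_sq,
    mul_neg, freq_zero_mul hL, Real.cos_neg, Real.cos_pi_div_two, smul_eq_mul]
  have := freq_zero_mul hL
  field_simp
  linarith

theorem integral_sin_freq_sq (hL : 0 < L) : ∫ x in -L..L, Real.sin (freq L 0 * x) ^ 2 = L := by
  have hb := freq_pos hL le_rfl
  rw [intervalIntegral.integral_comp_mul_left (fun y => Real.sin y ^ 2) hb.ne', integral_sin_sq,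
    mul_neg, freq_zero_mul hL, Real.cos_neg, Real.cos_pi_div_two, smul_eq_mul]
  have := freq_zero_mul hL
  field_simp
  linarith

theorem norm_sineWave (hL : 0 < L) : ‖sineWave L‖ = 1 := by
  refine (pow_eq_one_iff_of_nonneg (norm_nonneg _) two_ne_zero).1 ?_
  rw [sineWave, norm_sq_toLp hL]
  simp only [sineFun_eq hL, mul_pow]
  rw [intervalIntegral.integral_const_mul, integral_cos_freq_sq hL, sineAmp_sq hL]
  field_simp

theorem memLp_sineDeriv (L : ℝ) :
    MemLp (fun x => ((-(sineAmp L * freq L 0) * Real.sin (freq L 0 * x) : ℝ) : ℂ)) 2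
      (intervalMeasure L) := by
  refine MemLp.of_bound (C := |sineAmp L * freq L 0|)
    (Continuous.aestronglyMeasurable (by fun_prop)) (Filter.Eventually.of_forall fun x => ?_)
  rw [Complex.norm_real, norm_mul, norm_neg]
  exact mul_le_of_le_one_right (norm_nonneg _) (Real.abs_sin_le_one _)

/-- The derivative of the sine wave on `[-L, L]`. -/
def sineDeriv (L : ℝ) : WaveSpace L := (memLp_sineDeriv L).toLp _

theorem norm_sineDeriv_sq (hL : 0 < L) : ‖sineDeriv L‖ ^ 2 = Real.pi ^ 2 / (4 * L ^ 2) := by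
  rw [sineDeriv, norm_sq_toLp hL, ← freq_zero_sq]
  simp only [mul_pow, neg_sq]
  rw [intervalIntegral.integral_const_mul, integral_sin_freq_sq hL, sineAmp_sq hL]
  field_simp

theorem hasDerivAt_exp_neg (g x : ℝ) :
    HasDerivAt (fun x : ℝ => Complex.exp (-(Complex.I * x * g)))
      (-(Complex.I * g) * Complex.exp (-(Complex.I * x * g))) x := by
  have h := ((((hasDerivAt_id x).ofReal_comp.const_mul Complex.I).mul_const (g : ℂ)).neg).cexp
  simp only [Complex.ofReal_one, mul_one] at h
  rw [mul_comm] at h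
  exact h

theorem hasDerivAt_cos_freq (b x : ℝ) :
    HasDerivAt (fun x : ℝ => (Real.cos (b * x) : ℂ)) (-(b * Real.sin (b * x)) : ℝ) x := by
  have h := ((hasDerivAt_id x).const_mul b).cos.ofReal_comp
  refine h.congr_deriv ?_
  simp [mul_comm]

theorem hasDerivAt_sin_freq (b x : ℝ) :
    HasDerivAt (fun x : ℝ => (Real.sin (b * x) : ℂ)) (b * Real.cos (b * x) : ℝ) x := by
  have h := ((hasDerivAt_id x).const_mul b).sin.ofReal_comp
  refine h.congr_deriv ?_
  simp [mul_comm]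

/-- Integration by parts; the cosine vanishes at `±L`, so there is no boundary term. For the sine in
the next lemma the boundary terms add up to `2 cos(Lg)`. -/
theorem integral_exp_mul_cos_freq (hL : 0 < L) (g : ℝ) :
    Complex.I * g * ∫ x in -L..L, Complex.exp (-(Complex.I * x * g)) * (Real.cos (freq L 0 * x) : ℂ)
      = -(freq L 0
        * ∫ x in -L..L, Complex.exp (-(Complex.I * x * g)) * (Real.sin (freq L 0 * x) : ℂ)) := by
  have h := intervalIntegral.integral_mul_deriv_eq_deriv_mul (a := -L) (b := L)
    (fun x _ => hasDerivAt_cos_freq (freq L 0) x) (fun x _ => hasDerivAt_exp_neg g x)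
    (Continuous.intervalIntegrable (by fun_prop) _ _)
    (Continuous.intervalIntegrable (by fun_prop) _ _)
  rw [mul_neg, freq_zero_mul hL, Real.cos_neg, Real.cos_pi_div_two] at h
  simp only [Complex.ofReal_zero, zero_mul, sub_zero, zero_sub] at h
  rw [← intervalIntegral.integral_const_mul, ← intervalIntegral.integral_const_mul, ← neg_inj,
    neg_neg, ← intervalIntegral.integral_neg]
  refine Eq.trans ?_ (h.trans ?_)
  · refine intervalIntegral.integral_congr fun x _ => ?_
    ring
  · rw [← intervalIntegral.integral_neg]
    refine intervalIntegral.integral_congr fun x _ => ?_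
    push_cast; ring

theorem integral_exp_mul_sin_freq (hL : 0 < L) (g : ℝ) :
    Complex.I * g * ∫ x in -L..L, Complex.exp (-(Complex.I * x * g)) * (Real.sin (freq L 0 * x) : ℂ)
      = freq L 0 * (∫ x in -L..L, Complex.exp (-(Complex.I * x * g))
        * (Real.cos (freq L 0 * x) : ℂ)) - 2 * Real.cos (L * g) := by
  have h := intervalIntegral.integral_mul_deriv_eq_deriv_mul (a := -L) (b := L)
    (fun x _ => hasDerivAt_sin_freq (freq L 0) x) (fun x _ => hasDerivAt_exp_neg g x)
    (Continuous.intervalIntegrable (by fun_prop) _ _)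
    (Continuous.intervalIntegrable (by fun_prop) _ _)
  rw [mul_neg, freq_zero_mul hL, Real.sin_neg, Real.sin_pi_div_two] at h
  have e1 : ∫ x in -L..L, (Real.sin (freq L 0 * x) : ℂ)
      * (-(Complex.I * g) * Complex.exp (-(Complex.I * x * g)))
      = -(Complex.I * g * ∫ x in -L..L, Complex.exp (-(Complex.I * x * g))
        * (Real.sin (freq L 0 * x) : ℂ)) := by
    rw [← intervalIntegral.integral_const_mul, ← intervalIntegral.integral_neg]
    refine intervalIntegral.integral_congr fun x _ => ?_
    ring
  have e2 : ∫ x in -L..L, ((freq L 0 * Real.cos (freq L 0 * x) : ℝ) : ℂ)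
      * Complex.exp (-(Complex.I * x * g))
      = freq L 0 * ∫ x in -L..L, Complex.exp (-(Complex.I * x * g))
        * (Real.cos (freq L 0 * x) : ℂ) := by
    rw [← intervalIntegral.integral_const_mul]
    refine intervalIntegral.integral_congr fun x _ => ?_
    push_cast; ring
  rw [e1, e2] at h
  have e3 : (2 * Real.cos (L * g) : ℂ) = Complex.exp (-(Complex.I * L * g))
      + Complex.exp (-(Complex.I * (-L : ℝ) * g)) := by
    rw [Complex.ofReal_cos, Complex.cos]
    have a1 : (((L * g : ℝ) : ℂ) * Complex.I) = -(Complex.I * (-L : ℝ) * g) := by push_cast; ring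
    have a2 : (-((L * g : ℝ) : ℂ) * Complex.I) = -(Complex.I * L * g) := by push_cast; ring
    rw [a1, a2]
    ring
  rw [e3, ← neg_inj, h]
  push_cast
  ring

theorem invFourier_sineWave (hL : 0 < L) (g : ℝ) :
    invFourier (sineWave L) g = ((1 / Real.sqrt (2 * Real.pi) : ℝ) : ℂ) * (sineAmp L
      * ∫ x in -L..L, Complex.exp (-(Complex.I * x * g)) * (Real.cos (freq L 0 * x) : ℂ)) := by
  rw [sineWave, invFourier_toLp hL (memLp_sineFun L)]
  congr 1
  rw [← intervalIntegral.integral_const_mul]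
  refine intervalIntegral.integral_congr fun x _ => ?_
  rw [sineFun_eq hL]
  push_cast
  ring

theorem invFourier_sineDeriv (hL : 0 < L) (g : ℝ) :
    invFourier (sineDeriv L) g = Complex.I * g * invFourier (sineWave L) g := by
  rw [invFourier_sineWave hL, mul_left_comm (Complex.I * (g : ℂ)), mul_left_comm (Complex.I * (g : ℂ)),
    integral_exp_mul_cos_freq hL, sineDeriv, invFourier_toLp hL]
  congr 1
  rw [← intervalIntegral.integral_const_mul, ← intervalIntegral.integral_neg,
    ← intervalIntegral.integral_const_mul]
  refine intervalIntegral.integral_congr fun x _ => ?_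
  push_cast
  ring

theorem waveError_sineWave (hL : 0 < L) :
    waveError (sineWave L) = ENNReal.ofReal (Real.pi ^ 2 / (4 * L ^ 2)) := by
  rw [← norm_sineDeriv_sq hL]
  refine waveError_eq_of_norm_eq fun g => ?_
  rw [invFourier_sineDeriv hL, norm_mul, norm_mul, Complex.norm_I, one_mul, Complex.norm_real,
    Real.norm_eq_abs]

theorem invFourier_sineWave_eq (hL : 0 < L) (g : ℝ) (hg : L ^ 2 * g ^ 2 - Real.pi ^ 2 / 4 ≠ 0) :
    invFourier (sineWave L) g =
      ((-(Real.pi ^ (3 / 4 : ℝ) * Real.sqrt L / 2 ^ (1 / 4 : ℝ)) *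
        (Real.cos (L * g) / (L ^ 2 * g ^ 2 - Real.pi ^ 2 / 4)) : ℝ) : ℂ) := by
  have h1 := integral_exp_mul_cos_freq hL g
  have h2 := integral_exp_mul_sin_freq hL g
  rw [invFourier_sineWave hL]
  set C := ∫ x in -L..L, Complex.exp (-(Complex.I * x * g)) * (Real.cos (freq L 0 * x) : ℂ)
  set S := ∫ x in -L..L, Complex.exp (-(Complex.I * x * g)) * (Real.sin (freq L 0 * x) : ℂ)
  -- The two integrations by parts are linear equations for `C` and `S`; eliminating `S` leaves this
  -- one.
  have h3 : ((g ^ 2 - freq L 0 ^ 2 : ℝ) : ℂ) * C = ((-(2 * freq L 0 * Real.cos (L * g)) : ℝ) : ℂ) := by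
    push_cast at h2 ⊢
    linear_combination ((g : ℂ) ^ 2 * C) * Complex.I_sq - (Complex.I * g) * h1
      + (freq L 0 : ℂ) * h2
  have hb : freq L 0 = Real.pi / (2 * L) := by rw [freq]; simp
  have hd : g ^ 2 - freq L 0 ^ 2 = (L ^ 2 * g ^ 2 - Real.pi ^ 2 / 4) / L ^ 2 := by
    rw [hb]; field_simp; ring
  have hd0 : g ^ 2 - freq L 0 ^ 2 ≠ 0 := by
    rw [hd]; exact div_ne_zero hg (by positivity)
  have h4 : C = ((-(2 * freq L 0 * Real.cos (L * g)) / (g ^ 2 - freq L 0 ^ 2) : ℝ) : ℂ) := by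
    rw [Complex.ofReal_div, ← h3, mul_div_cancel_left₀]
    exact_mod_cast hd0
  rw [h4, ← Complex.ofReal_mul, ← Complex.ofReal_mul]
  congr 1
  rw [hd, hb, sineAmp, Real.sqrt_eq_rpow, Real.mul_rpow (by norm_num) Real.pi_pos.le,
    Real.mul_rpow (by norm_num) Real.pi_pos.le]
  have hp1 : Real.pi ^ (3 / 4 : ℝ) * Real.pi ^ (1 / 2 : ℝ) = Real.pi * Real.pi ^ (1 / 4 : ℝ) := by
    rw [← Real.rpow_add Real.pi_pos, ← Real.rpow_one_add' Real.pi_pos.le (by norm_num)]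
    norm_num
  have hp2 : (2 : ℝ) ^ (1 / 4 : ℝ) * 2 ^ (1 / 4 : ℝ) = 2 ^ (1 / 2 : ℝ) := by
    rw [← Real.rpow_add two_pos]
    norm_num
  rw [← hp2]
  have hs : 0 < Real.sqrt L := Real.sqrt_pos.2 hL
  have hq1 : 0 < (2 : ℝ) ^ (1 / 4 : ℝ) := by positivity
  have hq2 : 0 < Real.pi ^ (1 / 2 : ℝ) := by positivity
  set D := L ^ 2 * g ^ 2 - Real.pi ^ 2 / 4
  set q := (2 : ℝ) ^ (1 / 4 : ℝ)
  set p := Real.pi ^ (1 / 2 : ℝ)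
  set K := Real.cos (L * g)
  have : Real.pi ^ (3 / 4 : ℝ) = Real.pi * Real.pi ^ (1 / 4 : ℝ) / p := by
    rw [← hp1, mul_div_cancel_right₀ _ hq2.ne']
  rw [this]
  field_simp
  rw [Real.sq_sqrt hL.le]

end Sine

/-! ### The quadratic form of the squared momentum -/

section Momentum

variable {L : ℝ}

theorem IsWeakDeriv.ae_eq_zero {φ : WaveSpace L} {v : ℝ → ℂ} (hv : MemLp v 2)
    (hw : IsWeakDeriv (extend φ) v) : ∀ᵐ x, x ∉ Set.Icc (-L) L → v x = 0 := by
  refine isClosed_Icc.isOpen_compl.ae_eq_zero_of_integral_contDiff_smul_eq_zero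
    ((hv.locallyIntegrable (by norm_num)).locallyIntegrableOn _) fun η hη hc hsub => ?_
  have h := hw η hη hc
  have h0 : ∫ x, ((deriv η x : ℝ) : ℂ) * extend φ x = 0 := by
    refine integral_eq_zero_of_ae (Filter.Eventually.of_forall fun x => ?_)
    by_cases hx : x ∈ Set.Icc (-L) L
    · have : deriv η x = 0 := by
        by_contra hne
        exact hsub (support_deriv_subset (Function.mem_support.2 hne)) hx
      simp [this]
    · simp [extend_of_notMem φ hx]
  rw [h0, eq_comm, neg_eq_zero] at h
  simpa only [Complex.real_smul] using h

/-- Both `extend φ` and `v` vanish almost everywhere outside `[-L, L]`. Multiplying `h` by a bump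
function equal to one near that interval therefore changes neither integral and supplies the compact
support. -/
theorem IsWeakDeriv.integral_deriv_mul {φ : WaveSpace L} {v : ℝ → ℂ} (hv : MemLp v 2)
    (hw : IsWeakDeriv (extend φ) v) {h : ℝ → ℝ} (hh : ContDiff ℝ (⊤ : ℕ∞) h) :
    ∫ x, ((deriv h x : ℝ) : ℂ) * extend φ x = -∫ x, ((h x : ℝ) : ℂ) * v x := by
  let β : ContDiffBump (0 : ℝ) := ⟨|L| + 1, |L| + 2, by positivity, by linarith⟩
  have h1 := hw (fun x => β x * h x) (β.contDiff.mul hh) β.hasCompactSupport.mul_right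
  have hone : ∀ x ∈ Set.Icc (-L) L, ∀ᶠ y in nhds x, β y = 1 := by
    intro x hx
    refine β.eventuallyEq_one_of_mem_ball ?_
    rw [mem_ball_zero_iff, Real.norm_eq_abs]
    have : |x| ≤ |L| := (abs_le.2 hx).trans (le_abs_self L)
    change |x| < |L| + 1
    linarith
  have e1 : ∫ x, ((deriv (fun x => β x * h x) x : ℝ) : ℂ) * extend φ x
      = ∫ x, ((deriv h x : ℝ) : ℂ) * extend φ x := by
    refine integral_congr_ae (Filter.Eventually.of_forall fun x => ?_)
    by_cases hx : x ∈ Set.Icc (-L) L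
    · have : (fun x => β x * h x) =ᶠ[nhds x] h := by
        filter_upwards [hone x hx] with y hy
        rw [hy, one_mul]
      simp only [this.deriv_eq]
    · simp [extend_of_notMem φ hx]
  have e2 : ∫ x, ((β x * h x : ℝ) : ℂ) * v x = ∫ x, ((h x : ℝ) : ℂ) * v x := by
    refine integral_congr_ae ?_
    filter_upwards [hw.ae_eq_zero hv] with x hz
    by_cases hx : x ∈ Set.Icc (-L) L
    · rw [(hone x hx).self_of_nhds, one_mul]
    · simp [hz hx]
  rwa [e1, e2] at h1

/-- Test functions are real, so the exponential is split into cosine and sine, each tested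
separately. -/
theorem IsWeakDeriv.lineFourier_eq {φ : WaveSpace L} {v : ℝ → ℂ} (hv : MemLp v 2)
    (hvi : Integrable v) (hw : IsWeakDeriv (extend φ) v) (g : ℝ) :
    lineFourier v g = Complex.I * g * lineFourier (extend φ) g := by
  have hc := hw.integral_deriv_mul hv (h := fun x => Real.cos (g * x)) (by fun_prop)
  have hs := hw.integral_deriv_mul hv (h := fun x => Real.sin (g * x)) (by fun_prop)
  have dc : ∀ x, deriv (fun x => Real.cos (g * x)) x = -(g * Real.sin (g * x)) := by
    intro x
    have h := ((hasDerivAt_id x).const_mul g).cos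
    refine h.deriv.trans ?_
    simp [mul_comm]
  have ds : ∀ x, deriv (fun x => Real.sin (g * x)) x = g * Real.cos (g * x) := by
    intro x
    have h := ((hasDerivAt_id x).const_mul g).sin
    refine h.deriv.trans ?_
    simp [mul_comm]
  simp only [dc, ds] at hc hs
  have bdd : ∀ {u : ℝ → ℂ} {k : ℝ → ℝ}, Integrable u → Continuous k → (∀ x, |k x| ≤ 1) →
      Integrable (fun x => (k x : ℂ) * u x) := by
    intro u k hu hk hk1
    refine hu.bdd_mul (c := 1) (Continuous.aestronglyMeasurable (by fun_prop))
      (Filter.Eventually.of_forall fun x => ?_)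
    rw [Complex.norm_real]
    exact hk1 x
  have split : ∀ {u : ℝ → ℂ}, Integrable u →
      ∫ x : ℝ, Complex.exp (-(Complex.I * x * g)) * u x
        = (∫ x, ((Real.cos (g * x) : ℝ) : ℂ) * u x)
          - Complex.I * ∫ x, ((Real.sin (g * x) : ℝ) : ℂ) * u x := by
    intro u hu
    rw [← integral_const_mul, ← integral_sub (bdd hu (by fun_prop) fun x => Real.abs_cos_le_one _)
      ((bdd hu (by fun_prop) fun x => Real.abs_sin_le_one _).const_mul _)]
    refine integral_congr_ae (Filter.Eventually.of_forall fun x => ?_)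
    have e : -(Complex.I * x * g) = (-(g * x : ℝ) : ℝ) * Complex.I := by push_cast; ring
    simp only
    rw [e, Complex.exp_mul_I, ← Complex.ofReal_cos, ← Complex.ofReal_sin, Real.cos_neg,
      Real.sin_neg]
    push_cast
    ring
  have ec : ∫ x, ((-(g * Real.sin (g * x)) : ℝ) : ℂ) * extend φ x
      = -(g * ∫ x, ((Real.sin (g * x) : ℝ) : ℂ) * extend φ x) := by
    rw [← integral_const_mul, ← integral_neg]
    refine integral_congr_ae (Filter.Eventually.of_forall fun x => ?_)
    simp only
    push_cast
    ring
  have es : ∫ x, ((g * Real.cos (g * x) : ℝ) : ℂ) * extend φ x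
      = g * ∫ x, ((Real.cos (g * x) : ℝ) : ℂ) * extend φ x := by
    rw [← integral_const_mul]
    refine integral_congr_ae (Filter.Eventually.of_forall fun x => ?_)
    simp only
    push_cast
    ring
  rw [ec] at hc
  rw [es] at hs
  rw [lineFourier, lineFourier, integral_normMeasure, integral_normMeasure, split hvi,
    split (integrable_extend φ)]
  linear_combination ((1 / Real.sqrt (2 * Real.pi) : ℝ) : ℂ) * (hc - Complex.I * hs
    + (g * ∫ x, ((Real.sin (g * x) : ℝ) : ℂ) * extend φ x) * Complex.I_sq)

/-- Every admissible `v` restricts to a wave function whose transform has modulus `|g| |F⁻¹[φ](g)|`,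
so its squared norm is exactly the variance. The inequality suffices, as the sine wave has an
explicit weak derivative. -/
theorem waveError_le_momentumForm (φ : WaveSpace L) : waveError φ ≤ momentumForm φ := by
  refine le_iInf fun v => le_iInf fun hv => le_iInf fun hw => ?_
  have hv' := memLp_normMeasure.1 hv
  have hχ : MemLp v 2 (intervalMeasure L) := hv.restrict _
  have hext : extend (hχ.toLp v) =ᵐ[volume] v := by
    filter_upwards [extend_ae_of_ae hχ.coeFn_toLp, hw.ae_eq_zero hv'] with x h1 h2
    rw [h1]
    by_cases hx : x ∈ Set.Icc (-L) L
    · simp [hx]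
    · simp [hx, h2 hx]
  have hvi : Integrable v := (integrable_extend (hχ.toLp v)).congr hext
  rw [waveError_eq_of_norm_eq (χ := hχ.toLp v), norm_sq_eq_integral_extend,
    ofReal_integral_eq_lintegral_ofReal
      (integrable_normSq (memLp_normMeasure.2 (memLp_extend _)))
      (Filter.Eventually.of_forall fun g => by positivity)]
  · refine le_of_eq (lintegral_congr_ae ?_)
    rw [Filter.EventuallyEq, ae_normMeasure]
    filter_upwards [hext] with x hx
    rw [hx, norm_mul, norm_neg, Complex.norm_I, one_mul]
  · intro g
    have h1 : invFourier (hχ.toLp v) g = lineFourier v g := by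
      rw [invFourier_eq_lineFourier]
      refine integral_congr_ae ?_
      rw [Filter.EventuallyEq, ae_normMeasure]
      filter_upwards [hext] with x hx
      rw [hx]
    rw [h1, hw.lineFourier_eq hv' hvi, invFourier_eq_lineFourier, norm_mul, norm_mul,
      Complex.norm_I, one_mul, Complex.norm_real, Real.norm_eq_abs]

theorem extend_sineWave (hL : 0 < L) : extend (sineWave L) =ᵐ[volume]
    (Set.Icc (-L) L).indicator fun x => (sineAmp L * Real.cos (freq L 0 * x) : ℂ) := by
  refine (extend_ae_of_ae (memLp_sineFun L).coeFn_toLp).trans ?_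
  simp only [sineFun_eq hL]
  push_cast
  rfl

theorem integral_mul_extend (hL : 0 < L) {φ : WaveSpace L} {f : ℝ → ℂ}
    (h : extend φ =ᵐ[volume] (Set.Icc (-L) L).indicator f) (η : ℝ → ℂ) :
    ∫ x, η x * extend φ x = ∫ x in -L..L, η x * f x := by
  rw [intervalIntegral.integral_of_le (by linarith), ← integral_Icc_eq_integral_Ioc,
    ← integral_indicator measurableSet_Icc]
  refine integral_congr_ae ?_
  filter_upwards [h] with x hx
  rw [hx]
  by_cases hm : x ∈ Set.Icc (-L) L
  · simp [hm]
  · simp [hm]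

/-- The zero extension is continuous at `±L`, where the cosine vanishes; integrating by parts on
`[-L, L]` leaves no boundary terms. -/
theorem isWeakDeriv_sineWave (hL : 0 < L) :
    IsWeakDeriv (extend (sineWave L)) (extend (sineDeriv L)) := by
  intro η hη _
  rw [integral_mul_extend hL (extend_sineWave hL),
    integral_mul_extend hL (φ := sineDeriv L) (extend_ae_of_ae (memLp_sineDeriv L).coeFn_toLp)]
  have hd : Differentiable ℝ η := hη.differentiable (by simp)
  have hcd : Continuous (deriv η) := hη.continuous_deriv (by simp)
  have h := intervalIntegral.integral_mul_deriv_eq_deriv_mul (a := -L) (b := L)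
    (fun x _ => (hasDerivAt_cos_freq (freq L 0) x).const_mul (sineAmp L : ℂ))
    (fun x _ => (hd x).hasDerivAt.ofReal_comp)
    (Continuous.intervalIntegrable (by fun_prop) _ _)
    (Continuous.intervalIntegrable (by fun_prop) _ _)
  rw [mul_neg, freq_zero_mul hL, Real.cos_neg, Real.cos_pi_div_two] at h
  simp only [Complex.ofReal_zero, mul_zero, zero_mul, sub_zero, zero_sub] at h
  refine Eq.trans ?_ (h.trans ?_)
  · refine intervalIntegral.integral_congr fun x _ => ?_
    ring
  · congr 1
    refine intervalIntegral.integral_congr fun x _ => ?_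
    push_cast
    ring

theorem momentumForm_smul_sineWave_le (hL : 0 < L) {c : ℂ} (hc : ‖c‖ = 1) :
    momentumForm (c • sineWave L) ≤ ENNReal.ofReal (Real.pi ^ 2 / (4 * L ^ 2)) := by
  refine iInf_le_of_le (fun x => c * extend (sineDeriv L) x) (iInf_le_of_le
    (memLp_normMeasure.2 ((memLp_extend _).const_mul c)) (iInf_le_of_le ?_ ?_))
  · intro η hη hηc
    have h := congrArg (fun z => c * z) (isWeakDeriv_sineWave hL η hη hηc)
    simp only [mul_neg, ← integral_const_mul] at h
    refine Eq.trans (integral_congr_ae ?_) (h.trans ?_)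
    · filter_upwards [extend_smul c (sineWave L)] with x hx
      rw [hx]; ring
    · congr 1
      refine integral_congr_ae (Filter.Eventually.of_forall fun x => ?_)
      ring
  · rw [← norm_sineDeriv_sq hL, norm_sq_eq_integral_extend, ofReal_integral_eq_lintegral_ofReal
      (integrable_normSq (memLp_normMeasure.2 (memLp_extend _)))
      (Filter.Eventually.of_forall fun g => by positivity)]
    refine le_of_eq (lintegral_congr fun x => ?_)
    rw [norm_mul, norm_mul, norm_neg, Complex.norm_I, hc, one_mul, one_mul]

end Momentum

/-! ### The optimal errors and the optimal states -/

section Optimal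

variable {L : ℝ}

/-- The minimal error. -/
def minError (L : ℝ) : ℝ := Real.pi ^ 2 / (4 * L ^ 2)

theorem minError_pos (hL : 0 < L) : 0 < minError L := by
  unfold minError; positivity

theorem waveError_bound (hL : 0 < L) (φ : WaveSpace L) :
    ENNReal.ofReal (minError L * ‖φ‖ ^ 2) ≤ waveError φ ∧
    (waveError φ ≤ ENNReal.ofReal (minError L * ‖φ‖ ^ 2) → ∃ κ : ℂ, φ = κ • sineWave L) := by
  have h := dirichlet_bound_ennreal hL (memLp_extend φ) (fun _ hx => extend_of_notMem φ hx)
    (E := waveError φ) (fun t _ => ofReal_diff_le_waveError φ t)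
  rw [← norm_sq_eq_integral_extend, freq_zero_sq] at h
  refine ⟨h.1, fun hE => ?_⟩
  obtain ⟨κ, hκ⟩ := h.2 hE
  refine ⟨κ / sineAmp L, ext_of_extend_ae ?_⟩
  have hA : (sineAmp L : ℂ) ≠ 0 := by exact_mod_cast (sineAmp_pos hL).ne'
  filter_upwards [hκ, extend_smul (κ / sineAmp L) (sineWave L), extend_sineWave hL]
    with x h1 h2 h3
  rw [h2, h3]
  by_cases hx : x ∈ Set.Icc (-L) L
  · rw [h1 hx, Set.indicator_of_mem hx]
    field_simp
  · simp [hx, extend_of_notMem φ hx]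

theorem eq_unit_smul_sineWave (hL : 0 < L) {φ : WaveSpace L} (hφ : ‖φ‖ = 1)
    (h : waveError φ ≤ ENNReal.ofReal (minError L)) :
    ∃ c : ℂ, ‖c‖ = 1 ∧ φ = c • sineWave L := by
  obtain ⟨c, hc⟩ := (waveError_bound hL φ).2 (by simpa [hφ] using h)
  refine ⟨c, ?_, hc⟩
  rwa [hc, norm_smul, norm_sineWave hL, mul_one] at hφ

theorem minError_le_waveError (hL : 0 < L) {φ : WaveSpace L} (hφ : ‖φ‖ = 1) :
    ENNReal.ofReal (minError L) ≤ waveError φ := by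
  simpa [hφ] using (waveError_bound hL φ).1

theorem waveError_smul (c : ℂ) (φ : WaveSpace L) :
    waveError (c • φ) = ENNReal.ofReal (‖c‖ ^ 2) * waveError φ := by
  rw [← secondMoment_canonicalPOVM, ← secondMoment_canonicalPOVM, POVM.secondMoment_smul]

theorem eq_norm_mul_of_ae {φ χ : WaveSpace L} (hχ : ‖χ‖ = 1) {r : ℝ} (hr : 0 ≤ r)
    (h : ∀ᵐ x, ‖extend φ x‖ = r * ‖extend χ x‖) : r = ‖φ‖ := by
  have h1 : ‖φ‖ ^ 2 = r ^ 2 := by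
    have e : ∫ x, ‖extend φ x‖ ^ 2 ∂normMeasure
        = ∫ x, r ^ 2 * ‖extend χ x‖ ^ 2 ∂normMeasure := by
      refine integral_congr_ae ?_
      rw [Filter.EventuallyEq, ae_normMeasure]
      filter_upwards [h] with x hx
      rw [hx, mul_pow]
    rw [norm_sq_eq_integral_extend, e, integral_const_mul, ← norm_sq_eq_integral_extend, hχ]
    ring
  exact ((pow_left_inj₀ (norm_nonneg _) hr two_ne_zero).1 h1).symm

/-- The Dirichlet bound applied to `|ψ|`. In the case of equality the proportionality constant is
identified as `‖ψ‖` by comparing norms. -/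
theorem secondMoment_bound (hL : 0 < L) {M : POVM (WaveSpace L)}
    (hM : M.IsCovariant (phaseRep L)) (ψ : WaveSpace L) :
    ENNReal.ofReal (minError L * ‖ψ‖ ^ 2) ≤ M.secondMoment ψ ∧
    (M.secondMoment ψ ≤ ENNReal.ofReal (minError L * ‖ψ‖ ^ 2) →
      ∀ᵐ x, ‖extend ψ x‖ = ‖ψ‖ * ‖extend (sineWave L) x‖) := by
  have hu : MemLp (fun x => ((‖extend ψ x‖ : ℝ) : ℂ)) 2 := (memLp_extend ψ).norm.ofReal
  have h := dirichlet_bound_ennreal hL hu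
    (fun _ hx => by simp [extend_of_notMem ψ hx])
    (E := M.secondMoment ψ) (fun t _ => hM.ofReal_norm_diff_le ψ t)
  simp only [Complex.norm_real, norm_norm] at h
  rw [← norm_sq_eq_integral_extend, freq_zero_sq] at h
  refine ⟨h.1, fun hE => ?_⟩
  obtain ⟨κ, hκ⟩ := h.2 hE
  have hA := sineAmp_pos hL
  have h1 : ∀ᵐ x, ‖extend ψ x‖ = ‖κ‖ / sineAmp L * ‖extend (sineWave L) x‖ := by
    filter_upwards [hκ, extend_sineWave hL] with x h1 h3
    rw [h3]
    by_cases hx : x ∈ Set.Icc (-L) L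
    · have h2 := congrArg norm (h1 hx)
      rw [Complex.norm_real, norm_norm, norm_mul] at h2
      rw [h2, Set.indicator_of_mem hx, norm_mul, Complex.norm_real (sineAmp L),
        Real.norm_of_nonneg hA.le]
      field_simp
    · simp [hx, extend_of_notMem ψ hx]
  have h2 := eq_norm_mul_of_ae (norm_sineWave hL) (by positivity) h1
  rwa [h2] at h1

theorem secondMoment_smul_le {M : POVM (WaveSpace L)} {x : WaveSpace L}
    (hx : M.secondMoment x ≤ ENNReal.ofReal (minError L * ‖x‖ ^ 2)) (c : ℂ) :
    M.secondMoment (c • x) ≤ ENNReal.ofReal (minError L * ‖c • x‖ ^ 2) := by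
  rw [M.secondMoment_smul, norm_smul, mul_pow, mul_left_comm, ENNReal.ofReal_mul (by positivity)]
  gcongr

/-- Excess over the bound is a nonnegative quadratic form. By the parallelogram law the excesses of
`x + y` and `x - y` sum to zero, so both vanish. -/
theorem secondMoment_add_le (hL : 0 < L) {M : POVM (WaveSpace L)}
    (hM : M.IsCovariant (phaseRep L)) {x y : WaveSpace L}
    (hx : M.secondMoment x ≤ ENNReal.ofReal (minError L * ‖x‖ ^ 2))
    (hy : M.secondMoment y ≤ ENNReal.ofReal (minError L * ‖y‖ ^ 2)) :
    M.secondMoment (x + y) ≤ ENNReal.ofReal (minError L * ‖x + y‖ ^ 2) := by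
  have hE := (minError_pos hL).le
  have h1 : M.secondMoment (x + y) + M.secondMoment (x - y)
      ≤ ENNReal.ofReal (minError L * ‖x + y‖ ^ 2) + ENNReal.ofReal (minError L * ‖x - y‖ ^ 2) := by
    have hp := parallelogram_law_with_norm ℂ x y
    have h2 : ∀ r : ℝ, (2 : ℝ≥0∞) * ENNReal.ofReal r = ENNReal.ofReal (2 * r) := fun r => by
      rw [ENNReal.ofReal_mul (by norm_num), ENNReal.ofReal_ofNat]
    rw [← ENNReal.ofReal_add (by positivity) (by positivity), M.secondMoment_add_sub]
    refine (mul_le_mul_right (add_le_add hx hy) 2).trans (le_of_eq ?_)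
    rw [← ENNReal.ofReal_add (by positivity) (by positivity), h2]
    congr 1
    linear_combination (-minError L) * hp
  have h3 := (secondMoment_bound hL hM (x - y)).1
  exact (ENNReal.add_le_add_iff_right ENNReal.ofReal_ne_top).1
    ((add_le_add le_rfl h3).trans h1)

/-- The vectors attaining the bound of a covariant measurement are proportional. -/
theorem exists_smul_of_secondMoment_le (hL : 0 < L) {M : POVM (WaveSpace L)}
    (hM : M.IsCovariant (phaseRep L)) {x y : WaveSpace L} (hx1 : ‖x‖ = 1)
    (hx : M.secondMoment x ≤ ENNReal.ofReal (minError L * ‖x‖ ^ 2))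
    (hy : M.secondMoment y ≤ ENNReal.ofReal (minError L * ‖y‖ ^ 2)) :
    ∃ c : ℂ, y = c • x := by
  refine ⟨⟪x, y⟫_ℂ, ?_⟩
  set z := y + (-⟪x, y⟫_ℂ) • x with hz
  have hzQ := secondMoment_add_le hL hM hy (secondMoment_smul_le hx (-⟪x, y⟫_ℂ))
  rw [← hz] at hzQ
  have hxz : ⟪x, z⟫_ℂ = 0 := by
    rw [hz, inner_add_right, inner_smul_right, inner_self_eq_norm_sq_to_K, hx1]
    simp
  -- The modulus of `x + z` fixes only the real part of the pointwise product of `z` and the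
  -- conjugate of `x`; `x + iz` fixes the imaginary part.
  have hI := secondMoment_smul_le hzQ Complex.I
  have hxI : ⟪x, Complex.I • z⟫_ℂ = 0 := by rw [inner_smul_right, hxz, mul_zero]
  have n1 := norm_add_sq_eq_norm_sq_add_norm_sq_of_inner_eq_zero x z hxz
  have n2 := norm_add_sq_eq_norm_sq_add_norm_sq_of_inner_eq_zero x (Complex.I • z) hxI
  rw [norm_smul, Complex.norm_I, one_mul] at n2
  rw [hx1] at n1 n2
  have hz0 : z = 0 := by
    by_contra hne
    have hr : 0 < ‖z‖ := norm_pos_iff.2 hne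
    have hs : ∀ᵐ t, ‖extend (sineWave L) t‖ = 0 := by
      filter_upwards [(secondMoment_bound hL hM x).2 hx, (secondMoment_bound hL hM z).2 hzQ,
        (secondMoment_bound hL hM _).2 (secondMoment_add_le hL hM hx hzQ),
        (secondMoment_bound hL hM _).2 (secondMoment_add_le hL hM hx hI), extend_add x z,
        extend_add x (Complex.I • z), extend_smul Complex.I z] with t h1 h2 h3 h4 e1 e2 e3
      rw [e1] at h3
      rw [e2, e3] at h4
      set s := ‖extend (sineWave L) t‖
      rw [hx1, one_mul] at h1
      have s1 : ‖extend x t‖ ^ 2 = s ^ 2 := by rw [h1]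
      have s2 : ‖extend z t‖ ^ 2 = ‖z‖ ^ 2 * s ^ 2 := by rw [h2, mul_pow]
      have s3 : ‖extend x t + extend z t‖ ^ 2 = (1 + ‖z‖ ^ 2) * s ^ 2 := by
        rw [h3, mul_pow, sq ‖x + z‖, n1]; ring
      have s4 : ‖extend x t + Complex.I * extend z t‖ ^ 2 = (1 + ‖z‖ ^ 2) * s ^ 2 := by
        rw [h4, mul_pow, sq ‖x + Complex.I • z‖, n2]; ring
      simp only [← Complex.normSq_eq_norm_sq, Complex.normSq_apply, Complex.add_re,
        Complex.add_im, Complex.mul_re, Complex.mul_im, Complex.I_re, Complex.I_im] at s1 s2 s3 s4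
      set a := (extend x t).re
      set b := (extend x t).im
      set c := (extend z t).re
      set d := (extend z t).im
      have t1 : a * c + b * d = 0 := by linarith
      have t2 : b * c - a * d = 0 := by linarith
      have t3 : ‖z‖ ^ 2 * (s ^ 2 * s ^ 2) = 0 := by
        have : (a * a + b * b) * (c * c + d * d) = 0 := by
          linear_combination (a * c + b * d) * t1 + (b * c - a * d) * t2
        rw [s1, s2] at this
        linarith
      have t4 : s ^ 2 * s ^ 2 = 0 := (mul_eq_zero.1 t3).resolve_left (by positivity)
      simpa using t4
    -- With the factor zero this says that the sine wave has norm zero.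
    have := eq_norm_mul_of_ae (φ := sineWave L) (norm_sineWave hL) le_rfl
      (hs.mono fun t ht => by rw [ht, mul_zero])
    rw [norm_sineWave hL] at this
    exact zero_ne_one this
  rw [hz, neg_smul, ← sub_eq_add_neg, sub_eq_zero] at hz0
  exact hz0

theorem tsum_ofReal_minError (hL : 0 < L) {ι : Type*} {f : ι → ℝ} (hf : ∀ j, 0 ≤ f j)
    (h : HasSum f 1) : ∑' j, ENNReal.ofReal (minError L * f j) = ENNReal.ofReal (minError L) := by
  have h2 := h.mul_left (minError L)
  rw [← ENNReal.ofReal_tsum_of_nonneg (fun j => mul_nonneg (minError_pos hL).le (hf j))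
    h2.summable, h2.tsum_eq, mul_one]

theorem minError_le_worstError (hL : 0 < L) {M : POVM (WaveSpace L)}
    (hM : M.IsCovariant (phaseRep L)) (ρ : DensityOperator (WaveSpace L)) :
    ENNReal.ofReal (minError L) ≤ worstError (phaseRep L) ρ M := by
  obtain ⟨S, hS, hsum⟩ := ρ.exists_factor
  rw [worstError_eq hM ρ S hS hsum, ← tsum_ofReal_minError hL (fun j => by positivity) hsum]
  exact ENNReal.tsum_le_tsum fun j => (secondMoment_bound hL hM _).1

/-- The error is a sum of terms with lower bounds of the same finite total, so every `S eⱼ` attains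
its bound. All of them are then multiples of one unit vector, and `ρ` is pure. -/
theorem exists_of_worstError_eq (hL : 0 < L) {M : POVM (WaveSpace L)}
    (hM : M.IsCovariant (phaseRep L)) {ρ : DensityOperator (WaveSpace L)}
    (h : worstError (phaseRep L) ρ M = ENNReal.ofReal (minError L)) :
    ∃ ψ : WaveSpace L, ‖ψ‖ = 1 ∧ ρ.op = ketbra ψ := by
  obtain ⟨S, hS, hsum⟩ := ρ.exists_factor
  have ht := tsum_ofReal_minError hL (fun j => by positivity) hsum
  rw [worstError_eq hM ρ S hS hsum] at h
  have hQ : ∀ j, M.secondMoment (S (onb _ j))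
      ≤ ENNReal.ofReal (minError L * ‖S (onb _ j)‖ ^ 2) := by
    intro j
    by_contra hlt
    have := ENNReal.tsum_lt_tsum (by rw [ht]; exact ENNReal.ofReal_ne_top)
      (fun j => (secondMoment_bound hL hM (S (onb _ j))).1) (not_le.1 hlt)
    rw [ht, h] at this
    exact lt_irrefl _ this
  have hex : ∃ j, S (onb _ j) ≠ 0 := by
    by_contra hall
    push Not at hall
    simp only [hall, norm_zero, ne_eq, OfNat.ofNat_ne_zero, not_false_eq_true, zero_pow] at hsum
    exact zero_ne_one (hasSum_zero.unique hsum)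
  obtain ⟨j₀, hj₀⟩ := hex
  set x := ((‖S (onb _ j₀)‖⁻¹ : ℝ) : ℂ) • S (onb _ j₀) with hx
  have hx1 : ‖x‖ = 1 := by
    rw [hx, norm_smul, Complex.norm_real, norm_inv, norm_norm,
      inv_mul_cancel₀ (norm_ne_zero_iff.2 hj₀)]
  exact ⟨x, hx1, op_eq_ketbra_of_forall hS hsum hx1 fun j =>
    exists_smul_of_secondMoment_le hL hM hx1 (secondMoment_smul_le (hQ j₀) _) (hQ j)⟩

theorem ketbra_smul {c : ℂ} (hc : ‖c‖ = 1) (φ : WaveSpace L) : ketbra (c • φ) = ketbra φ := by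
  ext1 x
  rw [ketbra_apply, ketbra_apply, inner_smul_left, smul_smul, mul_right_comm, mul_comm _ c,
    Complex.mul_conj, Complex.normSq_eq_norm_sq, hc]
  simp

theorem worstError_canonicalPOVM_eq_iff (hL : 0 < L) (ρ : DensityOperator (WaveSpace L)) :
    worstError (phaseRep L) ρ (canonicalPOVM L) = ENNReal.ofReal (minError L) ↔
      ρ.op = ketbra (sineWave L) := by
  constructor
  · intro h
    obtain ⟨ψ, hψ, hρ⟩ := exists_of_worstError_eq hL isCovariant_canonicalPOVM h
    rw [worstError_of_op_eq_ketbra isCovariant_canonicalPOVM hρ, secondMoment_canonicalPOVM] at h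
    obtain ⟨c, hc, rfl⟩ := eq_unit_smul_sineWave hL hψ h.le
    rw [hρ, ketbra_smul hc]
  · intro h
    rw [worstError_of_op_eq_ketbra isCovariant_canonicalPOVM h, secondMoment_canonicalPOVM,
      waveError_sineWave hL, minError]

/-! ### Conjugation of a measurement by a phase -/

/-- The measurement `B ↦ V† M(B) V` for an isometry `V`. -/
def POVM.conj {H : Type*} [NormedAddCommGroup H] [InnerProductSpace ℂ H] [CompleteSpace H]
    (M : POVM H) (V : H →L[ℂ] H) (hV : ∀ x y, ⟪V x, V y⟫_ℂ = ⟪x, y⟫_ℂ) : POVM H where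
  toFun B := ContinuousLinearMap.adjoint V ∘L M B ∘L V
  isPositive B hB := (M.isPositive B hB).adjoint_conj V
  map_univ := by
    ext1 y
    refine ext_inner_left ℂ fun x => ?_
    rw [M.map_univ, ContinuousLinearMap.comp_apply, ContinuousLinearMap.adjoint_inner_right]
    exact hV x y
  hasSum_iUnion B hB hd x y := by
    simp only [ContinuousLinearMap.comp_apply, ContinuousLinearMap.adjoint_inner_right]
    exact M.hasSum_iUnion B hB hd (V x) (V y)

theorem POVM.inner_conj {H : Type*} [NormedAddCommGroup H] [InnerProductSpace ℂ H]
    [CompleteSpace H] (M : POVM H) (V : H →L[ℂ] H) (hV : ∀ x y, ⟪V x, V y⟫_ℂ = ⟪x, y⟫_ℂ)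
    (B : Set ℝ) (x y : H) : ⟪x, M.conj V hV B y⟫_ℂ = ⟪V x, M B (V y)⟫_ℂ :=
  ContinuousLinearMap.adjoint_inner_right V x (M B (V y))

theorem POVM.secondMoment_conj {H : Type*} [NormedAddCommGroup H] [InnerProductSpace ℂ H]
    [CompleteSpace H] (M : POVM H) (V : H →L[ℂ] H) (hV : ∀ x y, ⟪V x, V y⟫_ℂ = ⟪x, y⟫_ℂ)
    (x : H) : (M.conj V hV).secondMoment x = M.secondMoment (V x) := by
  have : (M.conj V hV).diag x = M.diag (V x) := by
    ext B hB
    rw [POVM.diag_apply _ _ hB, POVM.diag_apply _ _ hB, M.inner_conj]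
  rw [POVM.secondMoment, this, POVM.secondMoment]

theorem POVM.IsCovariant.conj {H : Type*} [NormedAddCommGroup H] [InnerProductSpace ℂ H]
    [CompleteSpace H] {f : ℝ → unitary (H →L[ℂ] H)} {M : POVM H} (hM : M.IsCovariant f)
    (V : H →L[ℂ] H) (hV : ∀ x y, ⟪V x, V y⟫_ℂ = ⟪x, y⟫_ℂ)
    (hc : ∀ g x, V ((f g : H →L[ℂ] H) x) = (f g : H →L[ℂ] H) (V x)) :
    (M.conj V hV).IsCovariant f := by
  intro g B hB
  have hu : star (f g : H →L[ℂ] H) * (f g : H →L[ℂ] H) = 1 := (Unitary.mem_iff.1 (f g).2).1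
  have hu' : (f g : H →L[ℂ] H) * star (f g : H →L[ℂ] H) = 1 := (Unitary.mem_iff.1 (f g).2).2
  have hc' : ∀ x, V (star (f g : H →L[ℂ] H) x) = star (f g : H →L[ℂ] H) (V x) := by
    intro x
    have h1 := congrArg (fun T : H →L[ℂ] H => T (V (star (f g : H →L[ℂ] H) x))) hu
    have h2 := congrArg (fun T : H →L[ℂ] H => T x) hu'
    simp only [mul_apply_eq_comp, one_apply_eq_self] at h1 h2
    rw [← h1, ← hc, h2]
  ext1 y
  refine ext_inner_left ℂ fun x => ?_
  rw [mul_apply_eq_comp, mul_apply_eq_comp, ← ContinuousLinearMap.adjoint_inner_left,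
    ← ContinuousLinearMap.star_eq_adjoint, M.inner_conj, M.inner_conj, hc', hc', ← hM g B hB,
    mul_apply_eq_comp, mul_apply_eq_comp, ContinuousLinearMap.star_eq_adjoint,
    ContinuousLinearMap.adjoint_inner_left]

theorem memLp_unit_mul {θ : ℝ → ℂ} (hθ : Measurable θ) (h1 : ∀ x, ‖θ x‖ = 1) (φ : WaveSpace L) :
    MemLp (fun x => θ x * φ x) 2 (intervalMeasure L) := by
  refine (Lp.memLp φ).of_le (hθ.aestronglyMeasurable.mul (Lp.aestronglyMeasurable φ)) ?_
  filter_upwards with x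
  simp [h1]

/-- Multiplication by a measurable function of modulus one. -/
def unitMul (L : ℝ) {θ : ℝ → ℂ} (hθ : Measurable θ) (h1 : ∀ x, ‖θ x‖ = 1) :
    WaveSpace L →L[ℂ] WaveSpace L :=
  LinearMap.mkContinuous
    { toFun := fun φ => (memLp_unit_mul hθ h1 φ).toLp _
      map_add' := fun φ ψ => by
        rw [← MemLp.toLp_add, MemLp.toLp_eq_toLp_iff]
        filter_upwards [Lp.coeFn_add φ ψ] with x hx
        rw [hx, Pi.add_apply, mul_add]
        rfl
      map_smul' := fun c φ => by
        rw [RingHom.id_apply, ← MemLp.toLp_const_smul, MemLp.toLp_eq_toLp_iff]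
        filter_upwards [Lp.coeFn_smul c φ] with x hx
        simp only [hx, Pi.smul_apply, smul_eq_mul]
        ring } 1
    (fun φ => by
      rw [one_mul]
      refine Lp.norm_le_norm_of_ae_le ?_
      filter_upwards [(memLp_unit_mul hθ h1 φ).coeFn_toLp] with x hx
      change ‖(memLp_unit_mul hθ h1 φ).toLp _ x‖ ≤ _
      rw [hx, norm_mul, h1, one_mul])

theorem coeFn_unitMul {θ : ℝ → ℂ} (hθ : Measurable θ) (h1 : ∀ x, ‖θ x‖ = 1) (φ : WaveSpace L) :
    unitMul L hθ h1 φ =ᵐ[intervalMeasure L] fun x => θ x * φ x :=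
  (memLp_unit_mul hθ h1 φ).coeFn_toLp

theorem inner_unitMul {θ : ℝ → ℂ} (hθ : Measurable θ) (h1 : ∀ x, ‖θ x‖ = 1)
    (φ ψ : WaveSpace L) : ⟪unitMul L hθ h1 φ, unitMul L hθ h1 ψ⟫_ℂ = ⟪φ, ψ⟫_ℂ := by
  rw [L2.inner_def, L2.inner_def]
  refine integral_congr_ae ?_
  filter_upwards [coeFn_unitMul hθ h1 φ, coeFn_unitMul hθ h1 ψ] with x e1 e2
  have h := Complex.mul_conj (θ x)
  rw [Complex.normSq_eq_norm_sq, h1] at h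
  rw [e1, e2, RCLike.inner_apply, RCLike.inner_apply, map_mul]
  push_cast at h
  linear_combination (ψ x * (starRingEnd ℂ) (φ x)) * h

theorem unitMul_phaseRep {θ : ℝ → ℂ} (hθ : Measurable θ) (h1 : ∀ x, ‖θ x‖ = 1) (g : ℝ)
    (φ : WaveSpace L) :
    unitMul L hθ h1 ((phaseRep L g : WaveSpace L →L[ℂ] WaveSpace L) φ)
      = (phaseRep L g : WaveSpace L →L[ℂ] WaveSpace L) (unitMul L hθ h1 φ) := by
  change unitMul L hθ h1 (phaseLin L g φ) = phaseLin L g (unitMul L hθ h1 φ)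
  refine Lp.ext ?_
  filter_upwards [coeFn_unitMul hθ h1 (phaseLin L g φ), coeFn_phaseLin L g φ,
    coeFn_phaseLin L g (unitMul L hθ h1 φ), coeFn_unitMul hθ h1 φ] with x e1 e2 e3 e4
  rw [e1, e2, e3, e4]
  ring

theorem sineFun_nonneg (hL : 0 < L) {x : ℝ} (hx : x ∈ Set.Icc (-L) L) : 0 ≤ sineFun L x := by
  rw [sineFun_eq hL]
  refine mul_nonneg (sineAmp_pos hL).le (Real.cos_nonneg_of_mem_Icc ⟨?_, ?_⟩)
  · have := mul_le_mul_of_nonneg_left hx.1 (freq_pos hL le_rfl).le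
    rw [mul_neg, freq_zero_mul hL] at this
    exact this
  · have := mul_le_mul_of_nonneg_left hx.2 (freq_pos hL le_rfl).le
    rwa [freq_zero_mul hL] at this

theorem exists_unitMul_eq_sineWave (hL : 0 < L) {ψ : WaveSpace L}
    (h : ∀ᵐ x ∂(intervalMeasure L), ‖ψ x‖ = ‖sineWave L x‖) :
    ∃ (θ : ℝ → ℂ) (hθ : Measurable θ) (h1 : ∀ x, ‖θ x‖ = 1),
      unitMul L hθ h1 ψ = sineWave L := by
  have hm : Measurable ψ := (Lp.stronglyMeasurable ψ).measurable
  -- This `θ` turns `ψ` into `|ψ|`, which is the sine wave because the latter is nonnegative on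
  -- `[-L, L]`. The value one at zeros of `ψ` keeps the modulus equal to one everywhere.
  refine ⟨fun x => if ψ x = 0 then 1 else (starRingEnd ℂ) (ψ x) / (‖ψ x‖ : ℝ), ?_, ?_, ?_⟩
  · refine Measurable.ite (hm (measurableSet_singleton 0)) measurable_const ?_
    exact (Complex.continuous_conj.measurable.comp hm).div
      (Complex.measurable_ofReal.comp hm.norm)
  · intro x
    beta_reduce
    split_ifs with hx
    · simp
    · rw [norm_div, RCLike.norm_conj, Complex.norm_real, norm_norm,
        div_self (norm_ne_zero_iff.2 hx)]
  · refine Lp.ext ?_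
    have hI : ∀ᵐ x ∂(intervalMeasure L), x ∈ Set.Icc (-L) L := ae_restrict_mem measurableSet_Icc
    refine (coeFn_unitMul _ _ ψ).trans ?_
    filter_upwards [h, (memLp_sineFun L).coeFn_toLp, hI] with x hx hs hmem
    have hs' : sineWave L x = (sineFun L x : ℂ) := hs
    have e : (if ψ x = 0 then 1 else (starRingEnd ℂ) (ψ x) / (‖ψ x‖ : ℝ)) * ψ x
        = ((‖ψ x‖ : ℝ) : ℂ) := by
      split_ifs with h0
      · simp [h0]
      · have hne : ((‖ψ x‖ : ℝ) : ℂ) ≠ 0 := by exact_mod_cast norm_ne_zero_iff.2 h0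
        rw [div_mul_eq_mul_div, mul_comm, Complex.mul_conj, Complex.normSq_eq_norm_sq,
          div_eq_iff hne]
        push_cast
        ring
    rw [e, hx, hs', Complex.norm_real, Real.norm_of_nonneg (sineFun_nonneg hL hmem)]

/-- For the converse, the canonical measurement is conjugated by the phase that straightens `ψ`.
Multiplication operators commute with the representation, so covariance survives. -/
theorem exists_worstError_eq_iff (hL : 0 < L) (ρ : DensityOperator (WaveSpace L)) :
    (∃ M : POVM (WaveSpace L), M.IsCovariant (phaseRep L) ∧
      worstError (phaseRep L) ρ M = ENNReal.ofReal (minError L)) ↔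
    ∃ ψ : WaveSpace L, ρ.op = ketbra ψ ∧
      ∀ᵐ x ∂(intervalMeasure L), ‖ψ x‖ = ‖sineWave L x‖ := by
  constructor
  · rintro ⟨M, hM, h⟩
    obtain ⟨ψ, hψ, hρ⟩ := exists_of_worstError_eq hL hM h
    refine ⟨ψ, hρ, ?_⟩
    rw [worstError_of_op_eq_ketbra hM hρ] at h
    have := (secondMoment_bound hL hM ψ).2 (by rw [h, hψ]; simp)
    rw [ae_intervalMeasure_iff]
    filter_upwards [this] with x hx hmem
    rwa [hψ, one_mul, extend_of_mem ψ hmem, extend_of_mem _ hmem] at hx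
  · rintro ⟨ψ, hρ, hψ⟩
    obtain ⟨θ, hθ, h1, hs⟩ := exists_unitMul_eq_sineWave hL hψ
    have hM := isCovariant_canonicalPOVM.conj (unitMul L hθ h1) (inner_unitMul hθ h1)
      (unitMul_phaseRep hθ h1)
    refine ⟨_, hM, ?_⟩
    rw [worstError_of_op_eq_ketbra hM hρ, POVM.secondMoment_conj, hs, secondMoment_canonicalPOVM,
      waveError_sineWave hL, minError]

/-! ### Stochastic strategies -/

theorem tsum_pmf_mul (p : PMF ℕ) (c : ℝ≥0∞) : ∑' i, p i * c = c := by
  rw [ENNReal.tsum_mul_right, p.tsum_coe, one_mul]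

theorem minError_le_stochasticError (hL : 0 < L) (p : PMF ℕ)
    (ρ : ℕ → DensityOperator (WaveSpace L)) (M : ℕ → POVM (WaveSpace L))
    (hM : ∀ i, (M i).IsCovariant (phaseRep L)) :
    ENNReal.ofReal (minError L) ≤ stochasticError (phaseRep L) p ρ M := by
  rw [← tsum_pmf_mul p (ENNReal.ofReal (minError L))]
  exact ENNReal.tsum_le_tsum fun i => mul_le_mul_right (minError_le_worstError hL (hM i) (ρ i)) _

theorem stochasticError_eq_iff (hL : 0 < L) (p : PMF ℕ)
    (ρ : ℕ → DensityOperator (WaveSpace L)) (M : ℕ → POVM (WaveSpace L))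
    (hM : ∀ i, (M i).IsCovariant (phaseRep L)) :
    stochasticError (phaseRep L) p ρ M = ENNReal.ofReal (minError L) ↔
      ∀ i, p i ≠ 0 → worstError (phaseRep L) (ρ i) (M i) = ENNReal.ofReal (minError L) := by
  constructor
  · intro h i hi
    refine le_antisymm ?_ (minError_le_worstError hL (hM i) (ρ i))
    by_contra hlt
    have h1 : p i * ENNReal.ofReal (minError L) < p i * worstError (phaseRep L) (ρ i) (M i) :=
      (ENNReal.mul_lt_mul_iff_right hi (p.apply_ne_top i)).2 (not_le.1 hlt)
    have h2 := ENNReal.tsum_lt_tsum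
      (by rw [tsum_pmf_mul p]; exact ENNReal.ofReal_ne_top)
      (fun i => mul_le_mul_right (minError_le_worstError hL (hM i) (ρ i)) (p i)) h1
    rw [tsum_pmf_mul] at h2
    exact h2.ne' h
  · intro h
    rw [stochasticError, ← tsum_pmf_mul p (ENNReal.ofReal (minError L))]
    refine tsum_congr fun i => ?_
    by_cases hi : p i = 0
    · simp [hi]
    · rw [h i hi]

end Optimal

end GroupEstimation

end

theorem mainTheorem5 (L : ℝ) (hL : 0 < L) :
    -- Scheme 1
    IsLeast {e : ℝ≥0∞ | ∃ (ρ : GroupEstimation.DensityOperator (GroupEstimation.WaveSpace L))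
        (M : GroupEstimation.POVM (GroupEstimation.WaveSpace L)),
        M.IsCovariant (GroupEstimation.phaseRep L) ∧
        e = GroupEstimation.worstError (GroupEstimation.phaseRep L) ρ M}
      (ENNReal.ofReal (Real.pi ^ 2 / (4 * L ^ 2))) ∧
    -- Scheme 2
    IsLeast {e : ℝ≥0∞ | ∃ (p : PMF ℕ)
        (ρ : ℕ → GroupEstimation.DensityOperator (GroupEstimation.WaveSpace L))
        (M : ℕ → GroupEstimation.POVM (GroupEstimation.WaveSpace L)),
        (∀ i, (M i).IsCovariant (GroupEstimation.phaseRep L)) ∧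
        e = GroupEstimation.stochasticError (GroupEstimation.phaseRep L) p ρ M}
      (ENNReal.ofReal (Real.pi ^ 2 / (4 * L ^ 2))) ∧
    -- the minimum over normalized wave functions of the variance of the inverse Fourier transform
    IsLeast {e : ℝ≥0∞ | ∃ φ : GroupEstimation.WaveSpace L, ‖φ‖ = 1 ∧
        e = GroupEstimation.waveError φ}
      (ENNReal.ofReal (Real.pi ^ 2 / (4 * L ^ 2))) ∧
    -- the minimum over normalized wave functions of `⟨φ|P²|φ⟩`
    IsLeast {e : ℝ≥0∞ | ∃ φ : GroupEstimation.WaveSpace L, ‖φ‖ = 1 ∧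
        e = GroupEstimation.momentumForm φ}
      (ENNReal.ofReal (Real.pi ^ 2 / (4 * L ^ 2))) ∧
    -- the minimizer and its uniqueness, for wave functions
    ‖GroupEstimation.sineWave L‖ = 1 ∧
    (∀ φ : GroupEstimation.WaveSpace L, ‖φ‖ = 1 →
      (GroupEstimation.waveError φ = ENNReal.ofReal (Real.pi ^ 2 / (4 * L ^ 2)) ↔
        ∃ c : ℂ, ‖c‖ = 1 ∧ φ = c • GroupEstimation.sineWave L)) ∧
    (∀ φ : GroupEstimation.WaveSpace L, ‖φ‖ = 1 →
      (GroupEstimation.momentumForm φ = ENNReal.ofReal (Real.pi ^ 2 / (4 * L ^ 2)) ↔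
        ∃ c : ℂ, ‖c‖ = 1 ∧ φ = c • GroupEstimation.sineWave L)) ∧
    -- the minimizer and its uniqueness among all input states, for the canonical measurement
    (∃ M : GroupEstimation.POVM (GroupEstimation.WaveSpace L),
      GroupEstimation.IsCanonical M ∧ M.IsCovariant (GroupEstimation.phaseRep L) ∧
      ∀ ρ : GroupEstimation.DensityOperator (GroupEstimation.WaveSpace L),
        GroupEstimation.worstError (GroupEstimation.phaseRep L) ρ M
            = ENNReal.ofReal (Real.pi ^ 2 / (4 * L ^ 2)) ↔
          ρ.op = GroupEstimation.ketbra (GroupEstimation.sineWave L)) ∧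
    -- the optimal input states in Scheme 1, for arbitrary covariant measurements
    (∀ ρ : GroupEstimation.DensityOperator (GroupEstimation.WaveSpace L),
      (∃ M : GroupEstimation.POVM (GroupEstimation.WaveSpace L),
        M.IsCovariant (GroupEstimation.phaseRep L) ∧
        GroupEstimation.worstError (GroupEstimation.phaseRep L) ρ M
          = ENNReal.ofReal (Real.pi ^ 2 / (4 * L ^ 2))) ↔
      ∃ ψ : GroupEstimation.WaveSpace L, ρ.op = GroupEstimation.ketbra ψ ∧
        ∀ᵐ x ∂(GroupEstimation.intervalMeasure L), ‖ψ x‖ = ‖GroupEstimation.sineWave L x‖) ∧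
    -- the optimal strategies in Scheme 2
    (∀ (p : PMF ℕ) (ρ : ℕ → GroupEstimation.DensityOperator (GroupEstimation.WaveSpace L))
      (M : ℕ → GroupEstimation.POVM (GroupEstimation.WaveSpace L)),
      (∀ i, (M i).IsCovariant (GroupEstimation.phaseRep L)) →
      (GroupEstimation.stochasticError (GroupEstimation.phaseRep L) p ρ M
          = ENNReal.ofReal (Real.pi ^ 2 / (4 * L ^ 2)) ↔
        ∀ i, p i ≠ 0 → GroupEstimation.worstError (GroupEstimation.phaseRep L) (ρ i) (M i)
          = ENNReal.ofReal (Real.pi ^ 2 / (4 * L ^ 2)))) ∧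
    -- the inverse Fourier transform of the minimizer
    (∀ g : ℝ, L ^ 2 * g ^ 2 - Real.pi ^ 2 / 4 ≠ 0 →
      GroupEstimation.invFourier (GroupEstimation.sineWave L) g =
        ((-(Real.pi ^ (3 / 4 : ℝ) * Real.sqrt L / 2 ^ (1 / 4 : ℝ)) *
          (Real.cos (L * g) / (L ^ 2 * g ^ 2 - Real.pi ^ 2 / 4)) : ℝ) : ℂ)) := by
  have hwave := GroupEstimation.waveError_sineWave hL
  have hnorm := GroupEstimation.norm_sineWave hL
  -- The explicit weak derivative gives the upper bound; the lower bound comes through the variance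
  -- of the inverse Fourier transform.
  have hmom : ∀ c : ℂ, ‖c‖ = 1 →
      GroupEstimation.momentumForm (c • GroupEstimation.sineWave L)
        = ENNReal.ofReal (Real.pi ^ 2 / (4 * L ^ 2)) := fun c hc =>
    le_antisymm (GroupEstimation.momentumForm_smul_sineWave_le hL hc)
      ((GroupEstimation.minError_le_waveError hL (by rw [norm_smul, hc, hnorm, one_mul])).trans
        (GroupEstimation.waveError_le_momentumForm _))
  have hcov := GroupEstimation.isCovariant_canonicalPOVM (L := L)
  have hpure : GroupEstimation.worstError (GroupEstimation.phaseRep L)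
      (GroupEstimation.pureState (GroupEstimation.sineWave L) hnorm)
      (GroupEstimation.canonicalPOVM L) = ENNReal.ofReal (Real.pi ^ 2 / (4 * L ^ 2)) :=
    (GroupEstimation.worstError_canonicalPOVM_eq_iff hL _).2 rfl
  -- A point mass on the sine wave with the canonical measurement attains the stochastic minimum, so
  -- randomization brings no gain.
  refine ⟨⟨⟨_, _, hcov, hpure.symm⟩, ?_⟩, ⟨⟨PMF.pure 0, fun _ => _, fun _ => _, fun _ => hcov,
    ((GroupEstimation.stochasticError_eq_iff hL _ _ _ fun _ => hcov).2
      fun _ _ => hpure).symm⟩, ?_⟩, ⟨⟨_, hnorm, hwave.symm⟩, ?_⟩,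
    ⟨⟨_, hnorm, (one_smul ℂ (GroupEstimation.sineWave L) ▸ hmom 1 norm_one).symm⟩, ?_⟩, hnorm,
    fun φ hφ => ⟨fun h => GroupEstimation.eq_unit_smul_sineWave hL hφ h.le, ?_⟩,
    fun φ hφ => ⟨fun h => GroupEstimation.eq_unit_smul_sineWave hL hφ
      ((GroupEstimation.waveError_le_momentumForm φ).trans h.le), ?_⟩,
    ⟨_, GroupEstimation.isCanonical_canonicalPOVM, hcov,
      GroupEstimation.worstError_canonicalPOVM_eq_iff hL⟩,
    GroupEstimation.exists_worstError_eq_iff hL, GroupEstimation.stochasticError_eq_iff hL,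
    GroupEstimation.invFourier_sineWave_eq hL⟩
  · rintro _ ⟨ρ, M, hM, rfl⟩
    exact GroupEstimation.minError_le_worstError hL hM ρ
  · rintro _ ⟨p, ρ, M, hM, rfl⟩
    exact GroupEstimation.minError_le_stochasticError hL p ρ M hM
  · rintro _ ⟨φ, hφ, rfl⟩
    exact GroupEstimation.minError_le_waveError hL hφ
  · rintro _ ⟨φ, hφ, rfl⟩
    exact (GroupEstimation.minError_le_waveError hL hφ).trans
      (GroupEstimation.waveError_le_momentumForm φ)
  · rintro ⟨c, hc, rfl⟩
    rw [GroupEstimation.waveError_smul, hc, hwave]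
    simp
  · rintro ⟨c, hc, rfl⟩
    exact hmom c hc
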